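/- Setting. Let $n,r,q,m,\tilde m$ be positive integers. Let $\bm U$ be a random $n\times r$ matrix with orthonormal columns (of any distribution), and let $\bm b_1,\dots,\bm b_q$ be random vectors in $\mathbb R^r$, mutually independent and independent of $\bm U$, with $\bm b_k\sim\mathcal N(0,\bm\Lambda_k)$, $\bm\Lambda_k$ diagonal. Put $\bm x_k=\bm U\bm b_k$, $\bar{\bm\Lambda}=\frac1q\sum_{k=1}^q\bm\Lambda_k$, let $\bar\lambda_{\max}$ and $\bar\lambda_{\min}>0$ be the largest and smallest eigenvalues of $\bar{\bm\Lambda}$, and $\kappa=\bar\lambda_{\max}/\bar\lambda_{\min}$. Let $\bm a_{i,k}$ ($1\le i\le m$, $1\le k\le q$) and $\bm a_i^{new}$ ($1\le i\le\tilde m$) be iid $\mathcal N(0,\bm I)$ vectors in $\mathbb R^n$, independent of $(\bm U,\bm b_1,\dots,\bm b_q)$, and put $y_{i,k}=(\bm a_{i,k}'\bm x_k)^2$, $y^{new}_{i,k}=(\bm a_i^{new}{}'\bm x_k)^2$. Let $\hat{\bm U}$ be a matrix of top $r$ (orthonormal) eigenvectors of $$\bm Y_U=\frac1{mq}\sum_{i=1}^m\sum_{k=1}^q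 y_{i,k}\,\bm a_{i,k}\bm a_{i,k}'\,\mathbb 1\Big\{y_{i,k}\le \frac9m\sum_{i'=1}^m y_{i',k}\Big\},$$ let $\hat{\bm v}_k$ be a unit-norm top eigenvector of $\hat{\bm U}'\big(\frac1{\tilde m}\sum_i y^{new}_{i,k}\bm a_i^{new}\bm a_i^{new}{}'\big)\hat{\bm U}$, and put $\hat{\bm x}_k=\big(\frac1{\tilde m}\sum_i y^{new}_{i,k}\big)^{1/2}\hat{\bm U}\hat{\bm v}_k$. Write $\mathrm{SE}(\hat{\bm U},\bm U)=\|(\bm I-\hat{\bm U}\hat{\bm U}')\bm U\|$ (induced $l_2$ norm) and $\mathrm{dist}(\bm z_1,\bm z_2)=\min(\|\bm z_1-\bm z_2\|,\|\bm z_1+\bm z_2\|)$. Theorem. For all constants $c_r,c_\Lambda>0$ there are constants $C,c,C_1,C_2>0$, depending only on $c_r,c_\Lambda$, such that the following holds. Suppose that $r\le c_r n^{1/5}$, that $\lambda_{\max}(\bm\Lambda_k)\le c_\Lambda\bar\lambda_{\max}$ for all $k$, that $0<\varepsilon<1$, and that $$\tilde m\ge\frac{C\sqrt n}{\varepsilon^2},\quad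 m\ge\frac{C\kappa^2r^4(\log\tilde m)^2}{\varepsilon^2},\quad mq\ge\frac{C\kappa^2 n r^4(\log\tilde m)^2(\log n)^2}{\varepsilon^2},\quad q\ge\frac{C\kappa^2r^3(\log n)(\log\tilde m)^2}{\varepsilon^2}.$$ Then there is an event of probability at least $1-2\exp(-cn)-\frac{36q}{n^4}-\frac{20}{n^2}$ on which, for every choice of the eigenvectors above, 1. $\mathrm{SE}(\hat{\bm U},\bm U)\le\dfrac{C_1\varepsilon}{r\log\tilde m}$; 2. $\mathrm{dist}(\bm x_k,\hat{\bm x}_k)^2\le C_2\,\varepsilon\|\bm x_k\|^2$ for all $k=1,\dots,q$, and so $\dfrac{\sum_k\mathrm{dist}(\bm x_k,\hat{\bm x}_k)^2}{\sum_k\|\bm x_k\|^2}\le C_2\,\varepsilon$. Furthermore, for every $c_q>0$ there is $C_3>0$, depending only on $c_q,c_r,c_\Lambda$, such that if $q\le c_q n^2$ then the event can be chosen so that its probability is also at least $1-C_3/n^2$. -/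

import Mathlib

open MeasureTheory ProbabilityTheory

noncomputable section

namespace LRPR

/-- Largest eigenvalue of a real square matrix (used for symmetric matrices of positive size). -/
def lamMax {r : ℕ} (M : Matrix (Fin r) (Fin r) ℝ) : ℝ := sSup (spectrum ℝ M)

/-- Smallest eigenvalue of a real square matrix (used for symmetric matrices of positive size). -/
def lamMin {r : ℕ} (M : Matrix (Fin r) (Fin r) ℝ) : ℝ := sInf (spectrum ℝ M)

/-- The condition number `λ_max / λ_min`. -/
def condNumber {r : ℕ} (M : Matrix (Fin r) (Fin r) ℝ) : ℝ := lamMax M / lamMin M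

/-- `V` is a matrix of top `s` eigenvectors of the symmetric matrix `M`: its columns are the first
`s` columns of an orthogonal matrix `W` diagonalizing `M`, with the eigenvalues in decreasing
order. -/
def IsTopEigenvectors {n s : ℕ} (M : Matrix (Fin n) (Fin n) ℝ) (V : Matrix (Fin n) (Fin s) ℝ) :
    Prop :=
  ∃ (hs : s ≤ n) (μ : Fin n → ℝ) (W : Matrix (Fin n) (Fin n) ℝ),
    W.transpose * W = 1 ∧ Antitone μ ∧ M * W = W * Matrix.diagonal μ ∧
      ∀ i j, V i j = W i (Fin.castLE hs j)

/-- `v` is a unit-norm top eigenvector of `M`. -/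
def IsTopEigenvector {r : ℕ} (M : Matrix (Fin r) (Fin r) ℝ) (v : EuclideanSpace ℝ (Fin r)) :
    Prop :=
  ‖v‖ = 1 ∧ M.mulVec v.ofLp = lamMax M • v.ofLp

/-- The rank one matrix `a a'`. -/
def outer {n : ℕ} (a : EuclideanSpace ℝ (Fin n)) : Matrix (Fin n) (Fin n) ℝ :=
  Matrix.vecMulVec a.ofLp a.ofLp

/-- The product of a matrix and a vector, as a vector of a Euclidean space. -/
def mulE {n r : ℕ} (U : Matrix (Fin n) (Fin r) ℝ) (b : EuclideanSpace ℝ (Fin r)) :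
    EuclideanSpace ℝ (Fin n) :=
  WithLp.toLp 2 (U.mulVec b.ofLp)

/-- The phaseless measurement `(a'x)²`. -/
def meas {n : ℕ} (a x : EuclideanSpace ℝ (Fin n)) : ℝ := (inner ℝ a x) ^ 2

/-- The truncated matrix `Y_U`, the average over `i, k` of
`y_{i,k} a_{i,k} a_{i,k}' 1{y_{i,k} ≤ 9 (1/m) ∑_i y_{i,k}}`, where `y_{i,k} = (a_{i,k}'x_k)²`. -/
def matYU {n m q : ℕ} (a : Fin m → Fin q → EuclideanSpace ℝ (Fin n))
    (x : Fin q → EuclideanSpace ℝ (Fin n)) : Matrix (Fin n) (Fin n) ℝ :=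
  (1 / ((m : ℝ) * (q : ℝ))) • ∑ i, ∑ k,
    if meas (a i k) (x k) ≤ 9 * ((∑ i', meas (a i' k) (x k)) / (m : ℝ)) then
      meas (a i k) (x k) • outer (a i k)
    else 0

/-- The matrix `Y_{b,k} = Û' ((1/m̃) ∑_i y_{i,k}^new a_i^new a_i^new') Û`, for `x = x_k`. -/
def matYb {n r mt : ℕ} (anew : Fin mt → EuclideanSpace ℝ (Fin n))
    (Uhat : Matrix (Fin n) (Fin r) ℝ) (x : EuclideanSpace ℝ (Fin n)) :
    Matrix (Fin r) (Fin r) ℝ :=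
  Uhat.transpose * ((1 / (mt : ℝ)) • ∑ i, meas (anew i) x • outer (anew i)) * Uhat

/-- `(Û, x̂_1, …, x̂_q)` is an output of the spectral initialization with partitioned measurements
and known rank `r`: `Û` consists of top `r` eigenvectors of `Y_U`, and `x̂_k = Û (ν̂_k v̂_k)`, with
`v̂_k` a top eigenvector of `Y_{b,k}` and `ν̂_k = ((1/m̃) ∑_i y_{i,k}^new)^(1/2)`. -/
def IsOutput {n r m q mt : ℕ} (a : Fin m → Fin q → EuclideanSpace ℝ (Fin n))
    (anew : Fin mt → EuclideanSpace ℝ (Fin n)) (x : Fin q → EuclideanSpace ℝ (Fin n))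
    (Uhat : Matrix (Fin n) (Fin r) ℝ) (xhat : Fin q → EuclideanSpace ℝ (Fin n)) : Prop :=
  IsTopEigenvectors (matYU a x) Uhat ∧
    ∀ k, ∃ v : EuclideanSpace ℝ (Fin r), IsTopEigenvector (matYb anew Uhat (x k)) v ∧
      xhat k = mulE Uhat (Real.sqrt ((1 / (mt : ℝ)) * ∑ i, meas (anew i) (x k)) • v)

section SubspaceError

open scoped Matrix.Norms.L2Operator

/-- Subspace error `SE(Û, U) = ‖(I - Û Û') U‖`, in the induced `l₂` norm. -/
def SE {n r : ℕ} (Uhat U : Matrix (Fin n) (Fin r) ℝ) : ℝ :=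
  ‖(1 - Uhat * Uhat.transpose) * U‖

end SubspaceError

/-- Phase invariant distance: for real vectors the phase is `1` or `-1`. -/
def phaseDist {n : ℕ} (z₁ z₂ : EuclideanSpace ℝ (Fin n)) : ℝ := min ‖z₁ - z₂‖ ‖z₁ + z₂‖

/-- Normalized error `(∑_k dist(x_k, x̂_k)²) / (∑_k ‖x_k‖²)`. -/
def normErr {n q : ℕ} (x xhat : Fin q → EuclideanSpace ℝ (Fin n)) : ℝ :=
  (∑ k, phaseDist (x k) (xhat k) ^ 2) / ∑ k, ‖x k‖ ^ 2

/-- The average covariance `Λ̄ = (1/q) ∑_k Λ_k`. -/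
def avgCov {r q : ℕ} (Λ : Fin q → Matrix (Fin r) (Fin r) ℝ) : Matrix (Fin r) (Fin r) ℝ :=
  (1 / (q : ℝ)) • ∑ k, Λ k

/-- The Gaussian signal model: `U` is a random matrix with orthonormal columns (of any
distribution), the `b_k` are independent `N(0, Λ_k)` vectors with `Λ_k` diagonal, independent of
`U`, and `λ_max(Λ_k) ≤ c λ_max(Λ̄)`. The signals are `x_k = U b_k`. -/
structure IsGaussianSignal {Ω : Type*} [MeasurableSpace Ω] (P : Measure Ω) {n r q : ℕ}
    (U : Ω → Matrix (Fin n) (Fin r) ℝ) (b : Fin q → Ω → EuclideanSpace ℝ (Fin r))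
    (Λ : Fin q → Matrix (Fin r) (Fin r) ℝ) (c : ℝ) : Prop where
  measurable_U : Measurable (fun ω i j => U ω i j)
  orthonormal_U : ∀ᵐ ω ∂P, (U ω).transpose * U ω = 1
  isDiag : ∀ k, (Λ k).IsDiag
  posSemidef : ∀ k, (Λ k).PosSemidef
  measurable_b : ∀ k, Measurable (b k)
  law_b : ∀ k, P.map (b k) = multivariateGaussian 0 (Λ k)
  indep_b : iIndepFun b P
  indep_U_b : IndepFun (fun ω i j => U ω i j) (fun ω k => b k ω) P
  lamMax_le : ∀ k, lamMax (Λ k) ≤ c * lamMax (avgCov Λ)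

/-- The measurement vectors: `a_{i,k}` are iid standard Gaussian, `a_i^new` are iid standard
Gaussian, and the two sets are independent. -/
structure IsMeasurementModel {Ω : Type*} [MeasurableSpace Ω] (P : Measure Ω) {n m q mt : ℕ}
    (a : Fin m → Fin q → Ω → EuclideanSpace ℝ (Fin n))
    (anew : Fin mt → Ω → EuclideanSpace ℝ (Fin n)) : Prop where
  measurable_a : ∀ i k, Measurable (a i k)
  measurable_anew : ∀ i, Measurable (anew i)
  law_a : ∀ i k, P.map (a i k) = multivariateGaussian 0 1
  law_anew : ∀ i, P.map (anew i) = multivariateGaussian 0 1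
  indep_a : iIndepFun (fun p : Fin m × Fin q => a p.1 p.2) P
  indep_anew : iIndepFun anew P
  indep_a_anew : IndepFun (fun ω (p : Fin m × Fin q) => a p.1 p.2 ω) (fun ω i => anew i ω) P

end LRPR

end

noncomputable section

namespace LRPR

/-! Write e_k for the direction of x_k. The truncation in Y_U sees a_{i,k} only through the
components along e_k. Conditionally on these, the component of a_{i,k} along a direction orthogonal
to e_k is still standard Gaussian. Hence Y_U = αI + U M U' + F, where α (`bulk`) is the average
truncated measurement, M is the average of s_k b_k b_k' with s_k = `spike`, and F has conditional
mean zero. Neither α nor s_k is replaced by its expectation: the value of α does not affect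
eigenvectors, and of s_k only the lower bound 1/16 is used.

For a fixed unit w, truncation bounds the coefficients of w'Fw, a conditionally quadratic polynomial
in independent Gaussians. Chernoff's bound (`measure_pi_fluctuation_le`) and a net of at most 5^n
points (`quadForm_le_of_net`) control F uniformly. The Gaussian b_k have empirical covariance at
least half of λ_min, so M ≥ γ = λ_min/32. A sin-theta argument (`IsPerturbedSpike.residual_le`) then
bounds SE by φ/(γ - φ), where |F| ≤ φ.

For the second stage, Û is independent of the new measurements, so only an r-dimensional compression
of the new matrix has to be controlled. Its entries are averages of a fourth-order Gaussian chaos,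
which has no exponential moments; Markov's inequality for the 100th moment
(`exists_measure_not_newGood_le`) suffices. Indeed m̃ε²/r² is at least a multiple of n^(1/10), whose
50th power is of order n^5, enough for r² entries and failure O(n^-4) per signal. Comparing the top
eigenvector with Û'x_k gives the error of x̂_k (`phaseDist_output_le`).

The conclusion concerns every choice of eigenvectors, with no measurable selection. The spectral gap
makes ÛÛ' independent of the choice and equal to a measurable function of Y_U and α (`specProj`), so
Fubini applies to the projector. The good event is built in three stages, (U, b), then a, then
a^new, each conditional on the previous ones (`exists_event_output_le`). -/

/-! ### One-dimensional Gaussian moments and Chernoff bounds -/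

theorem integral_even_pow_gaussianReal (k : ℕ) :
    ∫ x, x ^ (2 * k) ∂gaussianReal 0 1 = 2 ^ k * Real.Gamma (k + 1 / 2) / √Real.pi := by
  have hpi := Real.pi_pos
  rw [integral_gaussianReal_eq_integral_smul one_ne_zero]
  have h1 : ∀ x : ℝ, gaussianPDFReal 0 1 x • x ^ (2 * k)
      = (√(2 * Real.pi))⁻¹ * (|x| ^ ((2 * k : ℕ) : ℝ) * Real.exp (-(1 / 2) * |x| ^ (2 : ℝ))) := by
    intro x
    simp only [gaussianPDFReal, NNReal.coe_one, smul_eq_mul, Real.rpow_natCast, Real.rpow_two,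
      sq_abs, mul_one, sub_zero]
    rw [Even.pow_abs ⟨k, by ring⟩, show -x ^ 2 / 2 = -(1 / 2) * x ^ 2 by ring]
    ring
  simp_rw [h1]
  rw [integral_const_mul, integral_comp_abs
    (f := fun x : ℝ => x ^ ((2 * k : ℕ) : ℝ) * Real.exp (-(1 / 2) * x ^ (2 : ℝ))),
    integral_rpow_mul_exp_neg_mul_rpow (by norm_num)
      (lt_of_lt_of_le (by norm_num) (Nat.cast_nonneg _)) (by norm_num)]
  have h2 : (((2 * k : ℕ) : ℝ) + 1) / 2 = k + 1 / 2 := by push_cast; ring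
  have h3 : (1 / 2 : ℝ) ^ (-(((2 * k : ℕ) : ℝ) + 1) / 2) = 2 ^ k * √2 := by
    rw [neg_div, h2, one_div, Real.inv_rpow (by norm_num), Real.rpow_neg (by norm_num), inv_inv,
      Real.rpow_add (by norm_num), Real.rpow_natCast, Real.sqrt_eq_rpow, one_div]
  rw [h2, h3, Real.sqrt_mul (by norm_num)]
  field_simp

theorem integral_sq_gaussianReal : ∫ x, x ^ 2 ∂gaussianReal 0 1 = 1 := by
  have := integral_even_pow_gaussianReal 1
  rw [Real.Gamma_nat_add_half] at this
  have hpi : √Real.pi ≠ 0 := (Real.sqrt_pos.2 Real.pi_pos).ne'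
  norm_num [Nat.doubleFactorial] at this
  rw [this]; field_simp

theorem integral_pow_four_gaussianReal : ∫ x, x ^ 4 ∂gaussianReal 0 1 = 3 := by
  have := integral_even_pow_gaussianReal 2
  rw [Real.Gamma_nat_add_half] at this
  have hpi : √Real.pi ≠ 0 := (Real.sqrt_pos.2 Real.pi_pos).ne'
  norm_num [Nat.doubleFactorial] at this
  rw [this]; field_simp

theorem integral_pow_six_gaussianReal : ∫ x, x ^ 6 ∂gaussianReal 0 1 = 15 := by
  have := integral_even_pow_gaussianReal 3
  rw [Real.Gamma_nat_add_half] at this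
  have hpi : √Real.pi ≠ 0 := (Real.sqrt_pos.2 Real.pi_pos).ne'
  norm_num [Nat.doubleFactorial] at this
  rw [this]; field_simp

theorem integrable_pow_gaussianReal (k : ℕ) : Integrable (fun x : ℝ => x ^ k) (gaussianReal 0 1) :=
    by
  have h := memLp_id_gaussianReal' (μ := 0) (v := 1) (k : ENNReal) (by simp)
  rcases Nat.eq_zero_or_pos k with rfl | hk
  · simp
  exact (integrable_norm_iff (by fun_prop)).1 (by simpa using h.integrable_norm_pow hk.ne')

theorem lintegral_exp_mul_gaussianReal (t : ℝ) :
    ∫⁻ x, ENNReal.ofReal (Real.exp (t * x)) ∂gaussianReal 0 1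
      = ENNReal.ofReal (Real.exp (t ^ 2 / 2)) := by
  rw [← ofReal_integral_eq_lintegral_ofReal (integrable_exp_mul_gaussianReal t)
    (ae_of_all _ fun x => (Real.exp_pos _).le)]
  have := congrFun (mgf_fun_id_gaussianReal (μ := 0) (v := 1)) t
  simp only [mgf] at this
  rw [this]; simp

theorem lintegral_exp_mul_sq_gaussianReal {s : ℝ} (hs : s < 1 / 2) :
    ∫⁻ x, ENNReal.ofReal (Real.exp (s * x ^ 2)) ∂gaussianReal 0 1
      = ENNReal.ofReal (√(1 / (1 - 2 * s))) := by
  have hpi := Real.pi_pos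
  rw [gaussianReal_of_var_ne_zero _ one_ne_zero, lintegral_withDensity_eq_lintegral_mul _
    (measurable_gaussianPDF _ _) (by fun_prop)]
  have h1 : ∀ x : ℝ, (gaussianPDF 0 1 * fun x => ENNReal.ofReal (Real.exp (s * x ^ 2))) x
      = ENNReal.ofReal ((√(2 * Real.pi))⁻¹ * Real.exp (-(1 / 2 - s) * x ^ 2)) := by
    intro x
    simp only [Pi.mul_apply, gaussianPDF, gaussianPDFReal]
    rw [← ENNReal.ofReal_mul (by positivity), mul_assoc, ← Real.exp_add]
    congr 3
    · simp
    · simp; ring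
  simp_rw [h1]
  rw [← ofReal_integral_eq_lintegral_ofReal
    ((integrable_exp_neg_mul_sq (by linarith)).const_mul _) (ae_of_all _ fun x => by positivity),
    integral_const_mul, integral_gaussian, ← Real.sqrt_inv, ← Real.sqrt_mul (by positivity)]
  congr 2
  have : 1 - 2 * s ≠ 0 := by linarith
  have : 1 / 2 - s ≠ 0 := by linarith
  field_simp

/-- After squaring, the claim is 1 ≤ (1 - 2s) exp(2s + 4s²). For s < 0 the bound 1 + y ≤ exp y is
enough, since (1 + 2s + 4s²)(1 - 2s) = 1 - 8s³; for s ≥ 0 the quadratic Taylor term is needed. -/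
theorem sqrt_inv_one_sub_le {s : ℝ} (hs : |s| ≤ 1 / 4) :
    √(1 / (1 - 2 * s)) ≤ Real.exp (s + 2 * s ^ 2) := by
  obtain ⟨h1, h2⟩ := abs_le.1 hs
  have hpos : 0 < 1 - 2 * s := by linarith
  rw [Real.sqrt_le_left (Real.exp_pos _).le, ← Real.exp_nat_mul, div_le_iff₀ hpos]
  have h3 : 1 + (2 * s + 4 * s ^ 2) + (2 * s + 4 * s ^ 2) ^ 2 / 2 * 0 ≤
    Real.exp (2 * s + 4 * s ^ 2) := by
    have := Real.add_one_le_exp (2 * s + 4 * s ^ 2); linarith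
  have h5 : ((2 : ℕ) : ℝ) * (s + 2 * s ^ 2) = 2 * s + 4 * s ^ 2 := by push_cast; ring
  rw [h5]
  rcases le_or_gt 0 s with h | h
  · have h4 : 1 + (2 * s + 4 * s ^ 2) + (2 * s + 4 * s ^ 2) ^ 2 / 2 ≤
      Real.exp (2 * s + 4 * s ^ 2) := Real.quadratic_le_exp_of_nonneg (by positivity)
    have : 1 ≤ (1 + (2 * s + 4 * s ^ 2) + (2 * s + 4 * s ^ 2) ^ 2 / 2) * (1 - 2 * s) := by
      nlinarith [mul_nonneg h h, mul_nonneg (mul_nonneg h h) (sub_nonneg.2 h2),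
        mul_nonneg (mul_nonneg (mul_nonneg h h) h) (sub_nonneg.2 h2),
        mul_nonneg (mul_nonneg (mul_nonneg (mul_nonneg h h) h) h) (sub_nonneg.2 h2)]
    nlinarith
  · have : 1 ≤ (1 + (2 * s + 4 * s ^ 2)) * (1 - 2 * s) := by
      nlinarith [pow_pos (neg_pos.2 h) 3]
    nlinarith

/-- Cauchy–Schwarz separates the quadratic from the linear part at the price of doubling both
coefficients. This is why |A| ≤ 1/8 is asked: the previous estimate is applied with s = 2A. -/
theorem lintegral_exp_quad_gaussianReal_le {A B : ℝ} (hA : |A| ≤ 1 / 8) :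
    ∫⁻ x, ENNReal.ofReal (Real.exp (A * (x ^ 2 - 1) + B * x)) ∂gaussianReal 0 1
      ≤ ENNReal.ofReal (Real.exp (4 * A ^ 2 + B ^ 2)) := by
  have hA2 : |2 * A| ≤ 1 / 4 := by rw [abs_mul, abs_two]; linarith
  have hsplit : ∀ x : ℝ, ENNReal.ofReal (Real.exp (A * (x ^ 2 - 1) + B * x))
      = ENNReal.ofReal (Real.exp (A * (x ^ 2 - 1))) * ENNReal.ofReal (Real.exp (B * x)) := by
    intro x; rw [← ENNReal.ofReal_mul (Real.exp_pos _).le, ← Real.exp_add]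
  simp_rw [hsplit]
  refine (ENNReal.lintegral_mul_le_Lp_mul_Lq _ (p := 2) (q := 2)
    (Real.HolderConjugate.two_two) (by fun_prop) (by fun_prop)).trans ?_
  have e1 : ∀ x : ℝ, ENNReal.ofReal (Real.exp (A * (x ^ 2 - 1))) ^ (2 : ℝ)
      = ENNReal.ofReal (Real.exp (-(2 * A))) * ENNReal.ofReal (Real.exp (2 * A * x ^ 2)) := by
    intro x
    rw [ENNReal.ofReal_rpow_of_pos (Real.exp_pos _), ← Real.exp_mul,
      ← ENNReal.ofReal_mul (Real.exp_pos _).le, ← Real.exp_add]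
    congr 2; ring
  have e2 : ∀ x : ℝ, ENNReal.ofReal (Real.exp (B * x)) ^ (2 : ℝ)
      = ENNReal.ofReal (Real.exp (2 * B * x)) := by
    intro x
    rw [ENNReal.ofReal_rpow_of_pos (Real.exp_pos _), ← Real.exp_mul]
    congr 2; ring
  simp_rw [e1, e2]
  rw [lintegral_const_mul _ (by fun_prop), lintegral_exp_mul_gaussianReal,
    lintegral_exp_mul_sq_gaussianReal (by linarith [(abs_le.1 hA2).2])]
  have b1 : ENNReal.ofReal (Real.exp (-(2 * A))) * ENNReal.ofReal √(1 / (1 - 2 * (2 * A)))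
      ≤ ENNReal.ofReal (Real.exp (8 * A ^ 2)) := by
    rw [← ENNReal.ofReal_mul (Real.exp_pos _).le]
    apply ENNReal.ofReal_le_ofReal
    calc _ ≤ Real.exp (-(2 * A)) * Real.exp (2 * A + 2 * (2 * A) ^ 2) := by
          gcongr; exact sqrt_inv_one_sub_le hA2
      _ = _ := by rw [← Real.exp_add]; congr 1; ring
  calc _ ≤ ENNReal.ofReal (Real.exp (8 * A ^ 2)) ^ (1 / 2 : ℝ)
        * ENNReal.ofReal (Real.exp ((2 * B) ^ 2 / 2)) ^ (1 / 2 : ℝ) := by gcongr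
    _ = _ := by
      rw [ENNReal.ofReal_rpow_of_pos (Real.exp_pos _), ENNReal.ofReal_rpow_of_pos (Real.exp_pos _),
        ← Real.exp_mul, ← Real.exp_mul, ← ENNReal.ofReal_mul (Real.exp_pos _).le, ← Real.exp_add]
      congr 2; ring

/-- Chernoff's bound from a bound of the exponential moment, valid for outer measures. -/
theorem measure_le_of_lintegral_exp_le {Ω : Type*} [MeasurableSpace Ω] {P : Measure Ω}
    {f : Ω → ℝ} (hf : Measurable f) {K τ : ℝ}
    (h : ∫⁻ ω, ENNReal.ofReal (Real.exp (f ω)) ∂P ≤ ENNReal.ofReal (Real.exp K)) :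
    P {ω | τ ≤ f ω} ≤ ENNReal.ofReal (Real.exp (K - τ)) := by
  have h1 := mul_meas_ge_le_lintegral₀ (μ := P) (f := fun ω => ENNReal.ofReal (Real.exp (f ω)))
    (by fun_prop) (ENNReal.ofReal (Real.exp τ))
  have h2 : {ω | τ ≤ f ω} ⊆ {ω | ENNReal.ofReal (Real.exp τ) ≤ ENNReal.ofReal (Real.exp (f ω))} :=
    fun ω hω => ENNReal.ofReal_le_ofReal (Real.exp_le_exp.2 hω)
  have h3 := (mul_le_mul_right (measure_mono h2 (μ := P)) (ENNReal.ofReal (Real.exp τ))).trans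
    (h1.trans h)
  calc P {ω | τ ≤ f ω}
      = ENNReal.ofReal (Real.exp (-τ)) * (ENNReal.ofReal (Real.exp τ) * P {ω | τ ≤ f ω}) := by
        rw [← mul_assoc, ← ENNReal.ofReal_mul (Real.exp_pos _).le, ← Real.exp_add]; simp
    _ ≤ ENNReal.ofReal (Real.exp (-τ)) * ENNReal.ofReal (Real.exp K) := by gcongr
    _ = _ := by
      rw [← ENNReal.ofReal_mul (Real.exp_pos _).le, ← Real.exp_add]; congr 2; ring

/-- The exponential moment of a sum of functions of independent variables. -/
theorem lintegral_exp_sum_pi_le {ι : Type*} [Fintype ι] {X : ι → Type*}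
    [∀ i, MeasurableSpace (X i)] (μ : ∀ i, Measure (X i)) [∀ i, IsProbabilityMeasure (μ i)]
    {f : ∀ i, X i → ℝ} (hf : ∀ i, Measurable (f i)) {K : ι → ℝ}
    (h : ∀ i, ∫⁻ x, ENNReal.ofReal (Real.exp (f i x)) ∂μ i ≤ ENNReal.ofReal (Real.exp (K i))) :
    ∫⁻ x, ENNReal.ofReal (Real.exp (∑ i, f i (x i))) ∂Measure.pi μ
      ≤ ENNReal.ofReal (Real.exp (∑ i, K i)) := by
  have hind : iIndepFun (fun i (x : ∀ i, X i) => ENNReal.ofReal (Real.exp (f i (x i))))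
      (Measure.pi μ) :=
    iIndepFun_pi (X := fun i x => ENNReal.ofReal (Real.exp (f i x))) fun i => by
      have := hf i; fun_prop
  have e : ∀ x : ∀ i, X i, ENNReal.ofReal (Real.exp (∑ i, f i (x i)))
      = ∏ i, ENNReal.ofReal (Real.exp (f i (x i))) := by
    intro x
    rw [Real.exp_sum, ENNReal.ofReal_prod_of_nonneg fun i _ => (Real.exp_pos _).le]
  simp_rw [e]
  rw [lintegral_prod_eq_prod_lintegral_of_indepFun _ _ hind fun i => by
    have := hf i; fun_prop]
  rw [Real.exp_sum, ENNReal.ofReal_prod_of_nonneg fun i _ => (Real.exp_pos _).le]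
  refine Finset.prod_le_prod' fun i _ => ?_
  refine le_trans (le_of_eq ?_) (h i)
  exact (measurePreserving_eval μ i).lintegral_comp
    (f := fun x => ENNReal.ofReal (Real.exp (f i x))) (by have := hf i; fun_prop)

theorem measure_pi_gaussian_weighted_sq_ge_le {ι : Type*} [Fintype ι] {w : ι → ℝ} {W δ : ℝ}
    (hW : 0 < W) (hw : ∀ i, |w i| ≤ W) (hδ : 0 ≤ δ) (hδ1 : δ ≤ 1) :
    Measure.pi (fun _ : ι => gaussianReal 0 1)
      {x | Fintype.card ι * δ * W ≤ ∑ i, w i * (x i ^ 2 - 1)}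
      ≤ ENNReal.ofReal (Real.exp (-(Fintype.card ι * δ ^ 2 / 16))) := by
  -- With this Chernoff parameter each summand costs 4(l w_i)² ≤ δ²/16 and the threshold gains δ²/8
  -- per variable, leaving δ²/16.
  set l := δ / (8 * W) with hl
  have hl0 : 0 ≤ l := by positivity
  have hA : ∀ i, |l * w i| ≤ δ / 8 := fun i => by
    rw [abs_mul, abs_of_nonneg hl0, hl, div_mul_eq_mul_div, div_le_div_iff₀ (by positivity)
      (by norm_num)]
    nlinarith [hw i, mul_le_mul_of_nonneg_left (hw i) hδ]
  have h1 := lintegral_exp_sum_pi_le (fun _ : ι => gaussianReal 0 1)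
    (f := fun i x => l * w i * (x ^ 2 - 1) + 0 * x) (fun i => by fun_prop)
    (K := fun i => 4 * (l * w i) ^ 2 + 0 ^ 2)
    (fun i => lintegral_exp_quad_gaussianReal_le ((hA i).trans (by linarith)))
  have h2 := measure_le_of_lintegral_exp_le (τ := l * (Fintype.card ι * δ * W)) (by fun_prop) h1
  refine (measure_mono fun x hx => ?_).trans (h2.trans (ENNReal.ofReal_le_ofReal
    (Real.exp_le_exp.2 ?_)))
  · simp only [Set.mem_ofPred_eq] at hx ⊢
    have e : ∑ i, (l * w i * (x i ^ 2 - 1) + 0 * x i) = l * ∑ i, w i * (x i ^ 2 - 1) := by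
      rw [Finset.mul_sum]; exact Finset.sum_congr rfl fun i _ => by ring
    rw [e]; gcongr
  · have h3 : ∑ i, (4 * (l * w i) ^ 2 + 0 ^ 2) ≤ ∑ _i : ι, δ ^ 2 / 16 := by
      refine Finset.sum_le_sum fun i _ => ?_
      have := sq_le_sq' (by linarith [(abs_le.1 (hA i)).1]) (abs_le.1 (hA i)).2
      nlinarith
    rw [Finset.sum_const, Finset.card_univ, nsmul_eq_mul] at h3
    have h4 : l * (Fintype.card ι * δ * W) = Fintype.card ι * δ ^ 2 / 8 := by
      rw [hl]; field_simp
    rw [h4]; linarith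

/-! ### Lower bound for the truncated fourth moment -/

/-- A bounded minorant of the summands of the truncated fourth moment. -/
def truncQuartic (u : ℝ) : ℝ := if u ^ 2 ≤ 8 then u ^ 2 * (u ^ 2 - 1) else 0

theorem measurable_truncQuartic : Measurable truncQuartic :=
  Measurable.ite (measurableSet_le (by fun_prop) (by fun_prop)) (by fun_prop) (by fun_prop)

theorem truncQuartic_mem_Icc (u : ℝ) : truncQuartic u ∈ Set.Icc (-1 : ℝ) 56 := by
  unfold truncQuartic
  split_ifs with h
  · constructor <;> nlinarith [sq_nonneg (u ^ 2 - 1), sq_nonneg u]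
  · norm_num

/-- The polynomial u⁴ - u² - u⁶/8 lies below the truncated function, as it is nonpositive once u² >
8, and its Gaussian mean is 3 - 1 - 15/8 = 1/8. -/
theorem le_integral_truncQuartic : 1 / 8 ≤ ∫ u, truncQuartic u ∂gaussianReal 0 1 := by
  have h : ∀ u : ℝ, u ^ 4 - u ^ 2 - u ^ 6 / 8 ≤ truncQuartic u := by
    intro u
    have h0 : u ^ 4 - u ^ 2 - u ^ 6 / 8 = u ^ 2 * (u ^ 2 - 1 - u ^ 4 / 8) := by ring
    unfold truncQuartic
    split_ifs with h
    · nlinarith [pow_nonneg (sq_nonneg u) 3]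
    · rw [h0]
      have : u ^ 2 - 1 - u ^ 4 / 8 ≤ 0 := by nlinarith
      nlinarith [sq_nonneg u]
  have i2 := integrable_pow_gaussianReal 2
  have i4 := integrable_pow_gaussianReal 4
  have i6 := integrable_pow_gaussianReal 6
  have hi : Integrable truncQuartic (gaussianReal 0 1) :=
    Integrable.of_mem_Icc (-1) 56 measurable_truncQuartic.aemeasurable
      (ae_of_all _ truncQuartic_mem_Icc)
  have := integral_mono ((i4.sub i2).sub (i6.div_const 8)) hi h
  refine le_trans (le_of_eq ?_) this
  rw [integral_sub' (i4.sub i2) (i6.div_const 8), integral_sub' i4 i2, integral_div,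
    integral_pow_four_gaussianReal, integral_sq_gaussianReal, integral_pow_six_gaussianReal]
  norm_num

/-- Hoeffding's inequality for values in [-1, 56], an interval of length 57, and a deviation of 1/16
from a mean at least 1/8. The exponent is m/415872, and 500000 rounds it. -/
theorem measure_pi_truncQuartic_le {m : ℕ} (hm : 0 < m) :
    Measure.pi (fun _ : Fin m => gaussianReal 0 1) {u | ∑ i, truncQuartic (u i) ≤ m / 16}
      ≤ ENNReal.ofReal (Real.exp (-(m / 500000))) := by
  set e := ∫ u, truncQuartic u ∂gaussianReal 0 1 with he
  have hind : iIndepFun (fun (i : Fin m) (u : Fin m → ℝ) => -(truncQuartic (u i) - e))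
      (Measure.pi fun _ : Fin m => gaussianReal 0 1) :=
    iIndepFun_pi (X := fun _ x => -(truncQuartic x - e)) fun i =>
      (measurable_truncQuartic.sub_const _).neg.aemeasurable
  have hsub : ∀ i ∈ (Finset.univ : Finset (Fin m)), HasSubgaussianMGF
      (fun u : Fin m → ℝ => -(truncQuartic (u i) - e)) ((‖(56 : ℝ) - (-1)‖₊ / 2) ^ 2)
      (Measure.pi fun _ : Fin m => gaussianReal 0 1) := by
    intro i _
    have h1 : ∫ u : Fin m → ℝ, truncQuartic (u i) ∂(Measure.pi fun _ : Fin m => gaussianReal 0 1)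
        = e := by
      rw [he]
      exact integral_comp_eval (μ := fun _ : Fin m => gaussianReal 0 1)
        measurable_truncQuartic.aestronglyMeasurable
    have := (hasSubgaussianMGF_of_mem_Icc (X := fun u : Fin m → ℝ => truncQuartic (u i))
      (μ := Measure.pi fun _ : Fin m => gaussianReal 0 1)
      (measurable_truncQuartic.comp (measurable_pi_apply i)).aemeasurable
      (ae_of_all _ fun u => truncQuartic_mem_Icc (u i)))
    rw [h1] at this
    exact this.neg
  have hm' : (0 : ℝ) < m := by exact_mod_cast hm
  have h := HasSubgaussianMGF.measure_sum_ge_le_of_iIndepFun hind hsub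
    (ε := m / 16) (by positivity)
  have hsubset : {u : Fin m → ℝ | ∑ i, truncQuartic (u i) ≤ m / 16} ⊆
      {u | (m : ℝ) / 16 ≤ ∑ i, -(truncQuartic (u i) - e)} := by
    intro u hu
    simp only [Set.mem_ofPred_eq, Finset.sum_neg_distrib, Finset.sum_sub_distrib, Finset.sum_const,
      Finset.card_univ, Fintype.card_fin, nsmul_eq_mul] at hu ⊢
    have : (m : ℝ) * (1 / 8) ≤ m * e := by gcongr; exact le_integral_truncQuartic
    linarith
  refine (measure_mono hsubset).trans ?_
  rw [← ofReal_measureReal]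
  refine ENNReal.ofReal_le_ofReal (h.trans (Real.exp_le_exp.2 ?_))
  have h57 : ‖(56 : ℝ) - (-1)‖₊ = 57 := by
    ext; norm_num
  simp only [Finset.sum_const, Finset.card_univ, Fintype.card_fin, nsmul_eq_mul, h57]
  push_cast
  rw [neg_div, neg_le_neg_iff, div_le_div_iff₀ (by norm_num) (by positivity)]
  nlinarith

/-! ### Moments of sums of independent variables -/

/-- Only the terms of degree 0 and 1 in x are kept exactly, because the linear one integrates to
zero when x is centred and independent of a. Every other monomial is dominated by one of the extreme
ones, according to which of |x|, |a| is larger, and the binomial coefficients add up to at most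
4^(s+1). -/
theorem add_pow_le_of_even {s : ℕ} (a x : ℝ) :
    (a + x) ^ (2 * (s + 1)) ≤ a ^ (2 * (s + 1)) + 2 * (s + 1) * (a ^ (2 * s + 1) * x)
      + 4 ^ (s + 1) * (a ^ (2 * s) * x ^ 2 + x ^ (2 * (s + 1))) := by
  have key : ∀ j ∈ Finset.range (2 * s + 1), x ^ (j + 1 + 1) * a ^ (2 * s + 2 - (j + 1 + 1)) *
      ((2 * s + 2).choose (j + 1 + 1) : ℝ) ≤
      (a ^ (2 * s) * x ^ 2 + x ^ (2 * (s + 1))) * ((2 * s + 2).choose (j + 1 + 1) : ℝ) := by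
    intro j hj
    have hj : j ≤ 2 * s := by simpa [Nat.lt_succ_iff] using hj
    refine mul_le_mul_of_nonneg_right ?_ (Nat.cast_nonneg _)
    have e : 2 * s + 2 - (j + 1 + 1) = 2 * s - j := by omega
    rw [e]
    refine (le_abs_self _).trans ?_
    rw [abs_mul, abs_pow, abs_pow]
    have ea : a ^ (2 * s) = |a| ^ (2 * s) := (Even.pow_abs ⟨s, by ring⟩ a).symm
    have ex : x ^ (2 * (s + 1)) = |x| ^ (2 * (s + 1)) := (Even.pow_abs ⟨s + 1, by ring⟩ x).symm
    rw [ea, ex, ← sq_abs x]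
    rcases le_total |x| |a| with h | h
    · calc |x| ^ (j + 1 + 1) * |a| ^ (2 * s - j) = |x| ^ j * |a| ^ (2 * s - j) * |x| ^ 2 := by ring
        _ ≤ |a| ^ j * |a| ^ (2 * s - j) * |x| ^ 2 := by gcongr
        _ = |a| ^ (2 * s) * |x| ^ 2 := by rw [← pow_add]; congr 2; omega
        _ ≤ _ := by linarith [pow_nonneg (abs_nonneg x) (2 * (s + 1))]
    · calc |x| ^ (j + 1 + 1) * |a| ^ (2 * s - j) ≤ |x| ^ (j + 1 + 1) * |x| ^ (2 * s - j) := by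
            gcongr
        _ = |x| ^ (2 * (s + 1)) := by rw [← pow_add]; congr 1; omega
        _ ≤ _ := le_add_of_nonneg_left (by positivity)
  have hexp : (a + x) ^ (2 * (s + 1)) = a ^ (2 * (s + 1)) + 2 * (s + 1) * (a ^ (2 * s + 1) * x)
      + ∑ j ∈ Finset.range (2 * s + 1), x ^ (j + 1 + 1) * a ^ (2 * s + 2 - (j + 1 + 1)) *
      ((2 * s + 2).choose (j + 1 + 1) : ℝ) := by
    rw [add_comm a x, show 2 * (s + 1) = 2 * s + 2 by ring, add_pow, Finset.sum_range_succ',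
      Finset.sum_range_succ']
    simp only [zero_add, pow_zero, pow_one, Nat.choose_zero_right, Nat.choose_one_right]
    rw [show 2 * s + 2 - 1 = 2 * s + 1 by omega]
    push_cast
    ring
  rw [hexp]
  have hsum := Finset.sum_le_sum key
  rw [← Finset.mul_sum] at hsum
  have hch : ∑ j ∈ Finset.range (2 * s + 1), ((2 * s + 2).choose (j + 1 + 1) : ℝ)
      ≤ 4 ^ (s + 1) := by
    have h := Nat.sum_range_choose (2 * s + 2)
    rw [Finset.sum_range_succ', Finset.sum_range_succ'] at h
    have h2 : ∑ j ∈ Finset.range (2 * s + 1), (2 * s + 2).choose (j + 1 + 1) ≤ 4 ^ (s + 1) := by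
      rw [show (4 : ℕ) = 2 ^ 2 by norm_num, ← pow_mul, show 2 * (s + 1) = 2 * s + 2 by ring]
      omega
    exact_mod_cast h2
  have hn : 0 ≤ a ^ (2 * s) * x ^ 2 + x ^ (2 * (s + 1)) := by
    have : a ^ (2 * s) = (a ^ s) ^ 2 := by ring
    have : x ^ (2 * (s + 1)) = (x ^ (s + 1)) ^ 2 := by ring
    rw [‹a ^ (2 * s) = _›, ‹x ^ (2 * (s + 1)) = _›]; positivity
  nlinarith [mul_le_mul_of_nonneg_left hch hn]

/-- A moment inequality for sums of independent centred variables. -/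
theorem exists_integral_sum_pow_le (s : ℕ) (M : ℝ) (hM : 1 ≤ M) :
    ∃ K : ℝ, 0 < K ∧ ∀ {Ω : Type} [MeasurableSpace Ω] (P : Measure Ω) [IsProbabilityMeasure P]
      {ι : Type} (X : ι → Ω → ℝ), iIndepFun X P → (∀ i, Measurable (X i)) →
      (∀ i, ∀ p : ℕ, MemLp (X i) p P) → (∀ i, ∫ ω, X i ω ∂P = 0) →
      (∀ i, ∀ j ≤ s, ∫ ω, X i ω ^ (2 * j) ∂P ≤ M) → ∀ S : Finset ι,
      ∫ ω, (∑ i ∈ S, X i ω) ^ (2 * s) ∂P ≤ K * (S.card : ℝ) ^ s := by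
  induction s with
  | zero => exact ⟨1, one_pos, by intros; simp⟩
  | succ s ih =>
    obtain ⟨K, hK, ih⟩ := ih
    refine ⟨4 ^ (s + 1) * (K * M + M), by positivity, ?_⟩
    intro Ω _ P _ ι X hind hmeas hLp hzero hmom S
    have ih' := ih P X hind hmeas hLp hzero (fun i j hj => hmom i j (by omega))
    classical
    have hpow : ∀ {f : Ω → ℝ}, (∀ p : ℕ, MemLp f p P) → Measurable f → ∀ k : ℕ,
        Integrable (fun ω => f ω ^ k) P := by
      intro f hf hm k
      rcases Nat.eq_zero_or_pos k with rfl | hk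
      · simp
      exact (integrable_norm_iff (by fun_prop)).1 (by simpa using (hf k).integrable_norm_pow hk.ne')
    -- Inner induction on the index set, inside the induction on the exponent. A new summand raises
    -- the moment by a term in the moment of order 2s, already bounded by K |S|^s, and by its own
    -- moments; adding up |S| increments gives the power s + 1.
    have hstep : ∀ S : Finset ι, ∫ ω, (∑ i ∈ S, X i ω) ^ (2 * (s + 1)) ∂P
        ≤ S.card * (4 ^ (s + 1) * (K * M * (S.card : ℝ) ^ s + M)) := by
      intro S
      induction S using Finset.induction_on with
      | empty => simp
      | insert i S hi ihS =>
        have hSm : Measurable (fun ω => ∑ i ∈ S, X i ω) := by fun_prop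
        have hSL : ∀ p : ℕ, MemLp (fun ω => ∑ i ∈ S, X i ω) p P := fun p =>
          memLp_finsetSum S fun i _ => hLp i p
        have hI : IndepFun (fun ω => ∑ i ∈ S, X i ω) (X i) P := by
          have := hind.indepFun_finsetSum_of_notMem hmeas hi
          convert this using 1
          ext ω; simp
        have hmul : ∀ k l : ℕ, Integrable (fun ω => (∑ i ∈ S, X i ω) ^ k * X i ω ^ l) P ∧
            ∫ ω, (∑ i ∈ S, X i ω) ^ k * X i ω ^ l ∂P
              = (∫ ω, (∑ i ∈ S, X i ω) ^ k ∂P) * ∫ ω, X i ω ^ l ∂P := by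
          intro k l
          have hI' : IndepFun (fun ω => (∑ i ∈ S, X i ω) ^ k) (fun ω => X i ω ^ l) P :=
            hI.comp (φ := fun y : ℝ => y ^ k) (ψ := fun y : ℝ => y ^ l) (by fun_prop)
              (by fun_prop)
          exact ⟨hI'.integrable_mul (hpow hSL hSm k) (hpow (hLp i) (hmeas i) l),
            hI'.integral_fun_mul_eq_mul_integral (by fun_prop) (by
              have := hmeas i; fun_prop)⟩
        have hb : ∀ ω, (∑ j ∈ insert i S, X j ω) ^ (2 * (s + 1)) ≤
            (∑ j ∈ S, X j ω) ^ (2 * (s + 1))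
            + 2 * (s + 1) * ((∑ j ∈ S, X j ω) ^ (2 * s + 1) * X i ω ^ 1)
            + 4 ^ (s + 1) * ((∑ j ∈ S, X j ω) ^ (2 * s) * X i ω ^ 2
              + X i ω ^ (2 * (s + 1))) := by
          intro ω
          rw [Finset.sum_insert hi, add_comm (X i ω), pow_one]
          exact add_pow_le_of_even _ _
        have i1 := hpow hSL hSm (2 * (s + 1))
        have i2 := (hmul (2 * s + 1) 1).1.const_mul (2 * (s + 1) : ℝ)
        have i3 := (hmul (2 * s) 2).1
        have i4 := hpow (hLp i) (hmeas i) (2 * (s + 1))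
        have i0 : Integrable (fun ω => (∑ j ∈ insert i S, X j ω) ^ (2 * (s + 1))) P :=
          hpow (fun p => memLp_finsetSum _ fun i _ => hLp i p) (by fun_prop) _
        have h1 := integral_mono i0 ((i1.add i2).add ((i3.add i4).const_mul (4 ^ (s + 1)))) hb
        refine h1.trans ?_
        rw [integral_add' (i1.add i2) ((i3.add i4).const_mul _), integral_add' i1 i2,
          integral_const_mul, integral_const_mul, integral_add' i3 i4, (hmul (2 * s + 1) 1).2,
          (hmul (2 * s) 2).2]
        have hz : ∫ ω, X i ω ^ 1 ∂P = 0 := by simpa using hzero i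
        rw [hz, Finset.card_insert_of_notMem hi]
        have hx2 : ∫ ω, X i ω ^ 2 ∂P ≤ M := by simpa using hmom i 1 (by omega)
        have hx2' : 0 ≤ ∫ ω, X i ω ^ 2 ∂P := integral_nonneg fun ω => sq_nonneg _
        have hxs := hmom i (s + 1) le_rfl
        have hprod : (∫ ω, (∑ i ∈ S, X i ω) ^ (2 * s) ∂P) * ∫ ω, X i ω ^ 2 ∂P
            ≤ K * (S.card : ℝ) ^ s * M :=
          mul_le_mul (ih' S) hx2 hx2' (by positivity)
        have h4 : (0 : ℝ) < 4 ^ (s + 1) := by positivity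
        have hmono : (S.card : ℝ) ^ s ≤ ((S.card + 1 : ℕ) : ℝ) ^ s := by
          gcongr; exact_mod_cast Nat.le_succ _
        have hA : (S.card : ℝ) * (4 ^ (s + 1) * (K * M * (S.card : ℝ) ^ s + M)) ≤
            S.card * (4 ^ (s + 1) * (K * M * ((S.card + 1 : ℕ) : ℝ) ^ s + M)) := by gcongr
        have hB : 4 ^ (s + 1) * ((∫ ω, (∑ i ∈ S, X i ω) ^ (2 * s) ∂P) * ∫ ω, X i ω ^ 2 ∂P +
            ∫ ω, X i ω ^ (2 * (s + 1)) ∂P) ≤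
            4 ^ (s + 1) * (K * M * ((S.card + 1 : ℕ) : ℝ) ^ s + M) := by
          refine mul_le_mul_of_nonneg_left (add_le_add ?_ hxs) h4.le
          calc _ ≤ K * (S.card : ℝ) ^ s * M := hprod
            _ = K * M * (S.card : ℝ) ^ s := by ring
            _ ≤ _ := by gcongr
        have := ihS.trans hA
        rw [mul_zero, mul_zero, add_zero]
        refine (add_le_add this hB).trans (le_of_eq ?_)
        push_cast
        ring
    refine (hstep S).trans ?_
    rcases Nat.eq_zero_or_pos S.card with h0 | h0
    · simp [h0]
    have h1 : (1 : ℝ) ≤ S.card := by exact_mod_cast h0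
    have h2 : (1 : ℝ) ≤ (S.card : ℝ) ^ s := one_le_pow₀ h1
    calc _ ≤ S.card * (4 ^ (s + 1) * (K * M * (S.card : ℝ) ^ s + M * (S.card : ℝ) ^ s)) := by
          gcongr; nlinarith
      _ = _ := by ring

/-! ### Marginals of Gaussian vectors -/

theorem map_inner_of_isGaussian {n : ℕ} {μ : Measure (EuclideanSpace ℝ (Fin n))} [IsGaussian μ]
    (h0 : ∫ x, x ∂μ = 0) (v : EuclideanSpace ℝ (Fin n)) :
    μ.map (fun a => inner ℝ a v) = gaussianReal 0 (covarianceBilin μ v v).toNNReal := by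
  have h1 : (fun a : EuclideanSpace ℝ (Fin n) => inner ℝ a v) = innerSL ℝ v := by
    ext a; simp [real_inner_comm]
  have h2 : μ[innerSL ℝ v] = 0 := by
    rw [ContinuousLinearMap.integral_comp_id_comm IsGaussian.integrable_id]
    simp [h0]
  rw [h1, IsGaussian.map_eq_gaussianReal, h2,
    covarianceBilin_self IsGaussian.memLp_two_id]
  congr 2

theorem map_inner_stdGaussian {n : ℕ} {v : EuclideanSpace ℝ (Fin n)} (hv : ‖v‖ = 1) :
    (stdGaussian (EuclideanSpace ℝ (Fin n))).map (fun a => inner ℝ a v) = gaussianReal 0 1 := by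
  rw [map_inner_of_isGaussian integral_id_stdGaussian, covarianceBilin_stdGaussian,
    innerSL_apply_apply, real_inner_self_eq_norm_sq, hv]
  norm_num

theorem map_inner_multivariateGaussian {r : ℕ} {S : Matrix (Fin r) (Fin r) ℝ}
    (hS : S.PosSemidef) (v : EuclideanSpace ℝ (Fin r)) :
    (multivariateGaussian 0 S).map (fun a => inner ℝ a v)
      = gaussianReal 0 (v.ofLp ⬝ᵥ S.mulVec v.ofLp).toNNReal := by
  rw [map_inner_of_isGaussian (by simp), covarianceBilin_multivariateGaussian hS]

/-- Jointly Gaussian and uncorrelated components are independent. This is what allows conditioning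
on the component along a signal. -/
theorem map_inner_pair_stdGaussian {n : ℕ} {e f : EuclideanSpace ℝ (Fin n)} (he : ‖e‖ = 1)
    (hf : ‖f‖ = 1) (hef : inner ℝ e f = 0) :
    (stdGaussian (EuclideanSpace ℝ (Fin n))).map (fun a => (inner ℝ a e, inner ℝ a f))
      = (gaussianReal 0 1).prod (gaussianReal 0 1) := by
  have hG : HasGaussianLaw (fun a : EuclideanSpace ℝ (Fin n) => (inner ℝ a e, inner ℝ a f))
      (stdGaussian (EuclideanSpace ℝ (Fin n))) := by
    have := (IsGaussian.hasGaussianLaw_id (μ := stdGaussian (EuclideanSpace ℝ (Fin n)))).map_fun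
      ((innerSL ℝ e).prod (innerSL ℝ f))
    simpa [real_inner_comm] using this
  have hI : IndepFun (fun a : EuclideanSpace ℝ (Fin n) => inner ℝ a e)
      (fun a => inner ℝ a f) (stdGaussian (EuclideanSpace ℝ (Fin n))) := by
    refine hG.indepFun_of_covariance_eq_zero ?_
    have := covarianceBilin_apply_eq_cov (μ := stdGaussian (EuclideanSpace ℝ (Fin n)))
      IsGaussian.memLp_two_id e f
    rw [covarianceBilin_stdGaussian, innerSL_apply_apply, hef] at this
    simpa [real_inner_comm] using this.symm
  rw [hI.map_prod_eq_prod_map_map (by fun_prop) (by fun_prop), map_inner_stdGaussian he,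
    map_inner_stdGaussian hf]

/-! ### Truncated quadratic forms, conditionally on the components along the signals -/

/-- A tail bound for quadratic forms in Gaussian variables with coefficients depending on an
independent family. -/
theorem measure_pi_prod_quad_ge_le {ι : Type*} [Fintype ι] {A B : (ι → ℝ) → ι → ℝ}
    (hA : ∀ i, Measurable fun u => A u i) (hB : ∀ i, Measurable fun u => B u i) {K τ : ℝ}
    (hA8 : ∀ u i, |A u i| ≤ 1 / 8) (hK : ∀ u i, 4 * A u i ^ 2 + B u i ^ 2 ≤ K) :
    Measure.pi (fun _ : ι => (gaussianReal 0 1).prod (gaussianReal 0 1))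
      {z | τ ≤ ∑ i, (A (fun j => (z j).1) i * ((z i).2 ^ 2 - 1)
        + B (fun j => (z j).1) i * (z i).2)}
      ≤ ENNReal.ofReal (Real.exp (Fintype.card ι * K - τ)) := by
  set F : (ι → ℝ) × (ι → ℝ) → ℝ :=
    fun w => ∑ i, (A w.1 i * (w.2 i ^ 2 - 1) + B w.1 i * w.2 i) with hF
  have hFm : Measurable F := by
    refine Finset.measurable_sum _ fun i _ => ?_
    have h1 : Measurable fun w : (ι → ℝ) × (ι → ℝ) => A w.1 i := (hA i).comp measurable_fst
    have h2 : Measurable fun w : (ι → ℝ) × (ι → ℝ) => B w.1 i := (hB i).comp measurable_fst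
    have h3 : Measurable fun w : (ι → ℝ) × (ι → ℝ) => w.2 i := by fun_prop
    exact (h1.mul ((h3.pow_const 2).sub_const 1)).add (h2.mul h3)
  have hmp := measurePreserving_arrowProdEquivProdArrow ℝ ℝ ι
    (fun _ => gaussianReal 0 1) (fun _ => gaussianReal 0 1)
  have h1 : ∫⁻ w, ENNReal.ofReal (Real.exp (F w))
      ∂((Measure.pi fun _ : ι => gaussianReal 0 1).prod (Measure.pi fun _ : ι => gaussianReal 0 1))
      ≤ ENNReal.ofReal (Real.exp (Fintype.card ι * K)) := by
    -- Fubini: for fixed u the coefficients are constants and the one-variable bound applies to each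
    -- factor. The result does not depend on u.
    rw [lintegral_prod _ (by fun_prop)]
    calc _ ≤ ∫⁻ _u, ENNReal.ofReal (Real.exp (Fintype.card ι * K))
          ∂(Measure.pi fun _ : ι => gaussianReal 0 1) := by
          refine lintegral_mono fun u => ?_
          refine (lintegral_exp_sum_pi_le (fun _ : ι => gaussianReal 0 1)
            (f := fun i x => A u i * (x ^ 2 - 1) + B u i * x) (fun i => by fun_prop)
            fun i => lintegral_exp_quad_gaussianReal_le (hA8 u i)).trans ?_
          refine ENNReal.ofReal_le_ofReal (Real.exp_le_exp.2 ?_)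
          refine (Finset.sum_le_sum fun i _ => hK u i).trans ?_
          simp
      _ = _ := by simp
  have h2 := measure_le_of_lintegral_exp_le (τ := τ) hFm h1
  have h3 := hmp.measure_preimage_equiv {w | τ ≤ F w}
  rw [← h3] at h2
  exact h2

/-- The truncated squares. -/
def truncSq {m : ℕ} (u : Fin m → ℝ) (i : Fin m) : ℝ :=
  if u i ^ 2 ≤ 9 * ((∑ j, u j ^ 2) / m) then u i ^ 2 else 0

theorem measurable_truncSq {m : ℕ} (i : Fin m) : Measurable fun u : Fin m → ℝ => truncSq u i :=
  Measurable.ite (measurableSet_le (by fun_prop) (by fun_prop)) (by fun_prop) (by fun_prop)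

/-- The data-dependent threshold is then at least 9 · 8/9 = 8, so nothing below 8 is discarded, and
whatever is kept above 8 contributes a nonnegative amount. This replaces dependent summands by
independent ones. -/
theorem truncQuartic_le_truncSq {m : ℕ} {u : Fin m → ℝ} (h : 8 / 9 ≤ (∑ j, u j ^ 2) / m)
    (i : Fin m) : truncQuartic (u i) ≤ truncSq u i * (u i ^ 2 - 1) := by
  unfold truncQuartic truncSq
  split_ifs with h1 h2 h2
  · exact le_rfl
  · linarith
  · exact mul_nonneg (sq_nonneg _) (by linarith)
  · simp

theorem measure_pi_sum_sq_bounds {m : ℕ} (hm : 0 < m) :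
    Measure.pi (fun _ : Fin m => gaussianReal 0 1)
      {u | ¬ (8 / 9 ≤ (∑ j, u j ^ 2) / m ∧ (∑ j, u j ^ 2) / m ≤ 2)}
      ≤ 2 * ENNReal.ofReal (Real.exp (-(m / 1296))) := by
  have hm' : (0 : ℝ) < m := by exact_mod_cast hm
  have h1 := measure_pi_gaussian_weighted_sq_ge_le (ι := Fin m) (w := fun _ => 1) (W := 1)
    (δ := 1 / 9) one_pos (by simp) (by norm_num) (by norm_num)
  have h2 := measure_pi_gaussian_weighted_sq_ge_le (ι := Fin m) (w := fun _ => -1) (W := 1)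
    (δ := 1 / 9) one_pos (by simp) (by norm_num) (by norm_num)
  have e : (m : ℝ) * (1 / 9) ^ 2 / 16 = m / 1296 := by ring
  simp only [Fintype.card_fin, e] at h1 h2
  rw [two_mul]
  refine le_trans (measure_mono ?_) ((measure_union_le _ _).trans (add_le_add h1 h2))
  intro u hu
  simp only [Set.mem_ofPred_eq, Set.mem_union, Finset.sum_sub_distrib, one_mul, neg_mul,
    Finset.sum_neg_distrib, Finset.sum_const, Finset.card_univ, Fintype.card_fin,
    nsmul_eq_mul] at hu ⊢
  rw [le_div_iff₀ hm', div_le_iff₀ hm'] at hu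
  by_contra hcon
  push Not at hcon
  apply hu
  constructor <;> linarith [hcon.1, hcon.2]

theorem measure_pi_truncSq_bounds {m : ℕ} (hm : 0 < m) :
    Measure.pi (fun _ : Fin m => gaussianReal 0 1)
      {u | ¬ ((∑ j, u j ^ 2) / m ≤ 2 ∧ 1 / 16 ≤ (∑ i, truncSq u i * (u i ^ 2 - 1)) / (m : ℝ))}
      ≤ 3 * ENNReal.ofReal (Real.exp (-(m / 500000))) := by
  have hm' : (0 : ℝ) < m := by exact_mod_cast hm
  have hle : ENNReal.ofReal (Real.exp (-((m : ℝ) / 1296)))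
      ≤ ENNReal.ofReal (Real.exp (-((m : ℝ) / 500000))) := by
    refine ENNReal.ofReal_le_ofReal (Real.exp_le_exp.2 (neg_le_neg ?_))
    gcongr; norm_num
  have e3 : (3 : ENNReal) = 2 + 1 := by norm_num
  rw [e3, add_mul, one_mul]
  refine le_trans (measure_mono ?_) ((measure_union_le _ _).trans (add_le_add
    ((measure_pi_sum_sq_bounds hm).trans (mul_le_mul_right hle 2)) (measure_pi_truncQuartic_le hm)))
  intro u hu
  simp only [Set.mem_ofPred_eq, Set.mem_union] at hu ⊢
  by_contra hcon
  push Not at hcon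
  obtain ⟨⟨h1, h2⟩, h3⟩ := hcon
  refine hu ⟨h2, ?_⟩
  rw [le_div_iff₀ hm']
  have := Finset.sum_le_sum fun i (_ : i ∈ Finset.univ) => truncQuartic_le_truncSq h1 i
  linarith

theorem truncSq_nonneg {m : ℕ} (u : Fin m → ℝ) (i : Fin m) : 0 ≤ truncSq u i := by
  unfold truncSq; split_ifs <;> positivity

theorem truncSq_le {m : ℕ} {u : Fin m → ℝ} (h : (∑ j, u j ^ 2) / m ≤ 2) (i : Fin m) :
    truncSq u i ≤ 18 := by
  unfold truncSq; split_ifs <;> linarith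

/-- Where the truncated square is nonzero it equals u², hence u² ≤ 18 there too. This controls the
coefficient of the cross term, which carries an untruncated factor u. -/
theorem truncSq_sq_mul_le {m : ℕ} {u : Fin m → ℝ} (h : (∑ j, u j ^ 2) / m ≤ 2) (i : Fin m) :
    truncSq u i ^ 2 * u i ^ 2 ≤ 18 ^ 3 := by
  have h1 := truncSq_le h i
  have h0 := truncSq_nonneg u i
  have h2 : truncSq u i * u i ^ 2 ≤ 18 ^ 2 := by
    unfold truncSq at *
    split_ifs at * with h3
    · nlinarith [sq_nonneg (u i)]
    · simp
  nlinarith [mul_nonneg h0 (sq_nonneg (u i))]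

/-- The fluctuation of the truncated quadratic form, conditionally on the components along
the signals. -/
theorem measure_pi_fluctuation_le {m q : ℕ} (hm : 0 < m) (hq : 0 < q) {ρ p s : Fin q → ℝ}
    {R τ : ℝ} (hρ : ∀ k, 0 ≤ ρ k) (hρR : ∀ k, ρ k ≤ R) (hps : ∀ k, p k ^ 2 + s k ^ 2 = 1)
    (hτ : 0 < τ) (hτR : τ ≤ R) :
    Measure.pi (fun _ : Fin m × Fin q => (gaussianReal 0 1).prod (gaussianReal 0 1))
      {z | (∀ k, (∑ i, (z (i, k)).1 ^ 2) / m ≤ 2) ∧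
        τ ≤ |1 / (m * q : ℝ) * ∑ i, ∑ k, ρ k * truncSq (fun j => (z (j, k)).1) i *
          (s k ^ 2 * ((z (i, k)).2 ^ 2 - 1) + 2 * p k * s k * (z (i, k)).1 * (z (i, k)).2)|}
      ≤ 2 * ENNReal.ofReal (Real.exp (-(τ ^ 2 * (m * q) / (28512 * R ^ 2)))) := by
  have hm' : (0 : ℝ) < m := by exact_mod_cast hm
  have hq' : (0 : ℝ) < q := by exact_mod_cast hq
  have hR : 0 < R := hτ.trans_le hτR
  -- The optimal Chernoff parameter. Each variable costs 7128 (lW)² with W = R/(mq), where 7128 = 4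
  -- · 18² + 18³ collects the square and the cross term; maximizing lτ - 7128 l²R²/(mq) gives 14256
  -- = 2 · 7128 here and 28512 in the exponent.
  set l : ℝ := τ * (m * q) / (14256 * R ^ 2) with hl
  have hl0 : 0 < l := by positivity
  -- Setting the coefficients to zero in columns with a large average makes the bounds hold for all
  -- u, as the conditional tail bound requires. On the event considered no column is affected.
  set c : (Fin m × Fin q → ℝ) → Fin m × Fin q → ℝ := fun u ik =>
    if (∑ i, u (i, ik.2) ^ 2) / m ≤ 2 then
      1 / (m * q : ℝ) * (ρ ik.2 * truncSq (fun j => u (j, ik.2)) ik.1) else 0 with hc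
  have hcm : ∀ ik, Measurable fun u => c u ik := by
    intro ik
    refine Measurable.ite (measurableSet_le (by fun_prop) (by fun_prop)) ?_ (by fun_prop)
    have h1 : Measurable fun u : Fin m × Fin q → ℝ => truncSq (fun j => u (j, ik.2)) ik.1 :=
      (measurable_truncSq ik.1).comp
        (f := fun (u : Fin m × Fin q → ℝ) j => u (j, ik.2)) (by fun_prop)
    exact (h1.const_mul _).const_mul _
  set W : ℝ := R / (m * q) with hW
  have hW0 : 0 < W := by positivity
  have hc0 : ∀ u ik, 0 ≤ c u ik := by
    intro u ik
    simp only [hc]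
    split_ifs
    · have := truncSq_nonneg (fun j => u (j, ik.2)) ik.1
      have := hρ ik.2
      positivity
    · exact le_rfl
  have hcW : ∀ u ik, c u ik ≤ 18 * W := by
    intro u ik
    simp only [hc]
    split_ifs with h
    · have := mul_le_mul (hρR ik.2) (truncSq_le h ik.1) (truncSq_nonneg _ _) hR.le
      calc _ ≤ 1 / (m * q : ℝ) * (R * 18) := by gcongr
        _ = _ := by rw [hW]; ring
    · positivity
  have hcu : ∀ u ik, c u ik ^ 2 * u ik ^ 2 ≤ 18 ^ 3 * W ^ 2 := by
    intro u ik
    simp only [hc]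
    split_ifs with h
    · have h1 := truncSq_sq_mul_le h ik.1
      have h2 : ρ ik.2 ^ 2 ≤ R ^ 2 := pow_le_pow_left₀ (hρ _) (hρR _) 2
      calc _ = (1 / (m * q : ℝ)) ^ 2 * (ρ ik.2 ^ 2 *
            (truncSq (fun j => u (j, ik.2)) ik.1 ^ 2 * u (ik.1, ik.2) ^ 2)) := by ring
        _ ≤ (1 / (m * q : ℝ)) ^ 2 * (R ^ 2 * 18 ^ 3) := by
          gcongr
        _ = _ := by rw [hW]; ring
    · rw [zero_pow two_ne_zero, zero_mul]; positivity
  have hs1 : ∀ k, s k ^ 2 ≤ 1 := fun k => by nlinarith [hps k, sq_nonneg (p k)]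
  have hps4 : ∀ k, (2 * p k * s k) ^ 2 ≤ 1 := fun k => by
    have := hps k
    nlinarith [sq_nonneg (p k ^ 2 - s k ^ 2), sq_nonneg (p k), sq_nonneg (s k)]
  have hlW : l * W = τ / (14256 * R) := by rw [hl, hW]; field_simp
  have hlW1 : l * W ≤ 1 / 14256 := by
    rw [hlW, div_le_div_iff₀ (by positivity) (by norm_num)]; nlinarith
  have tail : ∀ σ : ℝ, |σ| = 1 →
      Measure.pi (fun _ : Fin m × Fin q => (gaussianReal 0 1).prod (gaussianReal 0 1))
      {z | l * τ ≤ ∑ ik, (σ * l * c (fun j => (z j).1) ik * s ik.2 ^ 2 * ((z ik).2 ^ 2 - 1)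
        + σ * l * c (fun j => (z j).1) ik * (2 * p ik.2 * s ik.2) * (z ik).1 * (z ik).2)}
      ≤ ENNReal.ofReal (Real.exp (-(τ ^ 2 * (m * q) / (28512 * R ^ 2)))) := by
    intro σ hσ
    have hσ2 : σ ^ 2 = 1 := by rw [← sq_abs, hσ]; norm_num
    have hlc : ∀ u ik, 0 ≤ l * c u ik ∧ l * c u ik ≤ 18 * (l * W) := fun u ik =>
      ⟨mul_nonneg hl0.le (hc0 u ik), by nlinarith [hcW u ik]⟩
    have := measure_pi_prod_quad_ge_le (ι := Fin m × Fin q) (τ := l * τ)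
      (A := fun u ik => σ * l * c u ik * s ik.2 ^ 2)
      (B := fun u ik => σ * l * c u ik * (2 * p ik.2 * s ik.2) * u ik)
      (K := 7128 * (l * W) ^ 2)
      (fun ik => by have := hcm ik; fun_prop) (fun ik => by have := hcm ik; fun_prop)
      (fun u ik => by
        rw [mul_assoc σ, mul_assoc σ, abs_mul, hσ, one_mul, abs_of_nonneg
          (mul_nonneg (hlc u ik).1 (sq_nonneg _))]
        have := mul_le_mul (hlc u ik).2 (hs1 ik.2) (sq_nonneg _)
          (mul_nonneg (by norm_num) (mul_nonneg hl0.le hW0.le))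
        linarith)
      (fun u ik => by
        have h1 : (l * c u ik) ^ 2 ≤ (18 * (l * W)) ^ 2 :=
          pow_le_pow_left₀ (hlc u ik).1 (hlc u ik).2 2
        have h2 : (s ik.2 ^ 2) ^ 2 ≤ 1 := pow_le_one₀ (sq_nonneg _) (hs1 _)
        have h3 : (l * c u ik) ^ 2 * (s ik.2 ^ 2) ^ 2 ≤ (18 * (l * W)) ^ 2 * 1 :=
          mul_le_mul h1 h2 (sq_nonneg _) (sq_nonneg _)
        have h4 : (l ^ 2 * (c u ik ^ 2 * u ik ^ 2)) * (2 * p ik.2 * s ik.2) ^ 2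
            ≤ (l ^ 2 * (18 ^ 3 * W ^ 2)) * 1 := by
          refine mul_le_mul ?_ (hps4 _) (sq_nonneg _) (by positivity)
          exact mul_le_mul_of_nonneg_left (hcu u ik) (sq_nonneg _)
        calc _ = σ ^ 2 * (4 * ((l * c u ik) ^ 2 * (s ik.2 ^ 2) ^ 2)
              + (l ^ 2 * (c u ik ^ 2 * u ik ^ 2)) * (2 * p ik.2 * s ik.2) ^ 2) := by ring
          _ ≤ _ := by rw [hσ2]; nlinarith)
    refine this.trans (ENNReal.ofReal_le_ofReal (Real.exp_le_exp.2 (le_of_eq ?_)))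
    rw [hlW, hl]
    simp only [Fintype.card_prod, Fintype.card_fin]
    push_cast
    field_simp
    norm_num
  rw [two_mul]
  refine le_trans (measure_mono ?_) ((measure_union_le _ _).trans (add_le_add
    (tail 1 (by simp)) (tail (-1) (by simp))))
  rintro z ⟨hz, hz2⟩
  have e : ∀ σ : ℝ, ∑ ik, (σ * l * c (fun j => (z j).1) ik * s ik.2 ^ 2 * ((z ik).2 ^ 2 - 1)
        + σ * l * c (fun j => (z j).1) ik * (2 * p ik.2 * s ik.2) * (z ik).1 * (z ik).2)
      = σ * (l * (1 / (m * q : ℝ) * ∑ i, ∑ k, ρ k * truncSq (fun j => (z (j, k)).1) i *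
          (s k ^ 2 * ((z (i, k)).2 ^ 2 - 1) + 2 * p k * s k * (z (i, k)).1 * (z (i, k)).2))) := by
    intro σ
    rw [Fintype.sum_prod_type, Finset.mul_sum, Finset.mul_sum, Finset.mul_sum]
    refine Finset.sum_congr rfl fun i _ => ?_
    rw [Finset.mul_sum, Finset.mul_sum, Finset.mul_sum]
    refine Finset.sum_congr rfl fun k _ => ?_
    simp only [hc]
    rw [if_pos (hz k)]
    ring
  simp only [Set.mem_union, Set.mem_ofPred_eq, e]
  rcases le_abs.1 hz2 with h | h
  · left; rw [one_mul]; gcongr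
  · right
    rw [neg_one_mul, ← mul_neg]; gcongr

/-! ### Diagonalization and extreme eigenvalues of symmetric matrices -/

open Matrix in
theorem exists_sorted_diagonalization {n : ℕ} {K : Matrix (Fin n) (Fin n) ℝ} (hK : K.IsSymm) :
    ∃ (μ : Fin n → ℝ) (W : Matrix (Fin n) (Fin n) ℝ), Wᵀ * W = 1 ∧ Antitone μ ∧
      K * W = W * Matrix.diagonal μ ∧ Set.range μ = spectrum ℝ K := by
  have hH : K.IsHermitian := by
    rw [Matrix.IsHermitian, Matrix.conjTranspose_eq_transpose_of_trivial]; exact hK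
  set V : Matrix (Fin n) (Fin n) ℝ := hH.eigenvectorUnitary.1 with hV
  have hVV : Vᵀ * V = 1 := by
    have := (Matrix.mem_unitaryGroup_iff'.1 hH.eigenvectorUnitary.2)
    rwa [Matrix.star_eq_conjTranspose, Matrix.conjTranspose_eq_transpose_of_trivial] at this
  have hVV' : V * Vᵀ = 1 := mul_eq_one_comm.1 hVV
  have hKV : K * V = V * Matrix.diagonal hH.eigenvalues := by
    have := hH.spectral_theorem
    rw [Unitary.conjStarAlgAut_apply, Matrix.star_eq_conjTranspose,
      Matrix.conjTranspose_eq_transpose_of_trivial] at this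
    rw [← hV] at this
    conv_lhs => rw [this]
    rw [Matrix.mul_assoc, hVV, Matrix.mul_one]
    rfl
  let σ := Tuple.sort (fun i => -hH.eigenvalues i)
  have hσ := Tuple.monotone_sort (fun i => -hH.eigenvalues i)
  refine ⟨hH.eigenvalues ∘ σ, V.submatrix id σ, ?_, ?_, ?_, ?_⟩
  · ext i j
    have := congrFun (congrFun hVV (σ i)) (σ j)
    simp only [Matrix.mul_apply, Matrix.transpose_apply, Matrix.submatrix_apply, id] at this ⊢
    rw [this]; simp [Matrix.one_apply]
  · intro i j hij
    have := hσ hij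
    simpa using this
  · ext i j
    have := congrFun (congrFun hKV i) (σ j)
    simpa [Matrix.mul_apply, Matrix.diagonal_apply] using this
  · rw [hH.spectrum_real_eq_range_eigenvalues, Set.range_comp, σ.surjective.range_eq,
      Set.image_univ]

section Diag

open Matrix

variable {n : ℕ} {K W : Matrix (Fin n) (Fin n) ℝ} {μ : Fin n → ℝ}

theorem dotProduct_transpose_mulVec_self (hW : Wᵀ * W = 1) (b : Fin n → ℝ) :
    Wᵀ *ᵥ b ⬝ᵥ Wᵀ *ᵥ b = b ⬝ᵥ b := by
  rw [Matrix.dotProduct_mulVec, Matrix.vecMul_transpose, Matrix.mulVec_mulVec,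
    mul_eq_one_comm.1 hW, Matrix.one_mulVec]

theorem quadForm_eq_sum (hW : Wᵀ * W = 1) (hK : K * W = W * Matrix.diagonal μ) (b : Fin n → ℝ) :
    b ⬝ᵥ K *ᵥ b = ∑ i, μ i * (Wᵀ *ᵥ b) i ^ 2 := by
  have h1 : K = W * Matrix.diagonal μ * Wᵀ := by
    rw [← hK, Matrix.mul_assoc, mul_eq_one_comm.1 hW, Matrix.mul_one]
  conv_lhs => rw [h1]
  rw [← Matrix.mulVec_mulVec, ← Matrix.mulVec_mulVec, Matrix.dotProduct_mulVec,
    ← Matrix.mulVec_transpose]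
  simp only [dotProduct, Matrix.mulVec_diagonal]
  exact Finset.sum_congr rfl fun i _ => by ring

end Diag

open Matrix in
theorem exists_lamMax_eigenvector {r : ℕ} (hr : 0 < r) {K : Matrix (Fin r) (Fin r) ℝ}
    (hK : K.IsSymm) :
    ∃ v : Fin r → ℝ, v ⬝ᵥ v = 1 ∧ K *ᵥ v = lamMax K • v ∧
      ∀ b : Fin r → ℝ, b ⬝ᵥ K *ᵥ b ≤ lamMax K * (b ⬝ᵥ b) := by
  obtain ⟨μ, W, hW, hμ, hKW, hs⟩ := exists_sorted_diagonalization hK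
  let i0 : Fin r := ⟨0, hr⟩
  have hmax : lamMax K = μ i0 := by
    unfold lamMax
    rw [← hs]
    refine IsGreatest.csSup_eq ⟨⟨i0, rfl⟩, ?_⟩
    rintro _ ⟨i, rfl⟩
    exact hμ (Fin.mk_le_of_le_val (Nat.zero_le _))
  refine ⟨W.col i0, ?_, ?_, fun b => ?_⟩
  · have := congrFun (congrFun hW i0) i0
    simpa [Matrix.mul_apply, dotProduct, Matrix.col] using this
  · ext i
    have := congrFun (congrFun hKW i) i0
    rw [hmax]
    simp only [Matrix.mul_apply, Matrix.diagonal_apply] at this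
    simpa [Matrix.mulVec, dotProduct, Matrix.col, mul_comm] using this
  · rw [quadForm_eq_sum hW hKW, ← dotProduct_transpose_mulVec_self hW b, hmax, dotProduct,
      Finset.mul_sum]
    refine Finset.sum_le_sum fun i _ => ?_
    rw [← sq]
    exact mul_le_mul_of_nonneg_right (hμ (Fin.mk_le_of_le_val (Nat.zero_le _))) (sq_nonneg _)

open Matrix in
theorem lamMin_mul_le {r : ℕ} {K : Matrix (Fin r) (Fin r) ℝ} (hK : K.IsSymm) (b : Fin r → ℝ) :
    lamMin K * (b ⬝ᵥ b) ≤ b ⬝ᵥ K *ᵥ b := by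
  obtain ⟨μ, W, hW, hμ, hKW, hs⟩ := exists_sorted_diagonalization hK
  rw [quadForm_eq_sum hW hKW, ← dotProduct_transpose_mulVec_self hW b, dotProduct,
    Finset.mul_sum]
  refine Finset.sum_le_sum fun i _ => ?_
  rw [← sq]
  refine mul_le_mul_of_nonneg_right ?_ (sq_nonneg _)
  unfold lamMin
  rw [← hs]
  exact csInf_le (Set.finite_range μ).bddBelow ⟨i, rfl⟩

/-! ### Nets of the sphere and quadratic forms -/

/-- A 1/2-separated subset of the sphere of maximal cardinality is a net. Doubled, it is 1-separated
in the ball of radius 2, and a volume comparison limits it to 5^n points. -/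
theorem exists_sphere_net (n : ℕ) :
    ∃ N : Finset (EuclideanSpace ℝ (Fin n)), N.card ≤ 5 ^ n ∧ (∀ w ∈ N, ‖w‖ = 1) ∧
      ∀ v, ‖v‖ = 1 → ∃ w ∈ N, ‖v - w‖ < 1 / 2 := by
  classical
  let S : Finset (EuclideanSpace ℝ (Fin n)) → Prop := fun N =>
    (∀ w ∈ N, ‖w‖ = 1) ∧ ∀ c ∈ N, ∀ d ∈ N, c ≠ d → 1 / 2 ≤ ‖c - d‖
  have hcard : ∀ N, S N → N.card ≤ 5 ^ n := by
    intro N hN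
    have := Besicovitch.card_le_of_separated (N.image fun x => (2 : ℝ) • x) (by
      intro c hc
      obtain ⟨x, hx, rfl⟩ := Finset.mem_image.1 hc
      rw [norm_smul, hN.1 x hx]; norm_num) (by
      intro c hc d hd hcd
      obtain ⟨x, hx, rfl⟩ := Finset.mem_image.1 hc
      obtain ⟨y, hy, rfl⟩ := Finset.mem_image.1 hd
      have := hN.2 x hx y hy (fun h => hcd (by rw [h]))
      rw [← smul_sub, norm_smul, Real.norm_eq_abs, abs_two]
      linarith)
    rwa [Finset.card_image_of_injective _ (smul_right_injective _ two_ne_zero),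
      finrank_euclideanSpace_fin] at this
  let Q : ℕ → Prop := fun k => ∃ N, S N ∧ N.card = k
  have h0 : Q 0 := ⟨∅, by simp [S], rfl⟩
  have hspec : Q (Nat.findGreatest Q (5 ^ n)) := Nat.findGreatest_spec (Nat.zero_le _) h0
  obtain ⟨N, hN, hNc⟩ := hspec
  refine ⟨N, hcard N hN, hN.1, fun v hv => ?_⟩
  by_contra hcon
  push Not at hcon
  have hvN : v ∉ N := fun h => by have := hcon v h; norm_num at this
  have hS : S (insert v N) := by
    refine ⟨fun w hw => ?_, fun c hc d hd hcd => ?_⟩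
    · rcases Finset.mem_insert.1 hw with rfl | h
      · exact hv
      · exact hN.1 w h
    · rcases Finset.mem_insert.1 hc with h1 | h1 <;> rcases Finset.mem_insert.1 hd with h2 | h2
      · exact absurd (h1.trans h2.symm) hcd
      · rw [h1]; exact hcon d h2
      · rw [h2, norm_sub_rev]; exact hcon c h1
      · exact hN.2 c h1 d h2 hcd
  have := Nat.le_findGreatest (P := Q) (hcard _ hS) ⟨_, hS, rfl⟩
  rw [Finset.card_insert_of_notMem hvN, hNc] at this
  omega

section QuadForm

open Matrix

variable {n : ℕ} {F : Matrix (Fin n) (Fin n) ℝ}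

theorem dotProduct_mulVec_comm_of_isSymm (hF : F.IsSymm) (z w : Fin n → ℝ) :
    z ⬝ᵥ F *ᵥ w = w ⬝ᵥ F *ᵥ z := by
  rw [Matrix.dotProduct_mulVec, ← Matrix.mulVec_transpose, hF.eq, dotProduct_comm]

/-- By polarization, the difference of the forms at z + tw and z - tw is 4t z'Fw, while the
parallelogram law bounds it by 2σ(|z|² + t²|w|²). The resulting quadratic in t is nonnegative, so
its discriminant is not positive. -/
theorem bilin_sq_le_of_quadForm_le (hF : F.IsSymm) {σ : ℝ}
    (h : ∀ w : Fin n → ℝ, |w ⬝ᵥ F *ᵥ w| ≤ σ * (w ⬝ᵥ w)) (z w : Fin n → ℝ) :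
    (z ⬝ᵥ F *ᵥ w) ^ 2 ≤ σ ^ 2 * (z ⬝ᵥ z) * (w ⬝ᵥ w) := by
  have key : ∀ t : ℝ, 0 ≤ (σ * (w ⬝ᵥ w)) * (t * t) + (-2 * (z ⬝ᵥ F *ᵥ w)) * t
      + σ * (z ⬝ᵥ z) := by
    intro t
    have h1 := (abs_le.1 (h (z + t • w))).2
    have h2 := (abs_le.1 (h (z - t • w))).1
    have hs := dotProduct_mulVec_comm_of_isSymm hF z w
    have hc := dotProduct_comm z w
    simp only [Matrix.mulVec_add, Matrix.mulVec_sub, Matrix.mulVec_smul, dotProduct_add,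
      dotProduct_sub, add_dotProduct, sub_dotProduct, smul_dotProduct, dotProduct_smul,
      smul_eq_mul] at h1 h2
    rw [← hs, ← hc] at h1 h2
    linarith
  have := discrim_le_zero key
  unfold discrim at this
  nlinarith

/-- Let σ be the numerical radius, attained at a unit v, and y a net point with d = |v - y|² ≤ 1/4.
Then v'Fv - y'Fy = (v - y)'F(v + y) and |v + y|² = 4 - d, so the difference is at most σ√(d(4 - d))
≤ (31/32)σ. Hence σ ≤ 32τ; the factor 32 is the price of a net as coarse as 1/2. -/
theorem quadForm_le_of_net (hn : 0 < n) (hF : F.IsSymm) {τ : ℝ}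
    {N : Finset (EuclideanSpace ℝ (Fin n))} (hN1 : ∀ w ∈ N, ‖w‖ = 1)
    (hN2 : ∀ v, ‖v‖ = 1 → ∃ w ∈ N, ‖v - w‖ < 1 / 2)
    (hτ : ∀ w ∈ N, |w.ofLp ⬝ᵥ F *ᵥ w.ofLp| ≤ τ) (w : Fin n → ℝ) :
    |w ⬝ᵥ F *ᵥ w| ≤ 32 * τ * (w ⬝ᵥ w) := by
  have hnegF : (-F).IsSymm := hF.neg
  obtain ⟨v1, hv1, hFv1, hq1⟩ := exists_lamMax_eigenvector hn hF
  obtain ⟨v2, hv2, hFv2, hq2⟩ := exists_lamMax_eigenvector hn hnegF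
  -- the numerical radius is attained
  have hatt : ∃ (σ : ℝ) (v : Fin n → ℝ), v ⬝ᵥ v = 1 ∧ |v ⬝ᵥ F *ᵥ v| = σ ∧
      ∀ w : Fin n → ℝ, |w ⬝ᵥ F *ᵥ w| ≤ σ * (w ⬝ᵥ w) := by
    have e1 : v1 ⬝ᵥ F *ᵥ v1 = lamMax F := by rw [hFv1, dotProduct_smul, hv1]; simp
    have e2 : v2 ⬝ᵥ F *ᵥ v2 = -lamMax (-F) := by
      rw [Matrix.neg_mulVec] at hFv2
      rw [← neg_eq_iff_eq_neg, ← dotProduct_neg, hFv2, dotProduct_smul, hv2]; simp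
    have hww : ∀ w : Fin n → ℝ, 0 ≤ w ⬝ᵥ w := fun w =>
      Finset.sum_nonneg fun i _ => mul_self_nonneg _
    have hq2' : ∀ w : Fin n → ℝ, -(w ⬝ᵥ F *ᵥ w) ≤ lamMax (-F) * (w ⬝ᵥ w) := by
      intro w; have := hq2 w; rwa [Matrix.neg_mulVec, dotProduct_neg] at this
    have b1 := hq1 v2
    have b2 := hq2' v1
    rw [e2, hv2] at b1
    rw [e1, hv1] at b2
    rcases le_total (lamMax F) (lamMax (-F)) with h | h
    · refine ⟨lamMax (-F), v2, hv2, ?_, fun w => abs_le.2 ⟨?_, ?_⟩⟩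
      · rw [e2, abs_neg, abs_of_nonneg (by linarith)]
      · linarith [hq2' w]
      · exact (hq1 w).trans (mul_le_mul_of_nonneg_right h (hww w))
    · refine ⟨lamMax F, v1, hv1, ?_, fun w => abs_le.2 ⟨?_, ?_⟩⟩
      · rw [e1, abs_of_nonneg (by linarith)]
      · linarith [hq2' w, mul_le_mul_of_nonneg_right h (hww w)]
      · exact hq1 w
  obtain ⟨σ, v, hv, hvσ, hσ⟩ := hatt
  have hσ0 : 0 ≤ σ := hvσ ▸ abs_nonneg _
  have hnorm : ∀ x : EuclideanSpace ℝ (Fin n), x.ofLp ⬝ᵥ x.ofLp = ‖x‖ ^ 2 := by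
    intro x
    rw [EuclideanSpace.real_norm_sq_eq]
    exact Finset.sum_congr rfl fun i _ => by ring
  have hvn : ‖WithLp.toLp 2 v‖ = 1 := by
    have := hnorm (WithLp.toLp 2 v)
    rw [show (WithLp.toLp 2 v).ofLp = v from rfl, hv] at this
    nlinarith [norm_nonneg (WithLp.toLp 2 v)]
  obtain ⟨y, hyN, hy⟩ := hN2 _ hvn
  have hyy : y.ofLp ⬝ᵥ y.ofLp = 1 := by rw [hnorm, hN1 y hyN]; norm_num
  have hd := hnorm (WithLp.toLp 2 v - y)
  rw [WithLp.ofLp_sub, show (WithLp.toLp 2 v).ofLp = v from rfl] at hd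
  set d := (v - y.ofLp) ⬝ᵥ (v - y.ofLp) with hdd
  have hd4 : d ≤ 1 / 4 := by
    rw [hd]; nlinarith [norm_nonneg (WithLp.toLp 2 v - y)]
  have hd0 : 0 ≤ d := by rw [hd]; positivity
  have hsum : (v + y.ofLp) ⬝ᵥ (v + y.ofLp) = 4 - d := by
    have hc := dotProduct_comm v y.ofLp
    rw [hdd]
    simp only [dotProduct_add, dotProduct_sub, add_dotProduct, sub_dotProduct, hv, hyy, hc]
    ring
  have hb := bilin_sq_le_of_quadForm_le hF hσ (v - y.ofLp) (v + y.ofLp)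
  rw [← hdd, hsum] at hb
  have hdiff : (v - y.ofLp) ⬝ᵥ F *ᵥ (v + y.ofLp) = v ⬝ᵥ F *ᵥ v - y.ofLp ⬝ᵥ F *ᵥ y.ofLp := by
    have hs := dotProduct_mulVec_comm_of_isSymm hF v y.ofLp
    simp only [Matrix.mulVec_add, dotProduct_add, sub_dotProduct, hs]
    ring
  have hb2 : |v ⬝ᵥ F *ᵥ v - y.ofLp ⬝ᵥ F *ᵥ y.ofLp| ≤ 31 / 32 * σ := by
    rw [← hdiff]
    refine abs_le_of_sq_le_sq (hb.trans ?_) (by positivity)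
    have : d * (4 - d) ≤ 15 / 16 := by nlinarith
    nlinarith [mul_le_mul_of_nonneg_left this (sq_nonneg σ)]
  have htri := abs_sub_abs_le_abs_sub (v ⬝ᵥ F *ᵥ v) (y.ofLp ⬝ᵥ F *ᵥ y.ofLp)
  have hyτ := hτ y hyN
  have hστ : σ ≤ 32 * τ := by rw [hvσ] at htri; linarith
  refine (hσ w).trans (mul_le_mul_of_nonneg_right hστ ?_)
  exact Finset.sum_nonneg fun i _ => mul_self_nonneg _

end QuadForm

/-! ### Eigenvalues and eigenspaces of a perturbed spiked matrix -/

section Spectral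

open Matrix

variable {n r : ℕ}

theorem exists_mulVec_eq_zero_of_lt {k l : ℕ} (h : k < l) (T : Matrix (Fin k) (Fin l) ℝ) :
    ∃ c : Fin l → ℝ, c ≠ 0 ∧ T *ᵥ c = 0 := by
  have h1 := LinearMap.ker_ne_bot_of_finrank_lt (f := T.mulVecLin) (by simpa using h)
  obtain ⟨c, hc, hc0⟩ := (Submodule.ne_bot_iff _).1 h1
  exact ⟨c, hc0, by simpa using hc⟩

theorem dotProduct_self_pos_of_ne_zero {k : ℕ} {c : Fin k → ℝ} (hc : c ≠ 0) : 0 < c ⬝ᵥ c := by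
  refine lt_of_le_of_ne (Finset.sum_nonneg fun i _ => mul_self_nonneg _) fun h => hc ?_
  exact dotProduct_self_eq_zero.1 h.symm

theorem dotProduct_self_nonneg' {k : ℕ} (c : Fin k → ℝ) : 0 ≤ c ⬝ᵥ c :=
  Finset.sum_nonneg fun _ _ => mul_self_nonneg _

theorem mulVec_dotProduct_mulVec_of_orthonormal {k l : ℕ} {U : Matrix (Fin k) (Fin l) ℝ}
    (hU : Uᵀ * U = 1) (b c : Fin l → ℝ) : U *ᵥ b ⬝ᵥ U *ᵥ c = b ⬝ᵥ c := by
  rw [Matrix.dotProduct_mulVec, ← Matrix.mulVec_transpose, Matrix.mulVec_mulVec, hU,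
    Matrix.one_mulVec]

/-- `Y = α I + U M U' + F` with `M ≥ γ` and `|F| ≤ φ`. -/
structure IsPerturbedSpike (Y : Matrix (Fin n) (Fin n) ℝ) (U : Matrix (Fin n) (Fin r) ℝ)
    (M : Matrix (Fin r) (Fin r) ℝ) (F : Matrix (Fin n) (Fin n) ℝ) (α γ φ : ℝ) : Prop where
  eq : Y = α • (1 : Matrix (Fin n) (Fin n) ℝ) + U * M * Uᵀ + F
  orthonormal : Uᵀ * U = 1
  symm : F.IsSymm
  le_M : ∀ b : Fin r → ℝ, γ * (b ⬝ᵥ b) ≤ b ⬝ᵥ M *ᵥ b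
  F_le : ∀ w : Fin n → ℝ, |w ⬝ᵥ F *ᵥ w| ≤ φ * (w ⬝ᵥ w)
  gap : 0 < γ
  phi_nonneg : 0 ≤ φ
  phi_le : φ ≤ γ / 4

namespace IsPerturbedSpike

variable {Y F W : Matrix (Fin n) (Fin n) ℝ} {U : Matrix (Fin n) (Fin r) ℝ}
  {M : Matrix (Fin r) (Fin r) ℝ} {α γ φ : ℝ} {μ : Fin n → ℝ}

theorem bilin_eq (h : IsPerturbedSpike Y U M F α γ φ) (z w : Fin n → ℝ) :
    z ⬝ᵥ Y *ᵥ w = α * (z ⬝ᵥ w) + (Uᵀ *ᵥ z) ⬝ᵥ M *ᵥ (Uᵀ *ᵥ w) + z ⬝ᵥ F *ᵥ w := by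
  conv_lhs => rw [h.eq]
  rw [Matrix.add_mulVec, Matrix.add_mulVec, dotProduct_add, dotProduct_add, Matrix.smul_mulVec,
    Matrix.one_mulVec, dotProduct_smul, smul_eq_mul, ← Matrix.mulVec_mulVec,
    ← Matrix.mulVec_mulVec, Matrix.dotProduct_mulVec z U, ← Matrix.mulVec_transpose]

/-- Courant–Fischer: the first r + 1 eigenvectors span a nonzero vector orthogonal to the range of
U, and there the spike vanishes. -/
theorem tail_le (h : IsPerturbedSpike Y U M F α γ φ) (hW : Wᵀ * W = 1) (hμ : Antitone μ)
    (hYW : Y * W = W * Matrix.diagonal μ) {i : Fin n} (hi : r ≤ i) : μ i ≤ α + φ := by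
  have hlt : r + 1 ≤ n := by have := i.2; omega
  set W' : Matrix (Fin n) (Fin (r + 1)) ℝ := W.submatrix id (Fin.castLE hlt) with hW'
  obtain ⟨c, hc0, hc⟩ := exists_mulVec_eq_zero_of_lt (Nat.lt_succ_self r) (Uᵀ * W')
  have hW'o : W'ᵀ * W' = 1 := by
    ext a b
    have := congrFun (congrFun hW (Fin.castLE hlt a)) (Fin.castLE hlt b)
    simp only [hW', Matrix.mul_apply, Matrix.transpose_apply, Matrix.submatrix_apply, id] at this ⊢
    rw [this]; simp [Matrix.one_apply]
  have hYW' : Y * W' = W' * Matrix.diagonal (fun j => μ (Fin.castLE hlt j)) := by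
    ext a b
    have := congrFun (congrFun hYW a) (Fin.castLE hlt b)
    simpa [hW', Matrix.mul_apply, Matrix.diagonal_apply] using this
  set y := W' *ᵥ c with hy
  have hyy : y ⬝ᵥ y = c ⬝ᵥ c := mulVec_dotProduct_mulVec_of_orthonormal hW'o c c
  have hUy : Uᵀ *ᵥ y = 0 := by rw [hy, Matrix.mulVec_mulVec, hc]
  have hyY : y ⬝ᵥ Y *ᵥ y = ∑ j, μ (Fin.castLE hlt j) * c j ^ 2 := by
    rw [hy, Matrix.mulVec_mulVec, hYW', ← Matrix.mulVec_mulVec,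
      mulVec_dotProduct_mulVec_of_orthonormal hW'o, dotProduct]
    exact Finset.sum_congr rfl fun j _ => by rw [Matrix.mulVec_diagonal]; ring
  have h1 : μ i * (c ⬝ᵥ c) ≤ y ⬝ᵥ Y *ᵥ y := by
    rw [hyY, dotProduct, Finset.mul_sum]
    refine Finset.sum_le_sum fun j _ => ?_
    rw [← sq]
    refine mul_le_mul_of_nonneg_right (hμ ?_) (sq_nonneg _)
    rw [Fin.le_def]
    have := j.2
    simp only [Fin.val_castLE]; omega
  have h2 := h.bilin_eq y y
  rw [hUy, hyy] at h2
  have h3 := (abs_le.1 (h.F_le y)).2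
  rw [hyy] at h3
  have hcc := dotProduct_self_pos_of_ne_zero hc0
  simp only [zero_dotProduct, add_zero] at h2
  refine le_of_mul_le_mul_right (a := c ⬝ᵥ c) ?_ hcc
  linarith

/-- The dual count: for i < r the range of U contains a nonzero vector orthogonal to the i
eigenvectors preceding index i. -/
theorem le_head (h : IsPerturbedSpike Y U M F α γ φ) (hW : Wᵀ * W = 1) (hμ : Antitone μ)
    (hYW : Y * W = W * Matrix.diagonal μ) {i : Fin n} (hi : (i : ℕ) < r) : α + γ - φ ≤ μ i := by
  set W' : Matrix (Fin n) (Fin i) ℝ := W.submatrix id (Fin.castLE i.2.le) with hW'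
  obtain ⟨b, hb0, hb⟩ := exists_mulVec_eq_zero_of_lt hi (W'ᵀ * U)
  set y := U *ᵥ b with hy
  have hyy : y ⬝ᵥ y = b ⬝ᵥ b := mulVec_dotProduct_mulVec_of_orthonormal h.orthonormal b b
  have hUy : Uᵀ *ᵥ y = b := by rw [hy, Matrix.mulVec_mulVec, h.orthonormal, Matrix.one_mulVec]
  have hz : ∀ j : Fin n, j < i → (Wᵀ *ᵥ y) j = 0 := by
    intro j hj
    have := congrFun hb ⟨j, hj⟩
    rw [← Matrix.mulVec_mulVec, ← hy] at this
    simpa [Matrix.mulVec, dotProduct, hW'] using this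
  have h1 : y ⬝ᵥ Y *ᵥ y ≤ μ i * (b ⬝ᵥ b) := by
    rw [quadForm_eq_sum hW hYW, ← hyy, ← dotProduct_transpose_mulVec_self hW y, dotProduct,
      Finset.mul_sum]
    refine Finset.sum_le_sum fun j _ => ?_
    rw [← sq]
    rcases lt_or_ge j i with hj | hj
    · rw [hz j hj]; simp
    · exact mul_le_mul_of_nonneg_right (hμ hj) (sq_nonneg _)
  have h2 := h.bilin_eq y y
  rw [hUy, hyy] at h2
  have h3 := (abs_le.1 (h.F_le y)).1
  rw [hyy] at h3
  have h4 := h.le_M b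
  refine le_of_mul_le_mul_right (a := b ⬝ᵥ b) ?_ (dotProduct_self_pos_of_ne_zero hb0)
  linarith

theorem le_all (h : IsPerturbedSpike Y U M F α γ φ) (hW : Wᵀ * W = 1)
    (hYW : Y * W = W * Matrix.diagonal μ) (i : Fin n) : α - φ ≤ μ i := by
  set y := W *ᵥ Pi.single i 1 with hy
  have hyy : y ⬝ᵥ y = 1 := by
    rw [hy, mulVec_dotProduct_mulVec_of_orthonormal hW]; simp
  have hyY : y ⬝ᵥ Y *ᵥ y = μ i := by
    rw [hy, Matrix.mulVec_mulVec, hYW, ← Matrix.mulVec_mulVec,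
      mulVec_dotProduct_mulVec_of_orthonormal hW]
    simp
  have h2 := h.bilin_eq y y
  have h3 := (abs_le.1 (h.F_le y)).1
  have h4 := h.le_M (Uᵀ *ᵥ y)
  have h5 := mul_nonneg h.gap.le (dotProduct_self_nonneg' (Uᵀ *ᵥ y))
  rw [hyY] at h2
  rw [hyy] at h2 h3
  linarith

end IsPerturbedSpike

/-- The indicator of the first `r` indices. -/
def headInd (n r : ℕ) (i : Fin n) : ℝ := if (i : ℕ) < r then 1 else 0

theorem mul_transpose_eq_of_cols {hs : r ≤ n} {W : Matrix (Fin n) (Fin n) ℝ}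
    {V : Matrix (Fin n) (Fin r) ℝ} (hV : ∀ i j, V i j = W i (Fin.castLE hs j)) :
    V * Vᵀ = W * Matrix.diagonal (headInd n r) * Wᵀ := by
  ext i j
  simp only [Matrix.mul_apply, Matrix.transpose_apply, Matrix.diagonal_apply, hV, headInd]
  have e : ∀ x : Fin n, (∑ l, W i l * if l = x then (if (l : ℕ) < r then (1 : ℝ) else 0) else 0)
      * W j x = if (x : ℕ) < r then W i x * W j x else 0 := by
    intro x; simp
  simp_rw [e]
  rw [← Finset.sum_filter]
  refine Finset.sum_bij (fun (l : Fin r) _ => Fin.castLE hs l) (fun l _ => by simp)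
    (fun a _ b _ hab => by simpa using hab) (fun x hx => ?_) (fun l _ => rfl)
  exact ⟨⟨x, (Finset.mem_filter.1 hx).2⟩, Finset.mem_univ _, rfl⟩

theorem transpose_mul_self_of_cols {hs : r ≤ n} {W : Matrix (Fin n) (Fin n) ℝ}
    {V : Matrix (Fin n) (Fin r) ℝ} (hW : Wᵀ * W = 1) (hV : ∀ i j, V i j = W i (Fin.castLE hs j)) :
    Vᵀ * V = 1 := by
  ext a b
  have := congrFun (congrFun hW (Fin.castLE hs a)) (Fin.castLE hs b)
  simp only [Matrix.mul_apply, Matrix.transpose_apply, hV] at this ⊢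
  rw [this]; simp [Matrix.one_apply]

theorem IsTopEigenvectors.transpose_mul_self {Y : Matrix (Fin n) (Fin n) ℝ}
    {V : Matrix (Fin n) (Fin r) ℝ} (h : IsTopEigenvectors Y V) : Vᵀ * V = 1 := by
  obtain ⟨hs, μ, W, hW, -, -, hV⟩ := h
  exact transpose_mul_self_of_cols hW hV

theorem exists_isTopEigenvectors (hs : r ≤ n) {Y : Matrix (Fin n) (Fin n) ℝ} (hY : Y.IsSymm) :
    ∃ V : Matrix (Fin n) (Fin r) ℝ, IsTopEigenvectors Y V := by
  obtain ⟨μ, W, hW, hμ, hYW, -⟩ := exists_sorted_diagonalization hY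
  exact ⟨fun i j => W i (Fin.castLE hs j), hs, μ, W, hW, hμ, hYW, fun _ _ => rfl⟩

/-- A sin-theta bound tested at the worst direction. Let Q = I - VV', let v be a unit top
eigenvector of U'QU with eigenvalue κ, and z = QUv. Then z'z = κ and U'z = κv. As Q commutes with Y,
z'Y(Uv) = z'Yz ≤ (α + φ)κ, whereas the decomposition of Y makes the left side at least ακ + γκ +
z'F(Uv). Since |z'F(Uv)| ≤ φ√κ, this leaves √κ ≤ φ/(γ - φ). -/
theorem IsPerturbedSpike.residual_le {Y F : Matrix (Fin n) (Fin n) ℝ}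
    {U V : Matrix (Fin n) (Fin r) ℝ} {M : Matrix (Fin r) (Fin r) ℝ} {α γ φ : ℝ} (hr : 0 < r)
    (h : IsPerturbedSpike Y U M F α γ φ) (hV : IsTopEigenvectors Y V) (b : Fin r → ℝ) :
    (((1 - V * Vᵀ) * U) *ᵥ b) ⬝ᵥ (((1 - V * Vᵀ) * U) *ᵥ b) ≤ (φ / (γ - φ)) ^ 2 * (b ⬝ᵥ b) := by
  obtain ⟨hs, μ, W, hW, hμ, hYW, hVW⟩ := hV
  have hWW := mul_eq_one_comm.1 hW
  set Q : Matrix (Fin n) (Fin n) ℝ := 1 - V * Vᵀ with hQ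
  have hQW : Q = W * Matrix.diagonal (fun i => 1 - headInd n r i) * Wᵀ := by
    rw [hQ, mul_transpose_eq_of_cols hVW]
    have : Matrix.diagonal (fun i => 1 - headInd n r i)
        = (1 : Matrix (Fin n) (Fin n) ℝ) - Matrix.diagonal (headInd n r) := by
      rw [← Matrix.diagonal_one, Matrix.diagonal_sub]
    rw [this, Matrix.mul_sub, Matrix.sub_mul, Matrix.mul_one, hWW]
  have hYWt : Y = W * Matrix.diagonal μ * Wᵀ := by
    rw [← hYW, Matrix.mul_assoc, hWW, Matrix.mul_one]
  have hVV : Vᵀ * V = 1 := transpose_mul_self_of_cols hW hVW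
  have hQs : Qᵀ = Q := by
    rw [hQ, Matrix.transpose_sub, Matrix.transpose_mul, Matrix.transpose_transpose,
      Matrix.transpose_one]
  have hQQ : Q * Q = Q := by
    have : V * Vᵀ * (V * Vᵀ) = V * Vᵀ := by
      rw [Matrix.mul_assoc, ← Matrix.mul_assoc Vᵀ, hVV, Matrix.one_mul]
    rw [hQ, Matrix.mul_sub, Matrix.sub_mul, Matrix.sub_mul, this]; simp
  have hcomm : Q * Y = Y * Q := by
    have hmul : ∀ D E : Fin n → ℝ, (W * Matrix.diagonal D * Wᵀ) * (W * Matrix.diagonal E * Wᵀ)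
        = W * Matrix.diagonal (fun i => D i * E i) * Wᵀ := by
      intro D E
      calc _ = W * Matrix.diagonal D * (Wᵀ * W) * Matrix.diagonal E * Wᵀ := by
            simp only [Matrix.mul_assoc]
        _ = _ := by rw [hW, Matrix.mul_one, Matrix.mul_assoc W, Matrix.diagonal_mul_diagonal]
    rw [hQW]
    conv_lhs => rw [hYWt]
    conv_rhs => rw [hYWt]
    rw [hmul, hmul]
    simp only [mul_comm]
  -- The range of Q is spanned by the trailing eigenvectors, whose eigenvalues are at most α + φ.
  have hrange : ∀ x : Fin n → ℝ, (Q *ᵥ x) ⬝ᵥ Y *ᵥ (Q *ᵥ x) ≤ (α + φ) * ((Q *ᵥ x) ⬝ᵥ (Q *ᵥ x)) := by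
    intro x
    rw [quadForm_eq_sum hW hYW, ← dotProduct_transpose_mulVec_self hW (Q *ᵥ x), dotProduct,
      Finset.mul_sum]
    refine Finset.sum_le_sum fun i _ => ?_
    rw [← sq]
    rcases lt_or_ge (i : ℕ) r with hi | hi
    · have : (Wᵀ *ᵥ (Q *ᵥ x)) i = 0 := by
        rw [Matrix.mulVec_mulVec, hQW, ← Matrix.mul_assoc, ← Matrix.mul_assoc, hW, Matrix.one_mul,
          ← Matrix.mulVec_mulVec, Matrix.mulVec_diagonal]
        simp [headInd, hi]
      rw [this]; simp
    · exact mul_le_mul_of_nonneg_right (h.tail_le hW hμ hYW hi) (sq_nonneg _)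
  set K : Matrix (Fin r) (Fin r) ℝ := Uᵀ * Q * U with hK
  have hKs : K.IsSymm := by
    rw [Matrix.IsSymm, hK, Matrix.transpose_mul, Matrix.transpose_mul, Matrix.transpose_transpose,
      hQs, Matrix.mul_assoc]
  have hKq : ∀ b : Fin r → ℝ, b ⬝ᵥ K *ᵥ b = ((Q * U) *ᵥ b) ⬝ᵥ ((Q * U) *ᵥ b) := by
    intro b
    have e : K = (Q * U)ᵀ * (Q * U) := by
      rw [Matrix.transpose_mul, hQs, hK, Matrix.mul_assoc, Matrix.mul_assoc, ← Matrix.mul_assoc Q Q,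
        hQQ]
    rw [e, ← Matrix.mulVec_mulVec, Matrix.dotProduct_mulVec, Matrix.vecMul_transpose]
  obtain ⟨v, hv, hKv, hKmax⟩ := exists_lamMax_eigenvector hr hKs
  set κ := lamMax K with hκ
  set z := Q *ᵥ (U *ᵥ v) with hz
  have hzz : z ⬝ᵥ z = κ := by
    have := hKq v
    rw [hKv, dotProduct_smul, hv, ← Matrix.mulVec_mulVec, ← hz] at this
    simpa using this.symm
  have hκ0 : 0 ≤ κ := hzz ▸ dotProduct_self_nonneg' z
  have hUz : Uᵀ *ᵥ z = κ • v := by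
    rw [hz, Matrix.mulVec_mulVec, Matrix.mulVec_mulVec, ← hKv, hK]
  have hUUv : Uᵀ *ᵥ (U *ᵥ v) = v := by
    rw [Matrix.mulVec_mulVec, h.orthonormal, Matrix.one_mulVec]
  have hQz : Q *ᵥ z = z := by rw [hz, Matrix.mulVec_mulVec, hQQ]
  have hmove : ∀ w : Fin n → ℝ, z ⬝ᵥ w = z ⬝ᵥ Q *ᵥ w := by
    intro w
    rw [Matrix.dotProduct_mulVec, ← Matrix.mulVec_transpose, hQs, hQz]
  have e1 : z ⬝ᵥ Y *ᵥ (U *ᵥ v) = z ⬝ᵥ Y *ᵥ z := by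
    rw [hmove, Matrix.mulVec_mulVec, hcomm, ← Matrix.mulVec_mulVec, ← hz]
  have e2 := h.bilin_eq z (U *ᵥ v)
  rw [hUz, hUUv, smul_dotProduct, smul_eq_mul, e1, hmove (U *ᵥ v), ← hz, hzz] at e2
  have e3 := hrange (U *ᵥ v)
  rw [← hz, hzz, e2] at e3
  have e4 := mul_le_mul_of_nonneg_left (h.le_M v) hκ0
  rw [hv] at e4
  have e5 := bilin_sq_le_of_quadForm_le h.symm h.F_le z (U *ᵥ v)
  rw [hzz, mulVec_dotProduct_mulVec_of_orthonormal h.orthonormal, hv] at e5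
  have hg : 0 < γ - φ := by linarith [h.gap, h.phi_le]
  have e6 : κ * (γ - φ) ≤ -(z ⬝ᵥ F *ᵥ (U *ᵥ v)) := by linarith
  have e7 : (κ * (γ - φ)) ^ 2 ≤ φ ^ 2 * κ := by
    have := pow_le_pow_left₀ (mul_nonneg hκ0 hg.le) e6 2
    rw [neg_sq] at this
    linarith
  have e8 : κ ≤ (φ / (γ - φ)) ^ 2 := by
    rw [div_pow, le_div_iff₀ (by positivity)]
    rcases hκ0.eq_or_lt with h0 | h0
    · rw [← h0]; simp; positivity
    · refine le_of_mul_le_mul_left (a := κ) ?_ h0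
      nlinarith
  rw [← hKq]
  exact (hKmax b).trans (mul_le_mul_of_nonneg_right e8 (dotProduct_self_nonneg' b))

theorem SE_le_of_residual {U V : Matrix (Fin n) (Fin r) ℝ} {c : ℝ} (hc : 0 ≤ c)
    (h : ∀ b : Fin r → ℝ,
      (((1 - V * Vᵀ) * U) *ᵥ b) ⬝ᵥ (((1 - V * Vᵀ) * U) *ᵥ b) ≤ c ^ 2 * (b ⬝ᵥ b)) :
    SE V U ≤ c := by
  unfold SE
  rw [Matrix.l2_opNorm_def]
  refine ContinuousLinearMap.opNorm_le_bound _ hc fun x => ?_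
  refine abs_le_of_sq_le_sq' ?_ (by positivity) |>.2
  rw [mul_pow, EuclideanSpace.real_norm_sq_eq, EuclideanSpace.real_norm_sq_eq]
  have := h x.ofLp
  simp only [dotProduct, ← sq] at this
  exact this

/-- The limit of `(1 + A^(2N))⁻¹ A^(2N)`: the projection onto the eigenspaces of `A` with
eigenvalues outside of the unit interval. -/
def specProj (A : Matrix (Fin n) (Fin n) ℝ) : Matrix (Fin n) (Fin n) ℝ := fun i j =>
  Filter.limsup (fun N : ℕ => ((1 + A ^ (2 * N))⁻¹ * A ^ (2 * N)) i j) Filter.atTop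

/-- In the eigenbasis the matrices are diagonal with entries ν^(2N)/(1 + ν^(2N)), which tend to 1 or
0 according as |ν| is above or below 1. The limit uses only matrix algebra on A, hence is measurable
in A, unlike an arbitrary choice of eigenvectors. -/
theorem specProj_eq {hs : r ≤ n} {A W : Matrix (Fin n) (Fin n) ℝ} {ν : Fin n → ℝ}
    {V : Matrix (Fin n) (Fin r) ℝ} (hW : Wᵀ * W = 1) (hA : A * W = W * Matrix.diagonal ν)
    (hV : ∀ i j, V i j = W i (Fin.castLE hs j))
    (h1 : ∀ i : Fin n, (i : ℕ) < r → 1 < ν i) (h2 : ∀ i : Fin n, r ≤ (i : ℕ) → |ν i| < 1) :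
    specProj A = V * Vᵀ := by
  have hWW := mul_eq_one_comm.1 hW
  have hmul : ∀ D E : Fin n → ℝ, (W * Matrix.diagonal D * Wᵀ) * (W * Matrix.diagonal E * Wᵀ)
      = W * Matrix.diagonal (fun i => D i * E i) * Wᵀ := by
    intro D E
    calc _ = W * Matrix.diagonal D * (Wᵀ * W) * Matrix.diagonal E * Wᵀ := by
          simp only [Matrix.mul_assoc]
      _ = _ := by rw [hW, Matrix.mul_one, Matrix.mul_assoc W, Matrix.diagonal_mul_diagonal]
  have hone : W * Matrix.diagonal (fun _ => (1 : ℝ)) * Wᵀ = 1 := by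
    rw [Matrix.diagonal_one, Matrix.mul_one, hWW]
  have hA1 : A = W * Matrix.diagonal ν * Wᵀ := by
    rw [← hA, Matrix.mul_assoc, hWW, Matrix.mul_one]
  have hpow : ∀ k : ℕ, A ^ k = W * Matrix.diagonal (fun i => ν i ^ k) * Wᵀ := by
    intro k
    induction k with
    | zero => simpa using hone.symm
    | succ k ih =>
      rw [pow_succ, ih]
      conv_lhs => rw [hA1]
      rw [hmul]
      simp only [pow_succ]
  have hpos : ∀ (N : ℕ) i, (0 : ℝ) < 1 + ν i ^ (2 * N) := fun N i => by
    rw [pow_mul]; positivity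
  have hfun : ∀ N : ℕ, (1 + A ^ (2 * N))⁻¹ * A ^ (2 * N)
      = W * Matrix.diagonal (fun i => (1 + ν i ^ (2 * N))⁻¹ * ν i ^ (2 * N)) * Wᵀ := by
    intro N
    have e1 : 1 + A ^ (2 * N) = W * Matrix.diagonal (fun i => 1 + ν i ^ (2 * N)) * Wᵀ := by
      rw [hpow]
      conv_lhs => rw [← hone]
      rw [← Matrix.add_mul, ← Matrix.mul_add, Matrix.diagonal_add]
    have e2 : (1 + A ^ (2 * N))⁻¹ = W * Matrix.diagonal (fun i => (1 + ν i ^ (2 * N))⁻¹) * Wᵀ := by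
      refine Matrix.inv_eq_left_inv ?_
      rw [e1, hmul, ← hone]
      congr 3
      ext i
      exact inv_mul_cancel₀ (hpos N i).ne'
    rw [e2, hpow, hmul]
  have hlim : ∀ i, Filter.Tendsto (fun N : ℕ => (1 + ν i ^ (2 * N))⁻¹ * ν i ^ (2 * N)) Filter.atTop
      (nhds (headInd n r i)) := by
    intro i
    unfold headInd
    split_ifs with hi
    · have hgt : 1 < ν i ^ 2 := by nlinarith [h1 i hi]
      have ht : Filter.Tendsto (fun N : ℕ => (ν i ^ 2)⁻¹ ^ N) Filter.atTop (nhds 0) :=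
        tendsto_pow_atTop_nhds_zero_of_lt_one (by positivity) (inv_lt_one_of_one_lt₀ hgt)
      have e : ∀ N : ℕ, (1 + ν i ^ (2 * N))⁻¹ * ν i ^ (2 * N) = ((ν i ^ 2)⁻¹ ^ N + 1)⁻¹ := by
        intro N
        have : (0 : ℝ) < ν i ^ 2 := by linarith
        have := hpos N i
        rw [pow_mul] at *
        rw [inv_pow]
        have : 0 < (ν i ^ 2) ^ N := by positivity
        field_simp
      simp_rw [e]
      have := (ht.add_const 1).inv₀ (by norm_num)
      simpa using this
    · have hlt : ν i ^ 2 < 1 := by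
        have := h2 i (not_lt.1 hi)
        rw [← sq_abs]; nlinarith [abs_nonneg (ν i)]
      have ht : Filter.Tendsto (fun N : ℕ => ν i ^ (2 * N)) Filter.atTop (nhds 0) := by
        simp_rw [pow_mul]
        exact tendsto_pow_atTop_nhds_zero_of_lt_one (sq_nonneg _) hlt
      have := ((ht.const_add 1).inv₀ (by norm_num)).mul ht
      simpa using this
  ext i j
  unfold specProj
  rw [mul_transpose_eq_of_cols hV]
  refine Filter.Tendsto.limsup_eq ?_
  simp_rw [hfun]
  simp only [Matrix.mul_apply, Matrix.transpose_apply, Matrix.diagonal_apply, mul_ite, mul_zero,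
    Finset.sum_ite_eq', Finset.mem_univ, if_true]
  exact tendsto_finsetSum _ fun l _ => ((hlim l).const_mul _).mul_const _

/-- After centring at α and scaling by 2/γ, the leading r eigenvalues are at least 2(γ - φ)/γ ≥ 3/2
and the others are at most 2φ/γ ≤ 1/2 in absolute value. This is where φ ≤ γ/4 enters. -/
theorem IsPerturbedSpike.specProj_eq {Y F : Matrix (Fin n) (Fin n) ℝ}
    {U V : Matrix (Fin n) (Fin r) ℝ} {M : Matrix (Fin r) (Fin r) ℝ} {α γ φ : ℝ}
    (h : IsPerturbedSpike Y U M F α γ φ) (hV : IsTopEigenvectors Y V) :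
    specProj ((2 / γ) • (Y - α • (1 : Matrix (Fin n) (Fin n) ℝ))) = V * Vᵀ := by
  obtain ⟨hs, μ, W, hW, hμ, hYW, hVW⟩ := hV
  have hγ := h.gap
  have hφ := h.phi_le
  refine LRPR.specProj_eq (ν := fun i => 2 / γ * (μ i - α)) hW ?_ hVW (fun i hi => ?_)
    (fun i hi => ?_)
  · rw [Matrix.smul_mul, Matrix.sub_mul, hYW, Matrix.smul_mul, Matrix.one_mul]
    ext a b
    simp [Matrix.mul_apply, Matrix.diagonal_apply]
    ring
  · have := h.le_head hW hμ hYW hi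
    rw [div_mul_eq_mul_div, lt_div_iff₀ hγ]
    linarith
  · have h1 := h.tail_le hW hμ hYW hi
    have h2 := h.le_all hW hYW i
    rw [abs_lt, div_mul_eq_mul_div, lt_div_iff₀ hγ, div_lt_iff₀ hγ]
    constructor <;> linarith

end Spectral

/-! ### Deterministic error of the estimated signals -/

section Deterministic

open Matrix

variable {n r mt : ℕ}

theorem ofLp_dotProduct_self (x : EuclideanSpace ℝ (Fin n)) : x.ofLp ⬝ᵥ x.ofLp = ‖x‖ ^ 2 := by
  rw [EuclideanSpace.real_norm_sq_eq]
  exact Finset.sum_congr rfl fun i _ => by ring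

theorem ofLp_dotProduct (x y : EuclideanSpace ℝ (Fin n)) : x.ofLp ⬝ᵥ y.ofLp = inner ℝ x y := by
  simp [PiLp.inner_apply, dotProduct, mul_comm]

theorem dotProduct_outer_mulVec (a x : EuclideanSpace ℝ (Fin n)) :
    x.ofLp ⬝ᵥ outer a *ᵥ x.ofLp = inner ℝ a x ^ 2 := by
  rw [outer, Matrix.vecMulVec_mulVec, ← ofLp_dotProduct, dotProduct_smul,
    dotProduct_comm x.ofLp, op_smul_eq_mul, sq]

theorem isSymm_outer (a : EuclideanSpace ℝ (Fin n)) : (outer a).IsSymm := by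
  ext i j
  simp [outer, Matrix.vecMulVec_apply, mul_comm]

theorem isSymm_sum {ι : Type*} (s : Finset ι) {A : ι → Matrix (Fin n) (Fin n) ℝ}
    (h : ∀ i ∈ s, (A i).IsSymm) : (∑ i ∈ s, A i).IsSymm := by
  rw [Matrix.IsSymm, Matrix.transpose_sum]
  exact Finset.sum_congr rfl fun i hi => h i hi

/-- The deviation of `(1/m̃) ∑_i y_i^new a_i^new a_i^new'` from its mean. -/
def newDev (anew : Fin mt → EuclideanSpace ℝ (Fin n)) (x : EuclideanSpace ℝ (Fin n)) :
    Matrix (Fin n) (Fin n) ℝ :=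
  (1 / (mt : ℝ)) • ∑ i, meas (anew i) x • outer (anew i)
    - ‖x‖ ^ 2 • (1 : Matrix (Fin n) (Fin n) ℝ) - (2 : ℝ) • outer x

theorem isSymm_newDev (anew : Fin mt → EuclideanSpace ℝ (Fin n)) (x : EuclideanSpace ℝ (Fin n)) :
    (newDev anew x).IsSymm :=
  (((isSymm_sum _ fun i _ => (isSymm_outer (anew i)).smul _).smul _).sub
    (Matrix.isSymm_one.smul _)).sub ((isSymm_outer x).smul _)

theorem quadForm_sq_le_sum_sq {k : ℕ} (L : Matrix (Fin k) (Fin k) ℝ) (z : Fin k → ℝ) :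
    (z ⬝ᵥ L *ᵥ z) ^ 2 ≤ (∑ i, ∑ j, L i j ^ 2) * (z ⬝ᵥ z) ^ 2 := by
  have h1 : (z ⬝ᵥ L *ᵥ z) ^ 2 ≤ (∑ i, z i ^ 2) * ∑ i, (L *ᵥ z) i ^ 2 :=
    Finset.sum_mul_sq_le_sq_mul_sq _ _ _
  have h2 : ∀ i, (L *ᵥ z) i ^ 2 ≤ (∑ j, L i j ^ 2) * ∑ j, z j ^ 2 := fun i => by
    simp only [Matrix.mulVec, dotProduct]
    exact Finset.sum_mul_sq_le_sq_mul_sq _ _ _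
  have h3 : z ⬝ᵥ z = ∑ i, z i ^ 2 := Finset.sum_congr rfl fun i _ => by ring
  rw [h3]
  calc _ ≤ (∑ i, z i ^ 2) * ∑ i, ((∑ j, L i j ^ 2) * ∑ j, z j ^ 2) := by
        refine h1.trans (mul_le_mul_of_nonneg_left (Finset.sum_le_sum fun i _ => h2 i) ?_)
        positivity
    _ = _ := by rw [← Finset.sum_mul]; ring

/-- The squared Frobenius norm of the compression V'NV depends on V only through the projector VV',
so a condition on it can be stated without choosing eigenvectors. -/
theorem trace_sq_eq_sum_sq {V : Matrix (Fin n) (Fin r) ℝ} {N : Matrix (Fin n) (Fin n) ℝ}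
    (hN : N.IsSymm) :
    Matrix.trace (V * Vᵀ * N * (V * Vᵀ) * N) = ∑ i, ∑ j, (Vᵀ * N * V) i j ^ 2 := by
  have e1 : Matrix.trace (V * Vᵀ * N * (V * Vᵀ) * N)
      = Matrix.trace ((Vᵀ * N * V) * (Vᵀ * N * V)) := by
    have : V * Vᵀ * N * (V * Vᵀ) * N = V * (Vᵀ * N * V * (Vᵀ * N)) := by
      simp only [Matrix.mul_assoc]
    rw [this, Matrix.trace_mul_comm]
    simp only [Matrix.mul_assoc]
  have hs : (Vᵀ * N * V)ᵀ = Vᵀ * N * V := by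
    rw [Matrix.transpose_mul, Matrix.transpose_mul, Matrix.transpose_transpose, hN.eq,
      Matrix.mul_assoc]
  rw [e1, Matrix.trace]
  refine Finset.sum_congr rfl fun i _ => ?_
  rw [Matrix.diag_apply, Matrix.mul_apply]
  refine Finset.sum_congr rfl fun j _ => ?_
  have := congrFun (congrFun hs j) i
  rw [Matrix.transpose_apply] at this
  rw [← this]; ring

theorem norm_sq_sub_add (x y : EuclideanSpace ℝ (Fin n)) :
    ‖x - y‖ ^ 2 = ‖x‖ ^ 2 - 2 * inner ℝ x y + ‖y‖ ^ 2 ∧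
      ‖x + y‖ ^ 2 = ‖x‖ ^ 2 + 2 * inner ℝ x y + ‖y‖ ^ 2 :=
  ⟨norm_sub_sq_real x y, norm_add_sq_real x y⟩

theorem phaseDist_sq_le (x y : EuclideanSpace ℝ (Fin n)) :
    phaseDist x y ^ 2 ≤ ‖x‖ ^ 2 - 2 * |inner ℝ x y| + ‖y‖ ^ 2 := by
  obtain ⟨h1, h2⟩ := norm_sq_sub_add x y
  have h0 : 0 ≤ phaseDist x y := le_min (norm_nonneg _) (norm_nonneg _)
  rcases abs_cases (inner ℝ x y) with ⟨h, _⟩ | ⟨h, _⟩ <;> rw [h]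
  · rw [← h1]; exact pow_le_pow_left₀ h0 (min_le_left _ _) 2
  · have := pow_le_pow_left₀ h0 (min_le_right ‖x - y‖ ‖x + y‖) 2
    rw [h2] at this; linarith

/-- The left side is (ν - X)² + 2ν(X - p). The first term is at most εX²; in the second, X - p ≤ 2εX
and ν ≤ 2X, which adds 8εX². -/
theorem sq_sub_add_sq_le {X ν ε p : ℝ} (hX : 0 < X) (hν0 : 0 ≤ ν) (hε : 0 < ε) (hε1 : ε < 1)
    (hν : |ν ^ 2 - X ^ 2| ≤ ε * X ^ 2) (hp : (1 - 2 * ε) * X ≤ p) :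
    X ^ 2 - 2 * (ν * p) + ν ^ 2 ≤ 9 * ε * X ^ 2 := by
  have h8 : |ν - X| ≤ ε * X := by
    refine le_of_mul_le_mul_right (a := X) ?_ hX
    calc |ν - X| * X ≤ |ν - X| * (ν + X) := by gcongr; linarith
      _ = |ν ^ 2 - X ^ 2| := by
        rw [show ν ^ 2 - X ^ 2 = (ν - X) * (ν + X) by ring, abs_mul,
          abs_of_nonneg (by positivity : 0 ≤ ν + X)]
      _ ≤ ε * X * X := by rw [mul_assoc, ← sq]; exact hν
  obtain ⟨h9, h10⟩ := abs_le.1 h8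
  have h11 : ν * ((1 - 2 * ε) * X) ≤ ν * p := mul_le_mul_of_nonneg_left hp hν0
  have h12 : (ν - X) ^ 2 ≤ (ε * X) ^ 2 := sq_le_sq' h9 h10
  have h13 : ν * (ε * X) ≤ 2 * X * (ε * X) := by
    refine mul_le_mul_of_nonneg_right ?_ (by positivity); nlinarith
  have h14 : (ε * X) ^ 2 ≤ ε * X ^ 2 := by
    rw [mul_pow]; refine mul_le_mul_of_nonneg_right ?_ (by positivity); nlinarith
  linarith

/-- Up to an error ε|x|², the matrix Y_b is |x|² I + 2ww' with w = V'x and |w|² ≥ (1 - ε²)|x|².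
Comparing its top eigenvalue with the Rayleigh quotient at w shows that the top eigenvector v
satisfies (w'v)² ≥ |w|² - ε|x|² ≥ (1 - 2ε)|x|². Together with the estimate of |x| this bounds the
distance, the phase being the sign of w'v. -/
theorem phaseDist_output_le (hr : 0 < r) {V : Matrix (Fin n) (Fin r) ℝ} (hV : Vᵀ * V = 1)
    {x : EuclideanSpace ℝ (Fin n)} {anew : Fin mt → EuclideanSpace ℝ (Fin n)} {ε : ℝ}
    (hε : 0 < ε) (hε1 : ε < 1)
    (hx : ((1 - V * Vᵀ) *ᵥ x.ofLp) ⬝ᵥ ((1 - V * Vᵀ) *ᵥ x.ofLp) ≤ ε ^ 2 * ‖x‖ ^ 2)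
    (hN : Matrix.trace (V * Vᵀ * newDev anew x * (V * Vᵀ) * newDev anew x) ≤ ε ^ 2 * ‖x‖ ^ 4)
    (hν : |(1 / (mt : ℝ)) * ∑ i, meas (anew i) x - ‖x‖ ^ 2| ≤ ε * ‖x‖ ^ 2)
    {v : EuclideanSpace ℝ (Fin r)} (hv : IsTopEigenvector (matYb anew V x) v) :
    phaseDist x (mulE V (√((1 / (mt : ℝ)) * ∑ i, meas (anew i) x) • v)) ^ 2
      ≤ 9 * ε * ‖x‖ ^ 2 := by
  rcases eq_or_ne x 0 with rfl | hx0
  · simp [meas, phaseDist, mulE]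
  have hX : 0 < ‖x‖ := norm_pos_iff.2 hx0
  obtain ⟨hv1, hvY⟩ := hv
  rw [trace_sq_eq_sum_sq (isSymm_newDev anew x)] at hN
  set L := Vᵀ * newDev anew x * V with hL
  -- the quadratic form of `Y_b`
  have hYb : ∀ z : Fin r → ℝ, z ⬝ᵥ matYb anew V x *ᵥ z
      = z ⬝ᵥ L *ᵥ z + ‖x‖ ^ 2 * (z ⬝ᵥ z) + 2 * (x.ofLp ⬝ᵥ V *ᵥ z) ^ 2 := by
    intro z
    have e1 : ∀ A : Matrix (Fin n) (Fin n) ℝ, z ⬝ᵥ (Vᵀ * A * V) *ᵥ z = (V *ᵥ z) ⬝ᵥ A *ᵥ (V *ᵥ z) :=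
        by
      intro A
      rw [← Matrix.mulVec_mulVec, ← Matrix.mulVec_mulVec, Matrix.dotProduct_mulVec z Vᵀ,
        Matrix.vecMul_transpose]
    have e2 : (1 / (mt : ℝ)) • ∑ i, meas (anew i) x • outer (anew i)
        = newDev anew x + ‖x‖ ^ 2 • (1 : Matrix (Fin n) (Fin n) ℝ) + (2 : ℝ) • outer x := by
      rw [newDev]; abel
    have e3 := dotProduct_outer_mulVec x (WithLp.toLp 2 (V *ᵥ z))
    rw [← ofLp_dotProduct] at e3
    simp only [] at e3
    rw [matYb, e1, e2, hL, e1, Matrix.add_mulVec, Matrix.add_mulVec, dotProduct_add,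
      dotProduct_add, Matrix.smul_mulVec, Matrix.smul_mulVec, Matrix.one_mulVec, dotProduct_smul,
      dotProduct_smul, e3, mulVec_dotProduct_mulVec_of_orthonormal hV, smul_eq_mul, smul_eq_mul]
  have hYs : (matYb anew V x).IsSymm := by
    rw [Matrix.IsSymm, matYb, Matrix.transpose_mul, Matrix.transpose_mul,
      Matrix.transpose_transpose, Matrix.transpose_smul,
      (isSymm_sum _ fun i _ => (isSymm_outer (anew i)).smul _).eq, Matrix.mul_assoc]
  have hLz : ∀ z : Fin r → ℝ, |z ⬝ᵥ L *ᵥ z| ≤ ε * ‖x‖ ^ 2 * (z ⬝ᵥ z) := by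
    intro z
    refine abs_le_of_sq_le_sq ?_ (mul_nonneg (by positivity) (dotProduct_self_nonneg' z))
    refine (quadForm_sq_le_sum_sq L z).trans ?_
    refine (mul_le_mul_of_nonneg_right hN (sq_nonneg _)).trans (le_of_eq (by ring))
  obtain ⟨-, -, -, hmax⟩ := exists_lamMax_eigenvector hr hYs
  have hvv : v.ofLp ⬝ᵥ v.ofLp = 1 := by rw [ofLp_dotProduct_self, hv1]; norm_num
  have hvq : v.ofLp ⬝ᵥ matYb anew V x *ᵥ v.ofLp = lamMax (matYb anew V x) := by
    rw [hvY, dotProduct_smul, hvv]; simp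
  set w := Vᵀ *ᵥ x.ofLp with hw
  set t := w ⬝ᵥ w with ht
  have hxVz : ∀ z : Fin r → ℝ, x.ofLp ⬝ᵥ V *ᵥ z = w ⬝ᵥ z := by
    intro z; rw [Matrix.dotProduct_mulVec, ← Matrix.mulVec_transpose]
  have hpyth : ((1 - V * Vᵀ) *ᵥ x.ofLp) ⬝ᵥ ((1 - V * Vᵀ) *ᵥ x.ofLp) = ‖x‖ ^ 2 - t := by
    rw [Matrix.sub_mulVec, Matrix.one_mulVec, ← Matrix.mulVec_mulVec, ← hw, sub_dotProduct,
      dotProduct_sub, dotProduct_sub, mulVec_dotProduct_mulVec_of_orthonormal hV,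
      dotProduct_comm (V *ᵥ w), hxVz, ofLp_dotProduct_self]
    ring
  rw [hpyth] at hx
  have ht0 : (1 - ε ^ 2) * ‖x‖ ^ 2 ≤ t := by linarith
  have htpos : 0 < t := lt_of_lt_of_le (mul_pos (by nlinarith) (by positivity)) ht0
  have h1 := hmax w
  rw [hYb, hxVz, ← ht] at h1
  have h2 := hYb v.ofLp
  rw [hvq, hvv] at h2
  have h3 := (abs_le.1 (hLz w)).1
  have h4 := (abs_le.1 (hLz v.ofLp)).2
  rw [← ht] at h3
  rw [hvv] at h4
  set p := x.ofLp ⬝ᵥ V *ᵥ v.ofLp with hp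
  have h5 : ‖x‖ ^ 2 + 2 * t - ε * ‖x‖ ^ 2 ≤ lamMax (matYb anew V x) := by
    refine le_of_mul_le_mul_right (a := t) ?_ htpos
    nlinarith
  have h6 : (1 - 2 * ε) * ‖x‖ ^ 2 ≤ p ^ 2 := by
    have : ε ^ 2 * ‖x‖ ^ 2 ≤ ε * ‖x‖ ^ 2 := by
      refine mul_le_mul_of_nonneg_right ?_ (by positivity); nlinarith
    nlinarith
  have h7 : (1 - 2 * ε) * ‖x‖ ≤ |p| := by
    rcases le_or_gt (1 - 2 * ε) 0 with h | h
    · exact (mul_nonpos_of_nonpos_of_nonneg h hX.le).trans (abs_nonneg _)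
    · have : (1 - 2 * ε) ^ 2 * ‖x‖ ^ 2 ≤ (1 - 2 * ε) * ‖x‖ ^ 2 := by
        refine mul_le_mul_of_nonneg_right ?_ (by positivity); nlinarith
      exact (le_abs_self _).trans (abs_le_of_sq_le_sq (by rw [sq_abs, mul_pow]; linarith)
        (abs_nonneg p))
  set ν := √((1 / (mt : ℝ)) * ∑ i, meas (anew i) x) with hνd
  have hν0 : 0 ≤ ν := Real.sqrt_nonneg _
  have hνsq : ν ^ 2 = (1 / (mt : ℝ)) * ∑ i, meas (anew i) x := by
    refine Real.sq_sqrt (mul_nonneg (by positivity) (Finset.sum_nonneg fun i _ => ?_))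
    exact sq_nonneg _
  rw [← hνsq] at hν
  have hxh : mulE V (ν • v) = ν • mulE V v := by
    ext i; simp [mulE, Matrix.mulVec_smul]
  have hVv : ‖mulE V v‖ = 1 := by
    have h2 : ‖mulE V v‖ ^ 2 = 1 := by
      rw [← ofLp_dotProduct_self]
      exact (mulVec_dotProduct_mulVec_of_orthonormal hV _ _).trans hvv
    exact (pow_eq_one_iff_of_nonneg (norm_nonneg _) two_ne_zero).1 h2
  have hpin : inner ℝ x (mulE V v) = p := by rw [← ofLp_dotProduct]; rfl
  refine (phaseDist_sq_le _ _).trans ?_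
  rw [hxh, inner_smul_right, hpin, norm_smul, hVv, mul_one, Real.norm_eq_abs, sq_abs, abs_mul,
    abs_of_nonneg hν0]
  exact sq_sub_add_sq_le hX hν0 hε hε1 hν h7

end Deterministic

/-! ### Fourth-order Gaussian chaos and the new measurements -/

/-- The standard Gaussian measure on `ℝⁿ`. -/
abbrev gaussE (n : ℕ) : Measure (EuclideanSpace ℝ (Fin n)) := stdGaussian (EuclideanSpace ℝ (Fin n))

/-- If w is parallel to e, any unit vector orthogonal to e serves as f, with s = 0; this is why n ≥
2 is needed. -/
theorem exists_orthonormal_decomp {n : ℕ} (hn : 2 ≤ n) {e : EuclideanSpace ℝ (Fin n)}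
    (he : ‖e‖ = 1) (w : EuclideanSpace ℝ (Fin n)) :
    ∃ (f : EuclideanSpace ℝ (Fin n)) (s : ℝ), ‖f‖ = 1 ∧ inner ℝ e f = 0 ∧
      w = (inner ℝ w e : ℝ) • e + s • f := by
  set y := w - (inner ℝ w e : ℝ) • e with hy
  have hey : inner ℝ e y = 0 := by
    rw [hy, inner_sub_right, inner_smul_right, real_inner_self_eq_norm_sq, he, real_inner_comm]
    ring
  by_cases h0 : y = 0
  · have hdim : 1 < Module.finrank ℝ (EuclideanSpace ℝ (Fin n)) := by
      rw [finrank_euclideanSpace_fin]; omega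
    obtain ⟨g, hg0, hg⟩ : ∃ g : EuclideanSpace ℝ (Fin n), g ≠ 0 ∧ inner ℝ e g = 0 := by
      have h1 : LinearMap.ker (innerSL ℝ e : EuclideanSpace ℝ (Fin n) →ₗ[ℝ] ℝ) ≠ ⊥ :=
        LinearMap.ker_ne_bot_of_finrank_lt (by simpa using hdim)
      obtain ⟨g, hg, hg0⟩ := (Submodule.ne_bot_iff _).1 h1
      exact ⟨g, hg0, by simpa using hg⟩
    refine ⟨(‖g‖⁻¹ : ℝ) • g, 0, ?_, ?_, ?_⟩
    · rw [norm_smul, norm_inv, norm_norm, inv_mul_cancel₀ (norm_ne_zero_iff.2 hg0)]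
    · rw [inner_smul_right, hg, mul_zero]
    · rw [zero_smul, add_zero]; exact sub_eq_zero.1 h0
  · refine ⟨(‖y‖⁻¹ : ℝ) • y, ‖y‖, ?_, ?_, ?_⟩
    · rw [norm_smul, norm_inv, norm_norm, inv_mul_cancel₀ (norm_ne_zero_iff.2 h0)]
    · rw [inner_smul_right, hey, mul_zero]
    · rw [smul_smul, mul_inv_cancel₀ (norm_ne_zero_iff.2 h0), one_smul, hy]; abel

theorem exists_unit_smul {n : ℕ} (hn : 0 < n) (x : EuclideanSpace ℝ (Fin n)) :
    ∃ e : EuclideanSpace ℝ (Fin n), ‖e‖ = 1 ∧ x = ‖x‖ • e := by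
  by_cases h0 : x = 0
  · refine ⟨EuclideanSpace.single ⟨0, hn⟩ 1, by simp, by simp [h0]⟩
  · refine ⟨(‖x‖⁻¹ : ℝ) • x, ?_, ?_⟩
    · rw [norm_smul, norm_inv, norm_norm, inv_mul_cancel₀ (norm_ne_zero_iff.2 h0)]
    · rw [smul_smul, mul_inv_cancel₀ (norm_ne_zero_iff.2 h0), one_smul]

theorem sq_add_sq_of_decomp {n : ℕ} {e f w : EuclideanSpace ℝ (Fin n)} {s : ℝ} (he : ‖e‖ = 1)
    (hf : ‖f‖ = 1) (hef : inner ℝ e f = 0) (hw : w = (inner ℝ w e : ℝ) • e + s • f) :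
    (inner ℝ w e : ℝ) ^ 2 + s ^ 2 = ‖w‖ ^ 2 := by
  set p : ℝ := inner ℝ w e
  rw [hw, norm_add_sq_real, norm_smul, norm_smul, he, hf, inner_smul_left, inner_smul_right, hef]
  simp

theorem integral_comp_inner_gaussE {n : ℕ} {e : EuclideanSpace ℝ (Fin n)} (he : ‖e‖ = 1)
    {g : ℝ → ℝ} (hg : Measurable g) :
    ∫ a, g (inner ℝ a e) ∂gaussE n = ∫ u, g u ∂gaussianReal 0 1 := by
  rw [← map_inner_stdGaussian he, integral_map (by fun_prop) (by fun_prop)]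

theorem integrable_inner_pow_gaussE {n : ℕ} {e : EuclideanSpace ℝ (Fin n)} (he : ‖e‖ = 1)
    (k : ℕ) : Integrable (fun a => (inner ℝ a e : ℝ) ^ k) (gaussE n) := by
  have := integrable_pow_gaussianReal k
  rw [← map_inner_stdGaussian he] at this
  exact this.comp_measurable (by fun_prop)

theorem memLp_inner_gaussE {n : ℕ} (x : EuclideanSpace ℝ (Fin n)) {p : ENNReal} (hp : p ≠ ⊤) :
    MemLp (fun a => (inner ℝ a x : ℝ)) p (gaussE n) := by
  have := (IsGaussian.hasGaussianLaw_id (μ := gaussE n)).map_fun (innerSL ℝ x)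
  have h := this.memLp hp
  simpa [real_inner_comm] using h

theorem MemLp.mul_of_forall {Ω : Type*} [MeasurableSpace Ω] {P : Measure Ω} {f g : Ω → ℝ}
    (hf : ∀ p : ENNReal, p ≠ ⊤ → MemLp f p P) (hg : ∀ p : ENNReal, p ≠ ⊤ → MemLp g p P)
    (p : ENNReal) (hp : p ≠ ⊤) : MemLp (fun x => f x * g x) p P := by
  have : ENNReal.HolderTriple (2 * p) (2 * p) p := by
    refine ⟨?_⟩
    rw [ENNReal.mul_inv (by simp) (by simp), ← add_mul, ENNReal.inv_two_add_inv_two, one_mul]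
  have h2 : 2 * p ≠ ⊤ := ENNReal.mul_ne_top (by simp) hp
  exact (hg (2 * p) h2).mul' (hf (2 * p) h2)

/-- The centred fourth order chaos. -/
def quartDev {n : ℕ} (x z a : EuclideanSpace ℝ (Fin n)) : ℝ :=
  inner ℝ a x ^ 2 * inner ℝ a z ^ 2 - (‖x‖ ^ 2 * ‖z‖ ^ 2 + 2 * inner ℝ x z ^ 2)

theorem measurable_quartDev {n : ℕ} (x z : EuclideanSpace ℝ (Fin n)) : Measurable (quartDev x z) :=
    by
  unfold quartDev; fun_prop

theorem memLp_quartDev {n : ℕ} (x z : EuclideanSpace ℝ (Fin n)) (p : ENNReal) (hp : p ≠ ⊤) :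
    MemLp (quartDev x z) p (gaussE n) := by
  have h2 : ∀ y : EuclideanSpace ℝ (Fin n), ∀ p : ENNReal, p ≠ ⊤ →
      MemLp (fun a => (inner ℝ a y : ℝ) * inner ℝ a y) p (gaussE n) := fun y =>
    MemLp.mul_of_forall (fun p hp => memLp_inner_gaussE y hp) fun p hp => memLp_inner_gaussE y hp
  have := (MemLp.mul_of_forall (h2 x) (h2 z) p hp).sub
    (memLp_const (‖x‖ ^ 2 * ‖z‖ ^ 2 + 2 * (inner ℝ x z : ℝ) ^ 2))
  convert this using 1
  ext a
  simp only [quartDev, Pi.sub_apply]; ring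

/-- With z = px + sf and independent components along x and f, the cross term has mean zero and the
mean of the product of squares is 3p² + s² = |z|² + 2p². -/
theorem integral_quartDev {n : ℕ} (hn : 2 ≤ n) {x : EuclideanSpace ℝ (Fin n)} (hx : ‖x‖ = 1)
    (z : EuclideanSpace ℝ (Fin n)) : ∫ a, quartDev x z a ∂gaussE n = 0 := by
  obtain ⟨f, s, hf, hef, hz⟩ := exists_orthonormal_decomp hn hx z
  have hns := sq_add_sq_of_decomp hx hf hef hz
  set p : ℝ := inner ℝ z x with hp
  let G : ℝ × ℝ → ℝ := fun w => p ^ 2 * (w.1 ^ 4 * 1) + 2 * p * s * (w.1 ^ 3 * w.2)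
    + s ^ 2 * (w.1 ^ 2 * w.2 ^ 2) - (3 * p ^ 2 + s ^ 2)
  have e1 : ∀ a, quartDev x z a = G (inner ℝ a x, inner ℝ a f) := by
    intro a
    have : (inner ℝ a z : ℝ) = p * inner ℝ a x + s * inner ℝ a f := by
      conv_lhs => rw [hz]
      rw [inner_add_right, inner_smul_right, inner_smul_right]
    simp only [quartDev, G]
    rw [this, hx, ← hns, real_inner_comm z x, ← hp]
    ring
  have e2 := integral_map (μ := gaussE n) (φ := fun a => ((inner ℝ a x : ℝ), (inner ℝ a f : ℝ)))
    (f := G) (by fun_prop) (by fun_prop)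
  rw [integral_congr_ae (ae_of_all _ e1), ← e2, map_inner_pair_stdGaussian hx hf hef]
  have i1 : Integrable (fun w : ℝ × ℝ => w.1 ^ 4 * 1) ((gaussianReal 0 1).prod
      (gaussianReal 0 1)) :=
    (integrable_pow_gaussianReal 4).mul_prod (integrable_const (1 : ℝ))
  have i2 : Integrable (fun w : ℝ × ℝ => w.1 ^ 3 * w.2)
      ((gaussianReal 0 1).prod (gaussianReal 0 1)) :=
    (integrable_pow_gaussianReal 3).mul_prod (g := fun x : ℝ => x)
      (by simpa using integrable_pow_gaussianReal 1)
  have i3 : Integrable (fun w : ℝ × ℝ => w.1 ^ 2 * w.2 ^ 2)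
      ((gaussianReal 0 1).prod (gaussianReal 0 1)) :=
    (integrable_pow_gaussianReal 2).mul_prod (integrable_pow_gaussianReal 2)
  have hG : G = (((fun w => p ^ 2 * (w.1 ^ 4 * 1)) + fun w => 2 * p * s * (w.1 ^ 3 * w.2))
    + fun w => s ^ 2 * (w.1 ^ 2 * w.2 ^ 2)) - fun _ => 3 * p ^ 2 + s ^ 2 := rfl
  rw [hG, integral_sub' (((i1.const_mul _).add (i2.const_mul _)).add (i3.const_mul _))
    (integrable_const _), integral_add' ((i1.const_mul _).add (i2.const_mul _)) (i3.const_mul _),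
    integral_add' (i1.const_mul _) (i2.const_mul _), integral_const_mul, integral_const_mul,
    integral_const_mul]
  have h0 : ∫ x, x ∂gaussianReal 0 1 = 0 := integral_id_gaussianReal
  have j1 := integral_prod_mul (μ := gaussianReal 0 1) (ν := gaussianReal 0 1)
    (fun x : ℝ => x ^ 4) (fun _ : ℝ => (1 : ℝ))
  have j2 := integral_prod_mul (μ := gaussianReal 0 1) (ν := gaussianReal 0 1)
    (fun x : ℝ => x ^ 3) (fun x : ℝ => x)
  have j3 := integral_prod_mul (μ := gaussianReal 0 1) (ν := gaussianReal 0 1)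
    (fun x : ℝ => x ^ 2) (fun x : ℝ => x ^ 2)
  rw [j1, j2, j3, h0, integral_pow_four_gaussianReal, integral_sq_gaussianReal]
  simp
  ring

theorem add_pow_even_le (a b : ℝ) (j : ℕ) :
    (a - b) ^ (2 * j) ≤ 4 ^ j * (a ^ (2 * j) + b ^ (2 * j)) := by
  simp only [pow_mul]
  calc ((a - b) ^ 2) ^ j ≤ (4 * max (a ^ 2) (b ^ 2)) ^ j := by
        gcongr
        nlinarith [sq_nonneg (a + b), le_max_left (a ^ 2) (b ^ 2), le_max_right (a ^ 2) (b ^ 2)]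
    _ = 4 ^ j * (max (a ^ 2) (b ^ 2)) ^ j := mul_pow _ _ _
    _ ≤ _ := by
      gcongr
      rcases max_choice (a ^ 2) (b ^ 2) with h | h <;> rw [h]
      · linarith [pow_nonneg (sq_nonneg b) j]
      · linarith [pow_nonneg (sq_nonneg a) j]

theorem exists_integral_quartDev_pow_le (s : ℕ) :
    ∃ M : ℝ, 1 ≤ M ∧ ∀ (n : ℕ), 2 ≤ n → ∀ x z : EuclideanSpace ℝ (Fin n), ‖x‖ = 1 → ‖z‖ ≤ 2 →
      ∀ j ≤ s, ∫ a, quartDev x z a ^ (2 * j) ∂gaussE n ≤ M := by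
  set m : ℕ → ℝ := fun k => ∫ u, u ^ k ∂gaussianReal 0 1 with hm
  -- The product of powers is split by AB ≤ A² + B², giving moments of order 8j; 2^(8j) comes from
  -- |z| ≤ 2, and 12 = 4 + 2 · 4 bounds the subtracted mean. Nothing depends on n, as the
  -- one-dimensional marginals do not.
  set B : ℕ → ℝ := fun j => 4 ^ j * ((m (8 * j) + 2 ^ (8 * j) * m (8 * j)) + 12 ^ (2 * j)) with hB
  have hm0 : ∀ j, 0 ≤ m (8 * j) := fun j => integral_nonneg fun u => by
    rw [show 8 * j = 2 * (4 * j) by ring, pow_mul]; positivity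
  have hB0 : ∀ j, 0 ≤ B j := fun j => by have := hm0 j; positivity
  refine ⟨1 + ∑ j ∈ Finset.range (s + 1), B j,
    le_add_of_nonneg_right (Finset.sum_nonneg fun j _ => hB0 j), ?_⟩
  intro n hn x z hx hz j hj
  have hle : B j ≤ 1 + ∑ j ∈ Finset.range (s + 1), B j := by
    have := Finset.single_le_sum (f := B) (fun i _ => hB0 i)
      (Finset.mem_range.2 (Nat.lt_succ_of_le hj))
    linarith
  refine le_trans ?_ hle
  obtain ⟨e, he, hze⟩ := exists_unit_smul (by omega) z
  have hpt : ∀ a, quartDev x z a ^ (2 * j) ≤ 4 ^ j * (((inner ℝ a x : ℝ) ^ (8 * j)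
      + 2 ^ (8 * j) * (inner ℝ a e : ℝ) ^ (8 * j)) + 12 ^ (2 * j)) := by
    intro a
    have hin : (inner ℝ a z : ℝ) = ‖z‖ * inner ℝ a e := by
      conv_lhs => rw [hze]
      rw [inner_smul_right]
    refine (add_pow_even_le _ _ j).trans ?_
    gcongr
    · have h1 : ((inner ℝ a x : ℝ) ^ 2 * (inner ℝ a z : ℝ) ^ 2) ^ (2 * j)
          = (inner ℝ a x : ℝ) ^ (4 * j) * (inner ℝ a z : ℝ) ^ (4 * j) := by
        rw [mul_pow, ← pow_mul, ← pow_mul]; ring_nf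
      have h2 : (inner ℝ a x : ℝ) ^ (4 * j) * (inner ℝ a z : ℝ) ^ (4 * j)
          ≤ (inner ℝ a x : ℝ) ^ (8 * j) + (inner ℝ a z : ℝ) ^ (8 * j) := by
        rw [show 8 * j = (4 * j) * 2 by ring, pow_mul _ (4 * j) 2, pow_mul _ (4 * j) 2]
        generalize (inner ℝ a x : ℝ) ^ (4 * j) = A
        generalize (inner ℝ a z : ℝ) ^ (4 * j) = A'
        nlinarith [sq_nonneg (A - A'), sq_nonneg A, sq_nonneg A']
      have h3 : (inner ℝ a z : ℝ) ^ (8 * j) ≤ 2 ^ (8 * j) * (inner ℝ a e : ℝ) ^ (8 * j) := by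
        rw [hin, mul_pow]
        have : (0 : ℝ) ≤ (inner ℝ a e : ℝ) ^ (8 * j) := by
          rw [show 8 * j = 2 * (4 * j) by ring, pow_mul]; positivity
        gcongr
      rw [h1]; linarith
    · rw [hx]
      have h1 : |(inner ℝ x z : ℝ)| ≤ 2 := (abs_real_inner_le_norm x z).trans (by rw [hx]; linarith)
      have h2 : (inner ℝ x z : ℝ) ^ 2 ≤ 2 ^ 2 := sq_le_sq' (abs_le.1 h1).1 (abs_le.1 h1).2
      have h3 : ‖z‖ ^ 2 ≤ 2 ^ 2 := pow_le_pow_left₀ (norm_nonneg _) hz 2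
      linarith
  have hi : Integrable (fun a => quartDev x z a ^ (2 * j)) (gaussE n) := by
    rcases Nat.eq_zero_or_pos j with rfl | hj0
    · simp
    have h := (memLp_quartDev x z (2 * j : ℕ) (ENNReal.natCast_ne_top _)).integrable_norm_pow
        (by omega)
    exact (integrable_norm_iff ((measurable_quartDev x z).pow_const _).aestronglyMeasurable).1
      (by simpa using h)
  have i1 := integrable_inner_pow_gaussE hx (8 * j)
  have i2 := (integrable_inner_pow_gaussE he (8 * j)).const_mul (2 ^ (8 * j))
  refine (integral_mono hi (((i1.add i2).add (integrable_const _)).const_mul (4 ^ j)) hpt).trans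
    (le_of_eq ?_)
  rw [integral_const_mul, integral_add' (i1.add i2) (integrable_const _), integral_add' i1 i2,
    integral_const_mul, integral_comp_inner_gaussE hx (g := fun u => u ^ (8 * j)) (by fun_prop),
    integral_comp_inner_gaussE he (g := fun u => u ^ (8 * j)) (by fun_prop)]
  simp [hB, hm]

/-- Markov's inequality for the moment of order 2s. Since u⁴ has no exponential moments for Gaussian
u, an arbitrary fixed polynomial rate replaces Chernoff's bound. -/
theorem exists_measure_pi_quartDev_le (s : ℕ) :
    ∃ K : ℝ, 0 < K ∧ ∀ (n mt : ℕ), 2 ≤ n → 0 < mt → ∀ x z : EuclideanSpace ℝ (Fin n), ‖x‖ = 1 →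
      ‖z‖ ≤ 2 → ∀ τ : ℝ, 0 < τ →
      Measure.pi (fun _ : Fin mt => gaussE n) {η | τ < |(1 / (mt : ℝ)) * ∑ i, quartDev x z (η i)|}
        ≤ ENNReal.ofReal (K / (mt * τ ^ 2) ^ s) := by
  obtain ⟨M, hM1, hM⟩ := exists_integral_quartDev_pow_le s
  obtain ⟨K, hK, h⟩ := exists_integral_sum_pow_le s M hM1
  refine ⟨K, hK, ?_⟩
  intro n mt hn hmt x z hx hz τ hτ
  have hmt' : (0 : ℝ) < mt := by exact_mod_cast hmt
  have hind : iIndepFun (fun (i : Fin mt) (η : Fin mt → EuclideanSpace ℝ (Fin n)) =>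
      quartDev x z (η i)) (Measure.pi fun _ : Fin mt => gaussE n) :=
    iIndepFun_pi (X := fun _ a => quartDev x z a) fun i => (measurable_quartDev x z).aemeasurable
  have hpow : ∀ (i : Fin mt) (k : ℕ), ∫ η, quartDev x z (η i) ^ k
      ∂(Measure.pi fun _ : Fin mt => gaussE n) = ∫ a, quartDev x z a ^ k ∂gaussE n := fun i k =>
    integral_comp_eval (μ := fun _ : Fin mt => gaussE n) (f := fun a => quartDev x z a ^ k)
      ((measurable_quartDev x z).pow_const k).aestronglyMeasurable
  have hLp : ∀ (i : Fin mt) (p : ℕ), MemLp (fun η : Fin mt → EuclideanSpace ℝ (Fin n) =>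
      quartDev x z (η i)) p (Measure.pi fun _ : Fin mt => gaussE n) := fun i p =>
    (memLp_quartDev x z p (by simp)).comp_measurePreserving
      (measurePreserving_eval (fun _ : Fin mt => gaussE n) i)
  have key := h (Measure.pi fun _ : Fin mt => gaussE n)
    (fun (i : Fin mt) (η : Fin mt → EuclideanSpace ℝ (Fin n)) => quartDev x z (η i)) hind
    (fun i => (measurable_quartDev x z).comp (measurable_pi_apply i)) hLp
    (fun i => by
      have := hpow i 1
      simp only [pow_one] at this
      rw [this, integral_quartDev hn hx])
    (fun i j hj => by rw [hpow]; exact hM n hn x z hx hz j hj) Finset.univ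
  simp only [Finset.card_univ, Fintype.card_fin] at key
  set S : (Fin mt → EuclideanSpace ℝ (Fin n)) → ℝ := fun η => ∑ i, quartDev x z (η i) with hS
  have hSm : Measurable S := Finset.measurable_sum _ fun i _ =>
    (measurable_quartDev x z).comp (measurable_pi_apply i)
  have hint : Integrable (fun η => S η ^ (2 * s)) (Measure.pi fun _ : Fin mt => gaussE n) := by
    rcases Nat.eq_zero_or_pos s with rfl | hs
    · simp
    have hL : MemLp S (2 * s : ℕ) (Measure.pi fun _ : Fin mt => gaussE n) :=
      memLp_finsetSum _ fun i _ => hLp i _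
    exact (integrable_norm_iff (hSm.pow_const _).aestronglyMeasurable).1
      (by simpa using hL.integrable_norm_pow (by omega))
  have hmark := mul_meas_ge_le_integral_of_nonneg (μ := Measure.pi fun _ : Fin mt => gaussE n)
    (ae_of_all _ fun η => by rw [Pi.zero_apply, pow_mul]; positivity) hint ((mt * τ) ^ (2 * s))
  have hpos : (0 : ℝ) < (mt * τ) ^ (2 * s) := by positivity
  have hsub : {η | τ < |(1 / (mt : ℝ)) * S η|} ⊆ {η | (mt * τ) ^ (2 * s) ≤ S η ^ (2 * s)} := by
    intro η hη
    simp only [Set.mem_ofPred_eq] at hη ⊢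
    rw [abs_mul, abs_of_pos (by positivity : 0 < 1 / (mt : ℝ)), one_div, inv_mul_eq_div,
      lt_div_iff₀ hmt'] at hη
    rw [← Even.pow_abs ⟨s, by ring⟩ (S η)]
    exact pow_le_pow_left₀ (by positivity) (by linarith) _
  refine (measure_mono hsub).trans ?_
  rw [← ofReal_measureReal]
  refine ENNReal.ofReal_le_ofReal ?_
  have h1 : (Measure.pi fun _ : Fin mt => gaussE n).real {η | (mt * τ) ^ (2 * s) ≤ S η ^ (2 * s)}
      ≤ K * (mt : ℝ) ^ s / (mt * τ) ^ (2 * s) := by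
    rw [le_div_iff₀ hpos, mul_comm]
    exact hmark.trans key
  refine h1.trans (le_of_eq ?_)
  have : ((mt : ℝ) * τ) ^ (2 * s) = (mt : ℝ) ^ s * (mt * τ ^ 2) ^ s := by
    rw [pow_mul, ← mul_pow]; congr 1; ring
  rw [this]
  field_simp

/-- The new measurements are accurate in the range of the projector `Q`. -/
def NewGood {n mt : ℕ} (Q : Matrix (Fin n) (Fin n) ℝ) (x : EuclideanSpace ℝ (Fin n)) (ε : ℝ)
    (η : Fin mt → EuclideanSpace ℝ (Fin n)) : Prop :=
  Matrix.trace (Q * newDev η x * Q * newDev η x) ≤ ε ^ 2 * ‖x‖ ^ 4 ∧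
    |(1 / (mt : ℝ)) * ∑ i, meas (η i) x - ‖x‖ ^ 2| ≤ ε * ‖x‖ ^ 2

section

open Matrix

variable {n r mt : ℕ}

theorem quadForm_newDev {x e : EuclideanSpace ℝ (Fin n)} (he : ‖e‖ = 1) (hxe : x = ‖x‖ • e)
    (hmt : 0 < mt) (η : Fin mt → EuclideanSpace ℝ (Fin n)) (z : EuclideanSpace ℝ (Fin n)) :
    z.ofLp ⬝ᵥ newDev η x *ᵥ z.ofLp = ‖x‖ ^ 2 * ((1 / (mt : ℝ)) * ∑ i, quartDev e z (η i)) := by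
  have hmt' : (mt : ℝ) ≠ 0 := by exact_mod_cast hmt.ne'
  have hin : ∀ y : EuclideanSpace ℝ (Fin n), (inner ℝ y x : ℝ) = ‖x‖ * inner ℝ y e := by
    intro y
    conv_lhs => rw [hxe]
    rw [inner_smul_right]
  have hsum : z.ofLp ⬝ᵥ (∑ i, meas (η i) x • outer (η i)) *ᵥ z.ofLp
      = ∑ i, meas (η i) x * inner ℝ (η i) z ^ 2 := by
    rw [Matrix.sum_mulVec, dotProduct_sum]
    refine Finset.sum_congr rfl fun i _ => ?_
    rw [Matrix.smul_mulVec, dotProduct_smul, dotProduct_outer_mulVec, smul_eq_mul]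
  rw [newDev, Matrix.sub_mulVec, Matrix.sub_mulVec, dotProduct_sub, dotProduct_sub,
    Matrix.smul_mulVec, Matrix.smul_mulVec, Matrix.smul_mulVec, dotProduct_smul, dotProduct_smul,
    dotProduct_smul, hsum, Matrix.one_mulVec, ofLp_dotProduct_self, dotProduct_outer_mulVec,
    real_inner_comm, hin]
  simp only [quartDev, meas, hin, smul_eq_mul, he, Finset.sum_sub_distrib, Finset.sum_const,
    Finset.card_univ, Fintype.card_fin, nsmul_eq_mul]
  rw [real_inner_comm e z]
  have : ∑ i, (‖x‖ * inner ℝ (η i) e) ^ 2 * (inner ℝ (η i) z) ^ 2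
      = ‖x‖ ^ 2 * ∑ i, (inner ℝ (η i) e) ^ 2 * (inner ℝ (η i) z : ℝ) ^ 2 := by
    rw [Finset.mul_sum]; exact Finset.sum_congr rfl fun i _ => by ring
  rw [this]
  field_simp
  ring

/-- The columns of a matrix, as vectors of the Euclidean space. -/
def colE (V : Matrix (Fin n) (Fin r) ℝ) (j : Fin r) : EuclideanSpace ℝ (Fin n) :=
  WithLp.toLp 2 fun i => V i j

theorem norm_colE {V : Matrix (Fin n) (Fin r) ℝ} (hV : Vᵀ * V = 1) (j : Fin r) :
    ‖colE V j‖ = 1 := by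
  have h : ‖colE V j‖ ^ 2 = 1 := by
    rw [← ofLp_dotProduct_self]
    have := congrFun (congrFun hV j) j
    simpa [Matrix.mul_apply, dotProduct, colE] using this
  exact (pow_eq_one_iff_of_nonneg (norm_nonneg _) two_ne_zero).1 h

/-- Polarization: each entry of the compressed deviation is a quarter of the difference of the
quadratic form at c_j + c_l and at c_j - c_l, with c_j the columns of V. Accuracy ε/r for all r²
entries gives squared Frobenius norm at most ε²|x|⁴. -/
theorem newGood_of_quartDev {V : Matrix (Fin n) (Fin r) ℝ} (hr : 0 < r) (hmt : 0 < mt)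
    {x e : EuclideanSpace ℝ (Fin n)} (he : ‖e‖ = 1) (hxe : x = ‖x‖ • e) {ε : ℝ} (hε : 0 < ε)
    {η : Fin mt → EuclideanSpace ℝ (Fin n)}
    (h1 : ∀ j l, |(1 / (mt : ℝ)) * ∑ i, quartDev e (colE V j + colE V l) (η i)| ≤ ε / r)
    (h2 : ∀ j l, |(1 / (mt : ℝ)) * ∑ i, quartDev e (colE V j - colE V l) (η i)| ≤ ε / r)
    (h3 : |(1 / (mt : ℝ)) * ∑ i, inner ℝ (η i) e ^ 2 - 1| ≤ ε) :
    NewGood (V * Vᵀ) x ε η := by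
  have hr' : (0 : ℝ) < r := by exact_mod_cast hr
  constructor
  · rw [trace_sq_eq_sum_sq (isSymm_newDev η x)]
    have hL : ∀ j l, (Vᵀ * newDev η x * V) j l ^ 2 ≤ (‖x‖ ^ 2 * (ε / r)) ^ 2 := by
      intro j l
      have e1 : (Vᵀ * newDev η x * V) j l = (colE V j).ofLp ⬝ᵥ newDev η x *ᵥ (colE V l).ofLp := by
        rw [Matrix.mul_assoc, Matrix.mul_apply]
        simp only [dotProduct, Matrix.mul_apply, Matrix.mulVec, Matrix.transpose_apply, colE]
      have q1 := quadForm_newDev he hxe hmt η (colE V j + colE V l)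
      have q2 := quadForm_newDev he hxe hmt η (colE V j - colE V l)
      have hs := dotProduct_mulVec_comm_of_isSymm (isSymm_newDev η x) (colE V l).ofLp
          (colE V j).ofLp
      simp only [WithLp.ofLp_add, WithLp.ofLp_sub, Matrix.mulVec_add, Matrix.mulVec_sub,
        dotProduct_add, dotProduct_sub, add_dotProduct, sub_dotProduct, hs] at q1 q2
      have b1 := abs_le.1 (h1 j l)
      have b2 := abs_le.1 (h2 j l)
      set A := (1 / (mt : ℝ)) * ∑ i, quartDev e (colE V j + colE V l) (η i)
      set B := (1 / (mt : ℝ)) * ∑ i, quartDev e (colE V j - colE V l) (η i)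
      have e2 : (Vᵀ * newDev η x * V) j l = ‖x‖ ^ 2 * ((A - B) / 4) := by
        rw [e1]; linarith
      have h0 : 0 < ε / r := by positivity
      rw [e2, mul_pow, mul_pow]
      refine mul_le_mul_of_nonneg_left (sq_le_sq' ?_ ?_) (by positivity) <;> linarith [b1.1, b1.2,
          b2.1, b2.2]
    calc _ ≤ ∑ _j : Fin r, ∑ _l : Fin r, (‖x‖ ^ 2 * (ε / r)) ^ 2 :=
          Finset.sum_le_sum fun j _ => Finset.sum_le_sum fun l _ => hL j l
      _ = ε ^ 2 * ‖x‖ ^ 4 := by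
        simp only [Finset.sum_const, Finset.card_univ, Fintype.card_fin, nsmul_eq_mul]
        field_simp
  · have hin : ∀ y : EuclideanSpace ℝ (Fin n), (inner ℝ y x : ℝ) = ‖x‖ * inner ℝ y e := by
      intro y
      conv_lhs => rw [hxe]
      rw [inner_smul_right]
    have : (1 / (mt : ℝ)) * ∑ i, meas (η i) x - ‖x‖ ^ 2
        = ‖x‖ ^ 2 * ((1 / (mt : ℝ)) * ∑ i, inner ℝ (η i) e ^ 2 - 1) := by
      simp only [meas, hin, mul_pow, ← Finset.mul_sum]; ring
    rw [this, abs_mul, abs_of_nonneg (by positivity), mul_comm]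
    gcongr

theorem newGood_zero (Q : Matrix (Fin n) (Fin n) ℝ) (ε : ℝ)
    (η : Fin mt → EuclideanSpace ℝ (Fin n)) : NewGood Q 0 ε η := by
  have : newDev η (0 : EuclideanSpace ℝ (Fin n)) = 0 := by
    simp [newDev, meas, outer]
  simp [NewGood, this, meas]

theorem measurePreserving_inner_pi {ι : Type*} [Fintype ι] {e : ι → EuclideanSpace ℝ (Fin n)}
    (he : ∀ i, ‖e i‖ = 1) :
    MeasurePreserving (fun (η : ι → EuclideanSpace ℝ (Fin n)) i => (inner ℝ (η i) (e i) : ℝ))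
      (Measure.pi fun _ : ι => gaussE n) (Measure.pi fun _ : ι => gaussianReal 0 1) :=
  measurePreserving_pi _ _ fun i => ⟨by fun_prop, map_inner_stdGaussian (he i)⟩

/-- A union bound over the r² pairs of columns and the two signs, plus a chi-square tail for the
norm estimate. The exponent 50 is dictated by m̃ε²/r² being only of order n^(1/10) in the worst
case. -/
theorem exists_measure_not_newGood_le :
    ∃ K : ℝ, 0 < K ∧ ∀ (n r mt : ℕ), 2 ≤ n → 0 < r → 0 < mt → ∀ V : Matrix (Fin n) (Fin r) ℝ,
      Vᵀ * V = 1 → ∀ (x : EuclideanSpace ℝ (Fin n)) (ε : ℝ), 0 < ε → ε < 1 →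
      Measure.pi (fun _ : Fin mt => gaussE n) {η | ¬ NewGood (V * Vᵀ) x ε η}
        ≤ ENNReal.ofReal (2 * Real.exp (-(mt * ε ^ 2 / 16))
          + 2 * (r : ℝ) ^ 2 * (K / (mt * (ε / r) ^ 2) ^ 50)) := by
  obtain ⟨K, hK, h⟩ := exists_measure_pi_quartDev_le 50
  refine ⟨K, hK, ?_⟩
  intro n r mt hn hr hmt V hV x ε hε hε1
  have hmt' : (0 : ℝ) < mt := by exact_mod_cast hmt
  have hr' : (0 : ℝ) < r := by exact_mod_cast hr
  by_cases hx0 : x = 0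
  · have : {η : Fin mt → EuclideanSpace ℝ (Fin n) | ¬ NewGood (V * Vᵀ) x ε η} = ∅ := by
      ext η
      simp [hx0, newGood_zero]
    rw [this]; simp
  obtain ⟨e, he, hxe⟩ := exists_unit_smul (by omega) x
  set μ := Measure.pi (fun _ : Fin mt => gaussE n) with hμ
  set b := K / (mt * (ε / r) ^ 2) ^ 50 with hb
  have hb0 : 0 ≤ b := by positivity
  have hplus : ∀ j l, μ {η | ε / r < |(1 / (mt : ℝ)) * ∑ i, quartDev e (colE V j + colE V l) (η i)|}
      ≤ ENNReal.ofReal b := fun j l => h n mt hn hmt e _ he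
    ((norm_add_le _ _).trans (by rw [norm_colE hV, norm_colE hV]; norm_num)) _ (by positivity)
  have hminus : ∀ j l,
      μ {η | ε / r < |(1 / (mt : ℝ)) * ∑ i, quartDev e (colE V j - colE V l) (η i)|}
      ≤ ENNReal.ofReal b := fun j l => h n mt hn hmt e _ he
    ((norm_sub_le _ _).trans (by rw [norm_colE hV, norm_colE hV]; norm_num)) _ (by positivity)
  have hsq : ∀ σ : ℝ, |σ| = 1 → μ {η | mt * ε * 1 ≤ ∑ i, σ * (inner ℝ (η i) e ^ 2 - 1)}
      ≤ ENNReal.ofReal (Real.exp (-(mt * ε ^ 2 / 16))) := by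
    intro σ hσ
    have h1 := measure_pi_gaussian_weighted_sq_ge_le (ι := Fin mt) (w := fun _ => σ) (W := 1)
      one_pos (fun _ => hσ.le) hε.le hε1.le
    rw [Fintype.card_fin] at h1
    have h2 := (measurePreserving_inner_pi (ι := Fin mt) (e := fun _ => e) fun _ => he)
    rw [← h2.map_eq] at h1
    exact (Measure.le_map_apply h2.aemeasurable _).trans h1
  set Bp := ⋃ j : Fin r, ⋃ l : Fin r,
    {η : Fin mt → EuclideanSpace ℝ (Fin n) |
      ε / r < |(1 / (mt : ℝ)) * ∑ i, quartDev e (colE V j + colE V l) (η i)|} with hBp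
  set Bm := ⋃ j : Fin r, ⋃ l : Fin r,
    {η : Fin mt → EuclideanSpace ℝ (Fin n) |
      ε / r < |(1 / (mt : ℝ)) * ∑ i, quartDev e (colE V j - colE V l) (η i)|} with hBm
  set S1 := {η : Fin mt → EuclideanSpace ℝ (Fin n) |
    mt * ε * 1 ≤ ∑ i, (1 : ℝ) * (inner ℝ (η i) e ^ 2 - 1)} with hS1
  set S2 := {η : Fin mt → EuclideanSpace ℝ (Fin n) |
    mt * ε * 1 ≤ ∑ i, (-1 : ℝ) * (inner ℝ (η i) e ^ 2 - 1)} with hS2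
  have hsub : {η : Fin mt → EuclideanSpace ℝ (Fin n) | ¬ NewGood (V * Vᵀ) x ε η}
      ⊆ (S1 ∪ S2) ∪ (Bp ∪ Bm) := by
    intro η hη
    by_contra hcon
    simp only [hBp, hBm, hS1, hS2, Set.mem_union, Set.mem_iUnion, Set.mem_ofPred_eq, not_or,
      not_exists, not_lt, not_le] at hcon
    obtain ⟨⟨c1, c2⟩, c3, c4⟩ := hcon
    refine hη (newGood_of_quartDev hr hmt he hxe hε c3 c4 ?_)
    simp only [Finset.sum_sub_distrib, ← Finset.mul_sum, Finset.sum_const, Finset.card_univ,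
      Fintype.card_fin, nsmul_eq_mul] at c1 c2
    have e1 : (1 / (mt : ℝ)) * ∑ i, inner ℝ (η i) e ^ 2 - 1
        = (∑ i, inner ℝ (η i) e ^ 2 - mt) / mt := by field_simp
    rw [e1, abs_div, abs_of_pos hmt', div_le_iff₀ hmt', abs_le]
    constructor <;> linarith
  have hunion : ∀ f : Fin r → Fin r → Set (Fin mt → EuclideanSpace ℝ (Fin n)),
      (∀ j l, μ (f j l) ≤ ENNReal.ofReal b) →
      μ (⋃ j, ⋃ l, f j l) ≤ ENNReal.ofReal ((r : ℝ) ^ 2 * b) := by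
    intro f hf
    calc μ (⋃ j, ⋃ l, f j l) ≤ ∑ j : Fin r, ∑ l : Fin r, ENNReal.ofReal b :=
          (measure_iUnion_fintype_le _ _).trans (Finset.sum_le_sum fun j _ =>
            (measure_iUnion_fintype_le _ _).trans (Finset.sum_le_sum fun l _ => hf j l))
      _ = ENNReal.ofReal ((r : ℝ) ^ 2 * b) := by
        simp only [Finset.sum_const, Finset.card_univ, Fintype.card_fin, nsmul_eq_mul]
        rw [ENNReal.ofReal_mul (by positivity), ENNReal.ofReal_pow hr'.le, ENNReal.ofReal_natCast]
        ring
  calc μ _ ≤ μ ((S1 ∪ S2) ∪ (Bp ∪ Bm)) := measure_mono hsub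
    _ ≤ (μ S1 + μ S2) + (μ Bp + μ Bm) :=
      (measure_union_le _ _).trans (add_le_add (measure_union_le _ _) (measure_union_le _ _))
    _ ≤ (ENNReal.ofReal (Real.exp (-(mt * ε ^ 2 / 16))) + ENNReal.ofReal (Real.exp
        (-(mt * ε ^ 2 / 16))))
        + (ENNReal.ofReal ((r : ℝ) ^ 2 * b) + ENNReal.ofReal ((r : ℝ) ^ 2 * b)) :=
      add_le_add (add_le_add (hsq 1 (by simp)) (hsq (-1) (by simp)))
        (add_le_add (hunion _ hplus) (hunion _ hminus))
    _ = _ := by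
      rw [← ENNReal.ofReal_add (by positivity) (by positivity),
        ← ENNReal.ofReal_add (by positivity) (by positivity),
        ← ENNReal.ofReal_add (by positivity) (by positivity)]
      congr 1; ring

end

/-! ### Bulk, spike and fluctuation of the truncated matrix -/

section

variable {n m q : ℕ}

/-- The truncated measurements. -/
def truncMeas (a : Fin m → Fin q → EuclideanSpace ℝ (Fin n)) (x : Fin q → EuclideanSpace ℝ (Fin n))
    (i : Fin m) (k : Fin q) : ℝ :=
  if meas (a i k) (x k) ≤ 9 * ((∑ i', meas (a i' k) (x k)) / (m : ℝ)) then meas (a i k) (x k) else 0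

/-- The bulk level of `Y_U`. -/
def bulk (a : Fin m → Fin q → EuclideanSpace ℝ (Fin n)) (x : Fin q → EuclideanSpace ℝ
    (Fin n)) : ℝ :=
  1 / (m * q : ℝ) * ∑ i, ∑ k, truncMeas a x i k

/-- The weight of `x_k x_k'` in `Y_U`. -/
def spike (a : Fin m → Fin q → EuclideanSpace ℝ (Fin n)) (x : Fin q → EuclideanSpace ℝ (Fin n))
    (k : Fin q) : ℝ :=
  (1 / (m : ℝ) * ∑ i, truncMeas a x i k * (meas (a i k) (x k) - ‖x k‖ ^ 2)) / ‖x k‖ ^ 4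

/-- The quadratic form of the difference of `Y_U` and its spiked part. -/
def fluct (a : Fin m → Fin q → EuclideanSpace ℝ (Fin n)) (x : Fin q → EuclideanSpace ℝ (Fin n))
    (w : EuclideanSpace ℝ (Fin n)) : ℝ :=
  1 / (m * q : ℝ) * ∑ i, ∑ k, truncMeas a x i k * inner ℝ (a i k) w ^ 2 - bulk a x * ‖w‖ ^ 2
    - 1 / (q : ℝ) * ∑ k, spike a x k * inner ℝ (x k) w ^ 2

/-- The measurements used for the subspace are accurate. -/
def SubspaceGood (a : Fin m → Fin q → EuclideanSpace ℝ (Fin n))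
    (x : Fin q → EuclideanSpace ℝ (Fin n)) (N : Finset (EuclideanSpace ℝ (Fin n))) (τ : ℝ) : Prop :=
  (∀ k, ‖x k‖ ^ 4 * (1 / 16) ≤ ‖x k‖ ^ 4 * spike a x k) ∧ ∀ w ∈ N, |fluct a x w| ≤ τ

theorem truncMeas_eq {a : Fin m → Fin q → EuclideanSpace ℝ (Fin n)}
    {x : Fin q → EuclideanSpace ℝ (Fin n)} {k : Fin q} {e : EuclideanSpace ℝ (Fin n)}
    (hxe : x k = ‖x k‖ • e) (i : Fin m) :
    truncMeas a x i k = ‖x k‖ ^ 2 * truncSq (fun j => inner ℝ (a j k) e) i := by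
  have hin : ∀ j, meas (a j k) (x k) = ‖x k‖ ^ 2 * inner ℝ (a j k) e ^ 2 := by
    intro j
    unfold meas
    conv_lhs => rw [hxe]
    rw [inner_smul_right, mul_pow]
  unfold truncMeas truncSq
  simp only [hin, ← Finset.mul_sum]
  rcases eq_or_ne (‖x k‖) 0 with h | h
  · simp [h]
  · have hpos : 0 < ‖x k‖ ^ 2 := by positivity
    have : ‖x k‖ ^ 2 * inner ℝ (a i k) e ^ 2
        ≤ 9 * (‖x k‖ ^ 2 * (∑ j, inner ℝ (a j k) e ^ 2) / (m : ℝ)) ↔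
        inner ℝ (a i k) e ^ 2 ≤ 9 * ((∑ j, (inner ℝ (a j k) e : ℝ) ^ 2) / (m : ℝ)) := by
      rw [show 9 * (‖x k‖ ^ 2 * (∑ j, (inner ℝ (a j k) e : ℝ) ^ 2) / (m : ℝ))
        = ‖x k‖ ^ 2 * (9 * ((∑ j, (inner ℝ (a j k) e : ℝ) ^ 2) / (m : ℝ))) by ring]
      exact mul_le_mul_iff_right₀ hpos
    simp only [this]
    split_ifs <;> simp

theorem norm_pow_four_mul_spike_eq {a : Fin m → Fin q → EuclideanSpace ℝ (Fin n)}
    {x : Fin q → EuclideanSpace ℝ (Fin n)} {k : Fin q} {e : EuclideanSpace ℝ (Fin n)}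
    (hxe : x k = ‖x k‖ • e) {c : ℝ} (hc : c = (∑ i, truncSq (fun j => inner ℝ (a j k) e) i
        * ((inner ℝ (a i k) e : ℝ) ^ 2 - 1)) / (m : ℝ)) (hx : x k ≠ 0) :
    spike a x k = c := by
  have hn : ‖x k‖ ≠ 0 := norm_ne_zero_iff.2 hx
  have hin : ∀ j, meas (a j k) (x k) = ‖x k‖ ^ 2 * inner ℝ (a j k) e ^ 2 := by
    intro j
    unfold meas
    conv_lhs => rw [hxe]
    rw [inner_smul_right, mul_pow]
  unfold spike
  rw [hc, div_eq_iff (by positivity), one_div, inv_mul_eq_div]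
  conv_rhs => rw [div_mul_eq_mul_div, Finset.sum_mul]
  congr 1
  refine Finset.sum_congr rfl fun i _ => ?_
  rw [truncMeas_eq hxe, hin]; ring

/-- With u, g the components of a_{i,k} along e_k and f_k, and w = p e_k + s f_k, bulk and spike
remove 1 = p² + s² and p²(u² - 1) from (pu + sg)². What is left, s²(g² - 1) + 2psug, has mean zero
given u. -/
theorem fluct_eq {a : Fin m → Fin q → EuclideanSpace ℝ (Fin n)}
    {x e f : Fin q → EuclideanSpace ℝ (Fin n)} (hm : 0 < m) (hq : 0 < q)
    (hxe : ∀ k, x k = ‖x k‖ • e k)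
    (he : ∀ k, ‖e k‖ = 1) (hf : ∀ k, ‖f k‖ = 1) (hef : ∀ k, inner ℝ (e k) (f k) = 0)
    {w : EuclideanSpace ℝ (Fin n)} (hw : ‖w‖ = 1) {s : Fin q → ℝ}
    (hdec : ∀ k, w = (inner ℝ w (e k) : ℝ) • e k + s k • f k) :
    fluct a x w = 1 / (m * q : ℝ) * ∑ i, ∑ k, ‖x k‖ ^ 2 * truncSq (fun j => inner ℝ (a j k)
        (e k)) i *
      (s k ^ 2 * ((inner ℝ (a i k) (f k) : ℝ) ^ 2 - 1)
        + 2 * inner ℝ w (e k) * s k * inner ℝ (a i k) (e k) * inner ℝ (a i k) (f k)) := by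
  have hm' : (m : ℝ) ≠ 0 := by exact_mod_cast hm.ne'
  have hq' : (q : ℝ) ≠ 0 := by exact_mod_cast hq.ne'
  have hspike : ∀ k, spike a x k * inner ℝ (x k) w ^ 2 = 1 / (m : ℝ) * ∑ i,
      ‖x k‖ ^ 2 * truncSq (fun j => inner ℝ (a j k) (e k)) i
        * (((inner ℝ (a i k) (e k) : ℝ) ^ 2 - 1) * inner ℝ w (e k) ^ 2) := by
    intro k
    have hin : (inner ℝ (x k) w : ℝ) = ‖x k‖ * inner ℝ w (e k) := by
      conv_lhs => rw [hxe k]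
      rw [inner_smul_left, real_inner_comm]; rfl
    rcases eq_or_ne (x k) 0 with h | h
    · simp [h]
    · rw [norm_pow_four_mul_spike_eq (hxe k) rfl h, hin, one_div, inv_mul_eq_div,
        div_mul_eq_mul_div, Finset.sum_mul]
      congr 1
      exact Finset.sum_congr rfl fun i _ => by ring
  have hsum : 1 / (q : ℝ) * ∑ k, spike a x k * inner ℝ (x k) w ^ 2 = 1 / (m * q : ℝ) * ∑ i, ∑ k,
      ‖x k‖ ^ 2 * truncSq (fun j => inner ℝ (a j k) (e k)) i
        * (((inner ℝ (a i k) (e k) : ℝ) ^ 2 - 1) * inner ℝ w (e k) ^ 2) := by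
    simp_rw [hspike]
    rw [← Finset.mul_sum, Finset.sum_comm, ← mul_assoc]
    congr 1
    field_simp
  rw [fluct, bulk, hsum, hw, one_pow, mul_one, ← mul_sub, ← mul_sub, ← Finset.sum_sub_distrib,
    ← Finset.sum_sub_distrib]
  congr 1
  refine Finset.sum_congr rfl fun i _ => ?_
  rw [← Finset.sum_sub_distrib, ← Finset.sum_sub_distrib]
  refine Finset.sum_congr rfl fun k _ => ?_
  have h1 := sq_add_sq_of_decomp (he k) (hf k) (hef k) (hdec k)
  have h2 : (inner ℝ (a i k) w : ℝ) = inner ℝ w (e k) * inner ℝ (a i k) (e k)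
      + s k * inner ℝ (a i k) (f k) := by
    conv_lhs => rw [hdec k]
    rw [inner_add_right, inner_smul_right, inner_smul_right]
  rw [truncMeas_eq (hxe k), h2]
  rw [hw] at h1
  linear_combination (‖x k‖ ^ 2 * truncSq (fun j => inner ℝ (a j k) (e k)) i) * h1

/-- An inequality, rather than an identity, holds for arbitrary S, so measurability of the bad set
is not needed. -/
theorem measure_column_le {e : EuclideanSpace ℝ (Fin n)} (he : ‖e‖ = 1) (k : Fin q)
    (S : Set (Fin m → ℝ)) :
    Measure.pi (fun _ : Fin m × Fin q => gaussE n) {a | (fun i => (inner ℝ (a (i, k)) e : ℝ)) ∈ S}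
      ≤ Measure.pi (fun _ : Fin m => gaussianReal 0 1) S := by
  have hind : iIndepFun (fun (p : Fin m × Fin q) (a : Fin m × Fin q → EuclideanSpace ℝ (Fin n)) =>
      (inner ℝ (a p) e : ℝ)) (Measure.pi fun _ : Fin m × Fin q => gaussE n) :=
    iIndepFun_pi (X := fun _ y => (inner ℝ y e : ℝ)) fun p => by fun_prop
  have hind' := hind.precomp (g := fun i : Fin m => (i, k)) (fun i j hij => by simpa using hij)
  have hmeas : ∀ i : Fin m, Measurable
      fun a : Fin m × Fin q → EuclideanSpace ℝ (Fin n) => (inner ℝ (a (i, k)) e : ℝ) :=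
    fun i => (measurable_pi_apply (i, k)).inner_const
  have hmap := hind'.map_fun_eq_pi_map (fun i => (hmeas i).aemeasurable)
  have h1 : ∀ i : Fin m, (Measure.pi fun _ : Fin m × Fin q => gaussE n).map
      (fun a => (inner ℝ (a (i, k)) e : ℝ)) = gaussianReal 0 1 := by
    intro i
    have hmp : MeasurePreserving (fun y : EuclideanSpace ℝ (Fin n) => (inner ℝ y e : ℝ))
        (gaussE n) (gaussianReal 0 1) := ⟨by fun_prop, map_inner_stdGaussian he⟩
    exact (hmp.comp (measurePreserving_eval (fun _ : Fin m × Fin q => gaussE n) (i, k))).map_eq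
  simp only [h1] at hmap
  rw [← hmap]
  exact Measure.le_map_apply (measurable_pi_lambda _ hmeas).aemeasurable S

theorem natCast_mul_ofReal_add_eq {s t : ℝ} (hs : 0 ≤ s) (ht : 0 ≤ t) (k l : ℕ) :
    (k : ENNReal) * (3 * ENNReal.ofReal s) + l * (2 * ENNReal.ofReal t)
      = ENNReal.ofReal (3 * k * s + 2 * l * t) := by
  rw [ENNReal.ofReal_add (by positivity) (by positivity),
    ENNReal.ofReal_mul (by positivity), ENNReal.ofReal_mul (by positivity),
    ENNReal.ofReal_mul (by positivity), ENNReal.ofReal_mul (by positivity),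
    ENNReal.ofReal_natCast, ENNReal.ofReal_natCast]
  simp only [ENNReal.ofReal_ofNat]
  ring

/-- A union bound over the q columns and the points of N. The column event gives both the lower
bound on the spike and the average bound 2 that caps the truncated squares in the fluctuation
estimate. -/
theorem measure_not_subspaceGood_le (hn : 2 ≤ n) (hm : 0 < m) (hq : 0 < q)
    {x : Fin q → EuclideanSpace ℝ (Fin n)} {R τ : ℝ} (hx : ∀ k, ‖x k‖ ^ 2 ≤ R) (hτ : 0 < τ)
    (hτR : τ ≤ R) {N : Finset (EuclideanSpace ℝ (Fin n))} (hN : ∀ w ∈ N, ‖w‖ = 1) :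
    Measure.pi (fun _ : Fin m × Fin q => gaussE n)
      {a | ¬ SubspaceGood (fun i k => a (i, k)) x N τ}
      ≤ ENNReal.ofReal (3 * q * Real.exp (-(m / 500000))
        + 2 * N.card * Real.exp (-(τ ^ 2 * (m * q) / (28512 * R ^ 2)))) := by
  set μ := Measure.pi (fun _ : Fin m × Fin q => gaussE n) with hμ
  choose e he hxe using fun k => exists_unit_smul (by omega) (x k)
  set good : Set (Fin m → ℝ) := {u | (∑ j, u j ^ 2) / (m : ℝ) ≤ 2 ∧
    1 / 16 ≤ (∑ i, truncSq u i * (u i ^ 2 - 1)) / (m : ℝ)} with hgood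
  set BK : Fin q → Set (Fin m × Fin q → EuclideanSpace ℝ (Fin n)) := fun k =>
    {a | (fun i => (inner ℝ (a (i, k)) (e k) : ℝ)) ∈ goodᶜ} with hBK
  set BW : EuclideanSpace ℝ (Fin n) → Set (Fin m × Fin q → EuclideanSpace ℝ (Fin n)) := fun w =>
    {a | (∀ k, (∑ i, (inner ℝ (a (i, k)) (e k) : ℝ) ^ 2) / (m : ℝ) ≤ 2) ∧
      τ ≤ |fluct (fun i k => a (i, k)) x w|} with hBW
  have hBKm : ∀ k, μ (BK k) ≤ 3 * ENNReal.ofReal (Real.exp (-(m / 500000))) := fun k =>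
    (measure_column_le (he k) k _).trans (measure_pi_truncSq_bounds hm)
  have hBWm : ∀ w ∈ N, μ (BW w) ≤
      2 * ENNReal.ofReal (Real.exp (-(τ ^ 2 * (m * q) / (28512 * R ^ 2)))) := by
    intro w hw
    choose f s hf hef hdec using fun k => exists_orthonormal_decomp hn (he k) w
    have hps : ∀ k, (inner ℝ w (e k) : ℝ) ^ 2 + s k ^ 2 = 1 := fun k => by
      rw [sq_add_sq_of_decomp (he k) (hf k) (hef k) (hdec k), hN w hw, one_pow]
    have h1 := measure_pi_fluctuation_le hm hq (ρ := fun k => ‖x k‖ ^ 2)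
      (p := fun k => (inner ℝ w (e k) : ℝ)) (fun k => sq_nonneg _) hx hps hτ hτR
    have hmp : MeasurePreserving
        (fun (a : Fin m × Fin q → EuclideanSpace ℝ (Fin n)) p =>
          ((inner ℝ (a p) (e p.2) : ℝ), (inner ℝ (a p) (f p.2) : ℝ))) μ
        (Measure.pi fun _ : Fin m × Fin q => (gaussianReal 0 1).prod (gaussianReal 0 1)) :=
      measurePreserving_pi (fun _ : Fin m × Fin q => gaussE n) _ fun p =>
        ⟨by fun_prop, map_inner_pair_stdGaussian (he p.2) (hf p.2) (hef p.2)⟩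
    rw [← hmp.map_eq] at h1
    refine le_trans ?_ ((Measure.le_map_apply hmp.aemeasurable _).trans h1)
    refine measure_mono ?_
    rintro a ⟨ha1, ha2⟩
    rw [fluct_eq hm hq hxe he hf hef (hN w hw) hdec] at ha2
    exact ⟨ha1, ha2⟩
  have hsub : {a | ¬ SubspaceGood (fun i k => a (i, k)) x N τ} ⊆ (⋃ k, BK k) ∪ ⋃ w ∈ N, BW w := by
    intro a ha
    by_contra hcon
    have c1 : ∀ k, (fun i => (inner ℝ (a (i, k)) (e k) : ℝ)) ∈ good := fun k =>
      not_not.1 fun h => hcon (Or.inl (Set.mem_iUnion.2 ⟨k, h⟩))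
    have c2 : ∀ w ∈ N, a ∉ BW w := fun w hw h =>
      hcon (Or.inr (Set.mem_iUnion₂.2 ⟨w, hw, h⟩))
    refine ha ⟨fun k => ?_, fun w hw => ?_⟩
    · rcases eq_or_ne (x k) 0 with h | h
      · rw [h, norm_zero, zero_pow four_ne_zero, zero_mul, zero_mul]
      · refine mul_le_mul_of_nonneg_left ?_ (by positivity)
        rw [norm_pow_four_mul_spike_eq (hxe k) rfl h]
        exact (c1 k).2
    · by_contra hlt
      exact c2 w hw ⟨fun k => (c1 k).1, (not_le.1 hlt).le⟩
  calc μ _ ≤ μ ((⋃ k, BK k) ∪ ⋃ w ∈ N, BW w) := measure_mono hsub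
    _ ≤ ∑ k, μ (BK k) + ∑ w ∈ N, μ (BW w) :=
      (measure_union_le _ _).trans (add_le_add (measure_iUnion_fintype_le _ _)
        (measure_biUnion_finset_le _ _))
    _ ≤ ∑ _k : Fin q, 3 * ENNReal.ofReal (Real.exp (-(m / 500000))) + ∑ w ∈ N,
        2 * ENNReal.ofReal (Real.exp (-(τ ^ 2 * (m * q) / (28512 * R ^ 2)))) :=
      add_le_add (Finset.sum_le_sum fun k _ => hBKm k) (Finset.sum_le_sum hBWm)
    _ = _ := by
      rw [Finset.sum_const, Finset.sum_const, Finset.card_univ, Fintype.card_fin, nsmul_eq_mul,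
        nsmul_eq_mul]
      exact natCast_mul_ofReal_add_eq (Real.exp_pos _).le (Real.exp_pos _).le q N.card

end

/-! ### From the good events to the error of the output -/

section

open Matrix

variable {n m q r mt : ℕ}

theorem matYU_eq (a : Fin m → Fin q → EuclideanSpace ℝ (Fin n))
    (x : Fin q → EuclideanSpace ℝ (Fin n)) :
    matYU a x = (1 / ((m : ℝ) * (q : ℝ))) • ∑ i, ∑ k, truncMeas a x i k • outer (a i k) := by
  unfold matYU truncMeas
  congr 1
  refine Finset.sum_congr rfl fun i _ => Finset.sum_congr rfl fun k _ => ?_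
  split_ifs <;> simp

theorem isSymm_matYU (a : Fin m → Fin q → EuclideanSpace ℝ (Fin n))
    (x : Fin q → EuclideanSpace ℝ (Fin n)) : (matYU a x).IsSymm := by
  rw [matYU_eq]
  exact (isSymm_sum _ fun i _ => isSymm_sum _ fun k _ => (isSymm_outer _).smul _).smul _

theorem norm_mulE {U : Matrix (Fin n) (Fin r) ℝ} (hU : Uᵀ * U = 1) (b : EuclideanSpace ℝ (Fin r)) :
    ‖mulE U b‖ = ‖b‖ := by
  have h : ‖mulE U b‖ ^ 2 = ‖b‖ ^ 2 := by
    rw [← ofLp_dotProduct_self, ← ofLp_dotProduct_self, mulE,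
      mulVec_dotProduct_mulVec_of_orthonormal hU]
  exact (pow_left_inj₀ (norm_nonneg _) (norm_nonneg _) two_ne_zero).1 h

theorem quadForm_smul_sum_outer {ι : Type*} [Fintype ι] (c : ℝ) (s : ι → ℝ)
    (b : ι → EuclideanSpace ℝ (Fin r)) (v : EuclideanSpace ℝ (Fin r)) :
    v.ofLp ⬝ᵥ (c • ∑ k, s k • outer (b k)) *ᵥ v.ofLp = c * ∑ k, s k * inner ℝ (b k) v ^ 2 := by
  rw [smul_mulVec, dotProduct_smul, smul_eq_mul, sum_mulVec, dotProduct_sum]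
  congr 1
  refine Finset.sum_congr rfl fun k _ => ?_
  rw [smul_mulVec, dotProduct_smul, smul_eq_mul, dotProduct_outer_mulVec]

/-- F is defined as the remainder, so its quadratic form is `fluct`, and the net bound multiplies τ
by 32. The spike weights are at least 1/16, which turns the lower bound 16γ for the second moments
of b into γ for M. -/
theorem exists_isPerturbedSpike (hn : 0 < n) {a : Fin m → Fin q → EuclideanSpace ℝ (Fin n)}
    {U : Matrix (Fin n) (Fin r) ℝ} {b : Fin q → EuclideanSpace ℝ (Fin r)} (hU : Uᵀ * U = 1)
    {N : Finset (EuclideanSpace ℝ (Fin n))} (hN1 : ∀ w ∈ N, ‖w‖ = 1)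
    (hN2 : ∀ v, ‖v‖ = 1 → ∃ w ∈ N, ‖v - w‖ < 1 / 2) {γ τ : ℝ} (hγ : 0 < γ)
    (hb : ∀ v, 16 * γ * ‖v‖ ^ 2 ≤ 1 / (q : ℝ) * ∑ k, inner ℝ (b k) v ^ 2)
    (hS : SubspaceGood a (fun k => mulE U (b k)) N τ) (hτ : 0 ≤ τ) (hτγ : 32 * τ ≤ γ / 4) :
    ∃ M F, IsPerturbedSpike (matYU a fun k => mulE U (b k)) U M F (bulk a fun k => mulE U (b k))
      γ (32 * τ) := by
  set x : Fin q → EuclideanSpace ℝ (Fin n) := fun k => mulE U (b k) with hx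
  set M : Matrix (Fin r) (Fin r) ℝ := (1 / (q : ℝ)) • ∑ k, spike a x k • outer (b k) with hM
  have hout : ∀ k, U * outer (b k) * Uᵀ = outer (x k) := fun k => by
    rw [outer, outer, mul_vecMulVec, vecMulVec_mul, vecMul_transpose]
    rfl
  have hUM : U * M * Uᵀ = (1 / (q : ℝ)) • ∑ k, spike a x k • outer (x k) := by
    rw [hM, Matrix.mul_smul, Matrix.smul_mul, Matrix.mul_sum, Matrix.sum_mul]
    congr 1
    refine Finset.sum_congr rfl fun k _ => ?_
    rw [Matrix.mul_smul, Matrix.smul_mul, hout]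
  set F := matYU a x - bulk a x • (1 : Matrix (Fin n) (Fin n) ℝ) - U * M * Uᵀ with hF
  have hFs : F.IsSymm := by
    rw [hF, hUM]
    exact ((isSymm_matYU a x).sub (isSymm_one.smul _)).sub
      ((isSymm_sum _ fun k _ => (isSymm_outer _).smul _).smul _)
  have hquad : ∀ w : EuclideanSpace ℝ (Fin n), w.ofLp ⬝ᵥ F *ᵥ w.ofLp = fluct a x w := by
    intro w
    rw [hF, hUM, sub_mulVec, sub_mulVec, dotProduct_sub, dotProduct_sub, quadForm_smul_sum_outer,
      smul_mulVec, one_mulVec, dotProduct_smul, smul_eq_mul, ofLp_dotProduct_self, fluct,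
      matYU_eq, ← Fintype.sum_prod_type' (f := fun i k => truncMeas a x i k • outer (a i k)),
      quadForm_smul_sum_outer, Fintype.sum_prod_type]
  refine ⟨M, F, by rw [hF]; abel, hU, hFs, fun v => ?_,
    quadForm_le_of_net hn hFs hN1 hN2 fun w hw => by rw [hquad]; exact hS.2 w hw, hγ,
    by positivity, hτγ⟩
  have h1 := quadForm_smul_sum_outer (1 / (q : ℝ)) (spike a x) b (WithLp.toLp 2 v)
  have h2 := hb (WithLp.toLp 2 v)
  rw [← ofLp_dotProduct_self] at h2
  rw [hM]
  change v ⬝ᵥ _ *ᵥ v = _ at h1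
  change 16 * γ * (v ⬝ᵥ v) ≤ _ at h2
  rw [h1]
  have h3 : ∑ k, (inner ℝ (b k) (WithLp.toLp 2 v) : ℝ) ^ 2
      ≤ 16 * ∑ k, spike a x k * inner ℝ (b k) (WithLp.toLp 2 v) ^ 2 := by
    rw [Finset.mul_sum]
    refine Finset.sum_le_sum fun k _ => ?_
    -- For b_k = 0 the spike weight is a quotient by zero and carries no lower bound, but its term
    -- vanishes.
    rcases eq_or_ne (b k) 0 with h | h
    · simp [h]
    · have hpos : 0 < ‖x k‖ ^ 4 := by
        rw [hx, norm_mulE hU]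
        have := norm_pos_iff.2 h
        positivity
      have h4 := le_of_mul_le_mul_left (hS.1 k) hpos
      nlinarith [sq_nonneg (inner ℝ (b k) (WithLp.toLp 2 v) : ℝ)]
  have h5 : 0 ≤ 1 / (q : ℝ) := by positivity
  nlinarith [mul_le_mul_of_nonneg_left h3 h5]

theorem IsPerturbedSpike.output_le (hr : 0 < r) {a : Fin m → Fin q → EuclideanSpace ℝ (Fin n)}
    {anew : Fin mt → EuclideanSpace ℝ (Fin n)}
    {U : Matrix (Fin n) (Fin r) ℝ} {b : Fin q → EuclideanSpace ℝ (Fin r)}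
    {M : Matrix (Fin r) (Fin r) ℝ} {F : Matrix (Fin n) (Fin n) ℝ} {α γ δ ε : ℝ}
    (h : IsPerturbedSpike (matYU a fun k => mulE U (b k)) U M F α γ (γ * δ / 4))
    (hδ : 0 ≤ δ) (hδε : δ ≤ ε) (hε : 0 < ε) (hε1 : ε < 1)
    (hnew : ∀ k, NewGood (specProj ((2 / γ) • (matYU a (fun k => mulE U (b k))
      - α • (1 : Matrix (Fin n) (Fin n) ℝ)))) (mulE U (b k)) ε anew)
    {Uhat : Matrix (Fin n) (Fin r) ℝ} {xhat : Fin q → EuclideanSpace ℝ (Fin n)}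
    (hout : IsOutput a anew (fun k => mulE U (b k)) Uhat xhat) :
    SE Uhat U ≤ δ ∧ (∀ k, phaseDist (mulE U (b k)) (xhat k) ^ 2 ≤ 9 * ε * ‖mulE U (b k)‖ ^ 2) ∧
      normErr (fun k => mulE U (b k)) xhat ≤ 9 * ε := by
  obtain ⟨hV, hx⟩ := hout
  have hγ := h.gap
  have hres : ∀ v : Fin r → ℝ, (((1 - Uhat * Uhatᵀ) * U) *ᵥ v) ⬝ᵥ (((1 - Uhat * Uhatᵀ) * U) *ᵥ v)
      ≤ δ ^ 2 * (v ⬝ᵥ v) := by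
    intro v
    refine (h.residual_le hr hV v).trans ?_
    refine mul_le_mul_of_nonneg_right ?_ (dotProduct_self_nonneg' v)
    -- With φ = γδ/4 the sin-theta bound is δ/(4 - δ), at most δ because δ < 1.
    have h1 : 0 < γ - γ * δ / 4 := by nlinarith
    refine pow_le_pow_left₀ (div_nonneg (by positivity) h1.le) ?_ 2
    rw [div_le_iff₀ h1]
    nlinarith [mul_nonneg hγ.le hδ, mul_nonneg (mul_nonneg hγ.le hδ) hδ,
      mul_nonneg (mul_nonneg hγ.le hδ) (sub_nonneg.2 (hδε.trans hε1.le))]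
  have hdist : ∀ k, phaseDist (mulE U (b k)) (xhat k) ^ 2 ≤ 9 * ε * ‖mulE U (b k)‖ ^ 2 := by
    intro k
    obtain ⟨v, hv, hxk⟩ := hx k
    obtain ⟨hN, hν⟩ := hnew k
    rw [h.specProj_eq hV] at hN
    rw [hxk]
    refine phaseDist_output_le hr hV.transpose_mul_self hε hε1 ?_ hN hν hv
    have h1 := hres (b k).ofLp
    rw [← mulVec_mulVec] at h1
    rw [norm_mulE h.orthonormal, ← ofLp_dotProduct_self]
    refine h1.trans (mul_le_mul_of_nonneg_right ?_ (dotProduct_self_nonneg' _))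
    exact pow_le_pow_left₀ hδ hδε 2
  refine ⟨SE_le_of_residual hδ hres, hdist, ?_⟩
  unfold normErr
  refine div_le_of_le_mul₀ (by positivity) (by positivity) ?_
  rw [Finset.mul_sum]
  exact Finset.sum_le_sum fun k _ => hdist k

end

/-! ### Norms and empirical covariance of the coefficient vectors -/

section

open Matrix

variable {q r : ℕ}

/-- The coefficient vectors are bounded, and their empirical second moments are within `t` of `S`
on `N`. -/
def CoeffGood (b : Fin q → EuclideanSpace ℝ (Fin r)) (S : Matrix (Fin r) (Fin r) ℝ)
    (N : Finset (EuclideanSpace ℝ (Fin r))) (R t : ℝ) : Prop :=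
  (∀ k, ‖b k‖ ^ 2 ≤ R) ∧
    ∀ w ∈ N, |1 / (q : ℝ) * ∑ k, inner ℝ (b k) w ^ 2 - w.ofLp ⬝ᵥ S *ᵥ w.ofLp| ≤ t

theorem CoeffGood.le_sum_inner_sq (hr : 0 < r) {b : Fin q → EuclideanSpace ℝ (Fin r)}
    {S : Matrix (Fin r) (Fin r) ℝ} (hS : S.IsSymm) {N : Finset (EuclideanSpace ℝ (Fin r))}
    (hN1 : ∀ w ∈ N, ‖w‖ = 1) (hN2 : ∀ v, ‖v‖ = 1 → ∃ w ∈ N, ‖v - w‖ < 1 / 2) {R t : ℝ}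
    (h : CoeffGood b S N R t) (v : EuclideanSpace ℝ (Fin r)) :
    (lamMin S - 32 * t) * ‖v‖ ^ 2 ≤ 1 / (q : ℝ) * ∑ k, inner ℝ (b k) v ^ 2 := by
  set F : Matrix (Fin r) (Fin r) ℝ := (1 / (q : ℝ)) • ∑ k, (1 : ℝ) • outer (b k) - S with hF
  have hFs : F.IsSymm :=
    ((isSymm_sum _ fun k _ => (isSymm_outer _).smul _).smul _).sub hS
  have hquad : ∀ w : EuclideanSpace ℝ (Fin r), w.ofLp ⬝ᵥ F *ᵥ w.ofLp
      = 1 / (q : ℝ) * ∑ k, inner ℝ (b k) w ^ 2 - w.ofLp ⬝ᵥ S *ᵥ w.ofLp := by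
    intro w
    rw [hF, sub_mulVec, dotProduct_sub, quadForm_smul_sum_outer (1 / (q : ℝ)) (fun _ => 1) b]
    simp only [one_mul]
  have h1 := quadForm_le_of_net hr hFs hN1 hN2
    (fun w hw => by rw [hquad]; exact h.2 w hw) v.ofLp
  have h2 := lamMin_mul_le hS v.ofLp
  rw [hquad, ofLp_dotProduct_self] at h1
  rw [ofLp_dotProduct_self] at h2
  linarith [(abs_le.1 h1).1]

theorem gaussianReal_map_sqrt_mul (v : NNReal) :
    (gaussianReal 0 1).map (fun x => √(v : ℝ) * x) = gaussianReal 0 v := by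
  rw [gaussianReal_map_const_mul]
  congr 1
  · simp
  · ext
    simp

theorem gaussianReal_sq_ge_le {v : NNReal} {W s : ℝ} (hW : 0 < W) (hv : (v : ℝ) ≤ W) :
    gaussianReal 0 v {x | W * s < x ^ 2} ≤ ENNReal.ofReal (Real.exp (1 - s / 8)) := by
  rw [← gaussianReal_map_sqrt_mul v, Measure.map_apply (by fun_prop)
    (measurableSet_lt (by fun_prop) (by fun_prop))]
  -- The largest admissible tilt; the constants 1/16 from the moment and 1/8 from centring are
  -- absorbed in the 1 of the exponent.
  have h1 := lintegral_exp_quad_gaussianReal_le (A := 1 / 8) (B := 0) (by norm_num [abs_of_pos])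
  have h2 := measure_le_of_lintegral_exp_le (τ := (s - 1) / 8) (by fun_prop) h1
  refine (measure_mono fun x hx => ?_).trans (h2.trans (ENNReal.ofReal_le_ofReal
    (Real.exp_le_exp.2 (by linarith))))
  have h3 : W * s < (√(v : ℝ) * x) ^ 2 := hx
  rw [mul_pow, Real.sq_sqrt v.coe_nonneg] at h3
  have h4 : W * s < W * x ^ 2 := h3.trans_le (mul_le_mul_of_nonneg_right hv (sq_nonneg x))
  have h5 := lt_of_mul_lt_mul_left h4 hW.le
  change (s - 1) / 8 ≤ 1 / 8 * (x ^ 2 - 1) + 0 * x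
  linarith

/-- The variables are scaled standard Gaussians, so this is the weighted chi-square bound with
weights ± v_k. Zero variances are covered. -/
theorem measure_pi_gaussianReal_sum_sq_dev_le (hq : 0 < q) {v : Fin q → NNReal} {W δ : ℝ}
    (hW : 0 < W) (hv : ∀ k, (v k : ℝ) ≤ W) (hδ : 0 ≤ δ) (hδ1 : δ ≤ 1) :
    Measure.pi (fun k => gaussianReal 0 (v k))
      {x | δ * W < |1 / (q : ℝ) * ∑ k, x k ^ 2 - 1 / (q : ℝ) * ∑ k, (v k : ℝ)|}
      ≤ 2 * ENNReal.ofReal (Real.exp (-(q * δ ^ 2 / 16))) := by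
  have hmp : MeasurePreserving (fun (x : Fin q → ℝ) k => √(v k : ℝ) * x k)
      (Measure.pi fun _ : Fin q => gaussianReal 0 1) (Measure.pi fun k => gaussianReal 0 (v k)) :=
    measurePreserving_pi _ _ fun k => ⟨by fun_prop, gaussianReal_map_sqrt_mul (v k)⟩
  rw [← hmp.map_eq, Measure.map_apply hmp.measurable
    (measurableSet_lt (by fun_prop) (by fun_prop))]
  have h1 := measure_pi_gaussian_weighted_sq_ge_le (w := fun k => (v k : ℝ)) hW
    (fun k => by rw [abs_of_nonneg (v k).coe_nonneg]; exact hv k) hδ hδ1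
  have h2 := measure_pi_gaussian_weighted_sq_ge_le (w := fun k => -(v k : ℝ)) hW
    (fun k => by rw [abs_neg, abs_of_nonneg (v k).coe_nonneg]; exact hv k) hδ hδ1
  rw [Fintype.card_fin] at h1 h2
  rw [two_mul]
  refine (measure_mono fun x hx => ?_).trans ((measure_union_le _ _).trans (add_le_add h1 h2))
  have hq' : (0 : ℝ) < q := by exact_mod_cast hq
  have h3 : δ * W < |1 / (q : ℝ) * ∑ k, (√(v k : ℝ) * x k) ^ 2 - 1 / (q : ℝ) * ∑ k, (v k : ℝ)| := hx
  have h4 : ∑ k, (√(v k : ℝ) * x k) ^ 2 - ∑ k, (v k : ℝ) = ∑ k, (v k : ℝ) * (x k ^ 2 - 1) := by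
    rw [← Finset.sum_sub_distrib]
    refine Finset.sum_congr rfl fun k _ => ?_
    rw [mul_pow, Real.sq_sqrt (v k).coe_nonneg]; ring
  rw [← mul_sub, h4, abs_mul, abs_of_pos (by positivity), one_div, inv_mul_eq_div,
    lt_div_iff₀ hq'] at h3
  rcases lt_abs.1 h3 with h | h
  · left
    change (q : ℝ) * δ * W ≤ _
    linarith
  · right
    change (q : ℝ) * δ * W ≤ ∑ k, -(v k : ℝ) * (x k ^ 2 - 1)
    simp only [neg_mul, Finset.sum_neg_distrib]
    linarith

theorem dotProduct_avgCov_mulVec (Λ : Fin q → Matrix (Fin r) (Fin r) ℝ) (w : Fin r → ℝ) :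
    w ⬝ᵥ avgCov Λ *ᵥ w = 1 / (q : ℝ) * ∑ k, w ⬝ᵥ Λ k *ᵥ w := by
  rw [avgCov, smul_mulVec, dotProduct_smul, smul_eq_mul, sum_mulVec, dotProduct_sum]

theorem measure_not_coeffGood_le {Ω : Type*} [MeasurableSpace Ω] {P : Measure Ω}
    [IsProbabilityMeasure P] (hq : 0 < q) (hr : 0 < r) {b : Fin q → Ω → EuclideanSpace ℝ (Fin r)}
    {Λ : Fin q → Matrix (Fin r) (Fin r) ℝ} (hpos : ∀ k, (Λ k).PosSemidef)
    (hbm : ∀ k, Measurable (b k)) (hlaw : ∀ k, P.map (b k) = multivariateGaussian 0 (Λ k))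
    (hind : iIndepFun b P) {W δ s : ℝ} (hW : 0 < W)
    (hΛW : ∀ k v, v ⬝ᵥ Λ k *ᵥ v ≤ W * (v ⬝ᵥ v)) (hδ : 0 ≤ δ) (hδ1 : δ ≤ 1)
    {N : Finset (EuclideanSpace ℝ (Fin r))} (hN : ∀ w ∈ N, ‖w‖ = 1) :
    P {ω | ¬ CoeffGood (fun k => b k ω) (avgCov Λ) N (r * (W * s)) (δ * W)}
      ≤ ENNReal.ofReal (q * r * Real.exp (1 - s / 8)
        + 2 * N.card * Real.exp (-(q * δ ^ 2 / 16))) := by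
  have hlaw' : ∀ (w : EuclideanSpace ℝ (Fin r)) k, P.map (fun ω => (inner ℝ (b k ω) w : ℝ))
      = gaussianReal 0 (w.ofLp ⬝ᵥ (Λ k).mulVec w.ofLp).toNNReal := by
    intro w k
    rw [← map_inner_multivariateGaussian (hpos k), ← hlaw k,
      Measure.map_map (by fun_prop) (hbm k)]
    rfl
  have hvar : ∀ w : EuclideanSpace ℝ (Fin r), ‖w‖ = 1 → ∀ k,
      ((w.ofLp ⬝ᵥ (Λ k).mulVec w.ofLp).toNNReal : ℝ) ≤ W := by
    intro w hw k
    rw [Real.coe_toNNReal _ (by simpa using (hpos k).dotProduct_mulVec_nonneg w.ofLp)]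
    have := hΛW k w.ofLp
    rwa [ofLp_dotProduct_self, hw, one_pow, mul_one] at this
  have h1 : ∀ k (j : Fin r), P {ω | W * s < b k ω j ^ 2} ≤ ENNReal.ofReal (Real.exp (1 - s / 8)) :=
      by
    intro k j
    have he : ‖EuclideanSpace.single j (1 : ℝ)‖ = 1 := by simp
    have h2 := gaussianReal_sq_ge_le (s := s) hW (hvar _ he k)
    rw [← hlaw' _ k, Measure.map_apply (by fun_prop)
      (measurableSet_lt (by fun_prop) (by fun_prop))] at h2
    refine le_trans (measure_mono fun ω hω => ?_) h2
    simpa [EuclideanSpace.inner_single_right] using hω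
  have h2 : ∀ w ∈ N, P {ω | δ * W < |1 / (q : ℝ) * ∑ k, (inner ℝ (b k ω) w : ℝ) ^ 2
      - w.ofLp ⬝ᵥ avgCov Λ *ᵥ w.ofLp|} ≤ 2 * ENNReal.ofReal (Real.exp (-(q * δ ^ 2 / 16))) := by
    intro w hw
    have h3 := measure_pi_gaussianReal_sum_sq_dev_le hq hW (hvar w (hN w hw)) hδ hδ1
    have hind' : iIndepFun (fun k ω => (inner ℝ (b k ω) w : ℝ)) P :=
      hind.comp (fun _ y => (inner ℝ y w : ℝ)) (fun _ => by fun_prop)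
    have hmap := hind'.map_fun_eq_pi_map (fun k => by fun_prop)
    simp only [hlaw' w] at hmap
    rw [← hmap, Measure.map_apply (by fun_prop) (measurableSet_lt (by fun_prop)
        (by fun_prop))] at h3
    refine le_trans (measure_mono fun ω hω => ?_) h3
    have h4 : ∀ k, ((w.ofLp ⬝ᵥ (Λ k).mulVec w.ofLp).toNNReal : ℝ) = w.ofLp ⬝ᵥ (Λ k).mulVec w.ofLp :=
      fun k => Real.coe_toNNReal _ (by simpa using (hpos k).dotProduct_mulVec_nonneg w.ofLp)
    simp only [Set.preimage_ofPred_eq, h4]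
    rw [dotProduct_avgCov_mulVec] at hω
    exact hω
  have hsub : {ω | ¬ CoeffGood (fun k => b k ω) (avgCov Λ) N (r * (W * s)) (δ * W)}
      ⊆ (⋃ k, ⋃ j, {ω | W * s < b k ω j ^ 2}) ∪
        ⋃ w ∈ N, {ω | δ * W < |1 / (q : ℝ) * ∑ k, (inner ℝ (b k ω) w : ℝ) ^ 2
          - w.ofLp ⬝ᵥ avgCov Λ *ᵥ w.ofLp|} := by
    intro ω hω
    by_contra hcon
    refine hω ⟨fun k => ?_, fun w hw => ?_⟩
    · rw [EuclideanSpace.real_norm_sq_eq]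
      calc ∑ j, b k ω j ^ 2 ≤ ∑ _j : Fin r, W * s := Finset.sum_le_sum fun j _ => not_lt.1 fun h =>
            hcon (Or.inl (Set.mem_iUnion₂.2 ⟨k, j, h⟩))
        _ = _ := by simp
    · exact not_lt.1 fun h => hcon (Or.inr (Set.mem_iUnion₂.2 ⟨w, hw, h⟩))
  calc P _ ≤ ∑ k, P (⋃ j, {ω | W * s < b k ω j ^ 2}) + ∑ w ∈ N, P _ :=
      (measure_mono hsub).trans ((measure_union_le _ _).trans (add_le_add
        (measure_iUnion_fintype_le _ _) (measure_biUnion_finset_le _ _)))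
    _ ≤ ∑ _k : Fin q, ∑ _j : Fin r, ENNReal.ofReal (Real.exp (1 - s / 8)) + ∑ w ∈ N,
        2 * ENNReal.ofReal (Real.exp (-(q * δ ^ 2 / 16))) :=
      add_le_add (Finset.sum_le_sum fun k _ => (measure_iUnion_fintype_le _ _).trans
        (Finset.sum_le_sum fun j _ => h1 k j)) (Finset.sum_le_sum h2)
    _ = _ := by
      simp only [Finset.sum_const, Finset.card_univ, Fintype.card_fin, nsmul_eq_mul]
      rw [ENNReal.ofReal_add (by positivity) (by positivity),
        ENNReal.ofReal_mul (by positivity), ENNReal.ofReal_mul (by positivity),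
        ENNReal.ofReal_mul (by positivity), ENNReal.ofReal_mul (by positivity),
        ENNReal.ofReal_natCast, ENNReal.ofReal_natCast, ENNReal.ofReal_natCast]
      simp only [ENNReal.ofReal_ofNat]
      ring

end

/-! ### Measurability and a Fubini bound -/

section

open Matrix

variable {α : Type*} [MeasurableSpace α] {n m q r mt : ℕ}

/-- Entrywise measurability of a random matrix. -/
def MeasurableEntries {k l : ℕ} (A : α → Matrix (Fin k) (Fin l) ℝ) : Prop :=
  ∀ i j, Measurable fun t => A t i j

namespace MeasurableEntries

variable {k l p : ℕ}

theorem const (A : Matrix (Fin k) (Fin l) ℝ) : MeasurableEntries fun _ : α => A :=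
  fun _ _ => measurable_const

theorem add {A B : α → Matrix (Fin k) (Fin l) ℝ} (hA : MeasurableEntries A)
    (hB : MeasurableEntries B) : MeasurableEntries fun t => A t + B t :=
  fun i j => (hA i j).add (hB i j)

theorem sub {A B : α → Matrix (Fin k) (Fin l) ℝ} (hA : MeasurableEntries A)
    (hB : MeasurableEntries B) : MeasurableEntries fun t => A t - B t :=
  fun i j => (hA i j).sub (hB i j)

theorem smul {c : α → ℝ} {A : α → Matrix (Fin k) (Fin l) ℝ} (hc : Measurable c)
    (hA : MeasurableEntries A) : MeasurableEntries fun t => c t • A t :=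
  fun i j => hc.mul (hA i j)

theorem sum {ι : Type*} (s : Finset ι) {A : ι → α → Matrix (Fin k) (Fin l) ℝ}
    (hA : ∀ i, MeasurableEntries (A i)) : MeasurableEntries fun t => ∑ i ∈ s, A i t := by
  intro i j
  simp only [Matrix.sum_apply]
  exact Finset.measurable_sum _ fun x _ => hA x i j

theorem mul {A : α → Matrix (Fin k) (Fin l) ℝ} {B : α → Matrix (Fin l) (Fin p) ℝ}
    (hA : MeasurableEntries A) (hB : MeasurableEntries B) :
    MeasurableEntries fun t => A t * B t := by
  intro i j
  simp only [Matrix.mul_apply]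
  exact Finset.measurable_sum _ fun x _ => (hA i x).mul (hB x j)

theorem transpose {A : α → Matrix (Fin k) (Fin l) ℝ} (hA : MeasurableEntries A) :
    MeasurableEntries fun t => (A t)ᵀ :=
  fun i j => hA j i

theorem pow {A : α → Matrix (Fin k) (Fin k) ℝ} (hA : MeasurableEntries A) (N : ℕ) :
    MeasurableEntries fun t => A t ^ N := by
  induction N with
  | zero => simpa using const 1
  | succ N ih => simpa only [pow_succ] using ih.mul hA

theorem trace {A : α → Matrix (Fin k) (Fin k) ℝ} (hA : MeasurableEntries A) :
    Measurable fun t => (A t).trace :=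
  Finset.measurable_sum _ fun x _ => hA x x

theorem det {A : α → Matrix (Fin k) (Fin k) ℝ} (hA : MeasurableEntries A) :
    Measurable fun t => (A t).det := by
  simp only [Matrix.det_apply']
  exact Finset.measurable_sum _ fun σ _ =>
    measurable_const.mul (Finset.measurable_prod _ fun i _ => hA (σ i) i)

theorem inv {A : α → Matrix (Fin k) (Fin k) ℝ} (hA : MeasurableEntries A) :
    MeasurableEntries fun t => (A t)⁻¹ := by
  intro i j
  -- Cramer's rule expresses the entries through determinants; singular matrices need no separate
  -- treatment, as inversion of reals is measurable everywhere.
  simp only [Matrix.inv_def, Ring.inverse_eq_inv', Matrix.smul_apply, smul_eq_mul,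
    Matrix.adjugate_apply]
  refine hA.det.inv.mul (det (A := fun t => (A t).updateRow j (Pi.single i 1)) fun a c => ?_)
  simp only [Matrix.updateRow_apply]
  split_ifs
  · exact measurable_const
  · exact hA a c

theorem specProj {A : α → Matrix (Fin k) (Fin k) ℝ} (hA : MeasurableEntries A) :
    MeasurableEntries fun t => specProj (A t) := fun i j =>
  Measurable.limsup fun N => ((((const 1).add (hA.pow (2 * N))).inv).mul (hA.pow (2 * N))) i j

theorem outer {x : α → EuclideanSpace ℝ (Fin k)} (hx : Measurable x) :
    MeasurableEntries fun t => outer (x t) := by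
  intro i j
  simp only [LRPR.outer, Matrix.vecMulVec_apply]
  fun_prop

end MeasurableEntries

theorem measurable_mulE {U : α → Matrix (Fin n) (Fin r) ℝ} {b : α → EuclideanSpace ℝ (Fin r)}
    (hU : MeasurableEntries U) (hb : Measurable b) : Measurable fun t => mulE (U t) (b t) := by
  refine (WithLp.measurable_toLp 2 _).comp (measurable_pi_lambda _ fun i => ?_)
  simp only [Matrix.mulVec, dotProduct]
  exact Finset.measurable_sum _ fun j _ => (hU i j).mul (by fun_prop)

theorem measurable_meas {a x : α → EuclideanSpace ℝ (Fin n)} (ha : Measurable a)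
    (hx : Measurable x) : Measurable fun t => meas (a t) (x t) :=
  (ha.inner hx).pow_const 2

section

variable {a : α → Fin m → Fin q → EuclideanSpace ℝ (Fin n)}
  {x : α → Fin q → EuclideanSpace ℝ (Fin n)}

theorem measurable_truncMeas (ha : ∀ i k, Measurable fun t => a t i k)
    (hx : ∀ k, Measurable fun t => x t k) (i : Fin m) (k : Fin q) :
    Measurable fun t => truncMeas (a t) (x t) i k := by
  have h := fun i => measurable_meas (ha i k) (hx k)
  exact Measurable.ite (measurableSet_le (h i) (((Finset.measurable_sum _ fun i _ => h i).div_const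
    _).const_mul 9)) (h i) measurable_const

theorem measurable_bulk (ha : ∀ i k, Measurable fun t => a t i k)
    (hx : ∀ k, Measurable fun t => x t k) : Measurable fun t => bulk (a t) (x t) :=
  (Finset.measurable_sum _ fun i _ => Finset.measurable_sum _ fun k _ =>
    measurable_truncMeas ha hx i k).const_mul _

theorem measurable_spike (ha : ∀ i k, Measurable fun t => a t i k)
    (hx : ∀ k, Measurable fun t => x t k) (k : Fin q) :
    Measurable fun t => spike (a t) (x t) k :=
  ((Finset.measurable_sum _ fun i _ => (measurable_truncMeas ha hx i k).mul
    ((measurable_meas (ha i k) (hx k)).sub ((hx k).norm.pow_const 2))).const_mul _).div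
    ((hx k).norm.pow_const 4)

theorem measurable_fluct (ha : ∀ i k, Measurable fun t => a t i k)
    (hx : ∀ k, Measurable fun t => x t k) (w : EuclideanSpace ℝ (Fin n)) :
    Measurable fun t => fluct (a t) (x t) w :=
  (((Finset.measurable_sum _ fun i _ => Finset.measurable_sum _ fun k _ =>
    (measurable_truncMeas ha hx i k).mul (((ha i k).inner_const).pow_const 2)).const_mul _).sub
    ((measurable_bulk ha hx).mul_const _)).sub
    ((Finset.measurable_sum _ fun k _ => (measurable_spike ha hx k).mul
      (((hx k).inner_const).pow_const 2)).const_mul _)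

theorem measurableSet_subspaceGood (ha : ∀ i k, Measurable fun t => a t i k)
    (hx : ∀ k, Measurable fun t => x t k) (N : Finset (EuclideanSpace ℝ (Fin n))) (τ : ℝ) :
    MeasurableSet {t | SubspaceGood (a t) (x t) N τ} := by
  have h : {t | SubspaceGood (a t) (x t) N τ}
      = (⋂ k, {t | ‖x t k‖ ^ 4 * (1 / 16) ≤ ‖x t k‖ ^ 4 * spike (a t) (x t) k}) ∩
        ⋂ w ∈ N, {t | |fluct (a t) (x t) w| ≤ τ} := by
    ext t
    simp only [SubspaceGood, Set.mem_inter_iff, Set.mem_iInter, Set.mem_ofPred_eq]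
  rw [h]
  refine (MeasurableSet.iInter fun k => ?_).inter (Finset.measurableSet_biInter _ fun w _ => ?_)
  · exact measurableSet_le (((hx k).norm.pow_const 4).mul_const _)
      (((hx k).norm.pow_const 4).mul (measurable_spike ha hx k))
  · exact measurableSet_le (measurable_fluct ha hx w).norm measurable_const

theorem measurableEntries_matYU (ha : ∀ i k, Measurable fun t => a t i k)
    (hx : ∀ k, Measurable fun t => x t k) : MeasurableEntries fun t => matYU (a t) (x t) := by
  simp only [matYU_eq]
  exact .smul measurable_const (.sum _ fun i => .sum _ fun k =>
    .smul (measurable_truncMeas ha hx i k) (.outer (ha i k)))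

end

theorem measurableSet_newGood {Q : α → Matrix (Fin n) (Fin n) ℝ}
    {x : α → EuclideanSpace ℝ (Fin n)} {η : α → Fin mt → EuclideanSpace ℝ (Fin n)}
    (hQ : MeasurableEntries Q) (hx : Measurable x) (hη : ∀ i, Measurable fun t => η t i) (ε : ℝ) :
    MeasurableSet {t | NewGood (Q t) (x t) ε (η t)} := by
  have hD : MeasurableEntries fun t => newDev (η t) (x t) :=
    ((MeasurableEntries.smul measurable_const (.sum _ fun i =>
      .smul (measurable_meas (hη i) hx) (.outer (hη i)))).sub
      (.smul (hx.norm.pow_const 2) (.const 1))).sub (.smul measurable_const (.outer hx))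
  refine MeasurableSet.inter ?_ ?_
  · exact measurableSet_le (((hQ.mul hD).mul hQ).mul hD).trace
      ((hx.norm.pow_const 4).const_mul _)
  · exact measurableSet_le ((((Finset.measurable_sum _ fun i _ =>
      measurable_meas (hη i) hx).const_mul _).sub (hx.norm.pow_const 2)).norm)
      ((hx.norm.pow_const 2).const_mul _)

theorem measurableSet_coeffGood (S : Matrix (Fin r) (Fin r) ℝ)
    (N : Finset (EuclideanSpace ℝ (Fin r))) (R t : ℝ) :
    MeasurableSet {b : Fin q → EuclideanSpace ℝ (Fin r) | CoeffGood b S N R t} := by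
  have h : {b : Fin q → EuclideanSpace ℝ (Fin r) | CoeffGood b S N R t}
      = (⋂ k, {b | ‖b k‖ ^ 2 ≤ R}) ∩ ⋂ w ∈ N, {b | |1 / (q : ℝ) * ∑ k, inner ℝ (b k) w ^ 2
        - w.ofLp ⬝ᵥ S *ᵥ w.ofLp| ≤ t} := by
    ext b
    simp only [CoeffGood, Set.mem_inter_iff, Set.mem_iInter, Set.mem_ofPred_eq]
  rw [h]
  have hm : ∀ k, Measurable fun b : Fin q → EuclideanSpace ℝ (Fin r) => b k := measurable_pi_apply
  refine (MeasurableSet.iInter fun k => ?_).inter (Finset.measurableSet_biInter _ fun w _ => ?_)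
  · exact measurableSet_le ((hm k).norm.pow_const 2) measurable_const
  · have hw : Measurable fun b : Fin q → EuclideanSpace ℝ (Fin r) =>
        1 / (q : ℝ) * ∑ k, inner ℝ (b k) w ^ 2 - w.ofLp ⬝ᵥ S *ᵥ w.ofLp :=
      ((Finset.measurable_sum _ fun k _ => ((hm k).inner_const).pow_const 2).const_mul _).sub_const
          _
    exact measurableSet_le hw.norm measurable_const

/-- One stage of conditioning: a failure probability valid for every good value of the first
coordinate is added to that of the first coordinate. It is applied twice, to a given (U, b) and to
a^new given the rest. -/
theorem prod_measure_le_of_section_le {β : Type*} [MeasurableSpace β] {μ : Measure α}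
    [IsProbabilityMeasure μ] {ν : Measure β} [IsProbabilityMeasure ν] {G : Set α} {S : Set (α × β)}
    (hG : MeasurableSet G) (hS : MeasurableSet S) {c d : ENNReal} (hGc : μ Gᶜ ≤ c)
    (h : ∀ x ∈ G, ν (Prod.mk x ⁻¹' Sᶜ) ≤ d) :
    (μ.prod ν) {p | p.1 ∈ G ∧ p ∈ S}ᶜ ≤ c + d := by
  have hsub : {p : α × β | p.1 ∈ G ∧ p ∈ S}ᶜ ⊆ (Gᶜ ×ˢ Set.univ) ∪ (Sᶜ ∩ (G ×ˢ Set.univ)) := by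
    intro p hp
    by_cases h1 : p.1 ∈ G
    · exact Or.inr ⟨fun h2 => hp ⟨h1, h2⟩, h1, trivial⟩
    · exact Or.inl ⟨h1, trivial⟩
  refine (measure_mono hsub).trans ((measure_union_le _ _).trans (add_le_add ?_ ?_))
  · rw [Measure.prod_prod, measure_univ, mul_one]
    exact hGc
  · rw [Measure.prod_apply (hS.compl.inter (hG.prod .univ))]
    calc ∫⁻ x, ν (Prod.mk x ⁻¹' (Sᶜ ∩ G ×ˢ Set.univ)) ∂μ ≤ ∫⁻ _, d ∂μ := by
          refine lintegral_mono fun x => ?_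
          by_cases hx : x ∈ G
          · exact (measure_mono fun y hy => hy.1).trans (h x hx)
          · rw [show Prod.mk x ⁻¹' (Sᶜ ∩ G ×ˢ Set.univ) = (∅ : Set β) from
              Set.eq_empty_of_forall_notMem fun y hy => hx hy.2.1, measure_empty]
            exact zero_le
      _ = d := by rw [lintegral_const, measure_univ, mul_one]

end

/-! ### The good event, with free parameters -/

section

open Matrix

variable {n m q r mt : ℕ}

theorem le_of_transpose_mul_self_eq_one {U : Matrix (Fin n) (Fin r) ℝ} (hU : Uᵀ * U = 1) :
    r ≤ n := by
  have h := Matrix.rank_mul_le_right Uᵀ U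
  rw [hU, Matrix.rank_one, Fintype.card_fin] at h
  exact h.trans (by simpa using Matrix.rank_le_card_height U)

variable {Ω : Type*} [MeasurableSpace Ω] {P : Measure Ω}
  {U : Ω → Matrix (Fin n) (Fin r) ℝ} {b : Fin q → Ω → EuclideanSpace ℝ (Fin r)}
  {Λ : Fin q → Matrix (Fin r) (Fin r) ℝ} {c : ℝ}
  {a : Fin m → Fin q → Ω → EuclideanSpace ℝ (Fin n)} {anew : Fin mt → Ω → EuclideanSpace ℝ (Fin n)}

theorem IsMeasurementModel.measurable_pair (ha : IsMeasurementModel P a anew) :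
    Measurable fun ω => ((fun p : Fin m × Fin q => a p.1 p.2 ω), fun i => anew i ω) :=
  (measurable_pi_lambda _ fun p : Fin m × Fin q => ha.measurable_a p.1 p.2).prodMk
    (measurable_pi_lambda _ ha.measurable_anew)

theorem IsGaussianSignal.measurable_pair (hs : IsGaussianSignal P U b Λ c) :
    Measurable fun ω => ((fun i j => U ω i j), fun k => b k ω) :=
  hs.measurable_U.prodMk (measurable_pi_lambda _ hs.measurable_b)

theorem IsMeasurementModel.map_pair [IsProbabilityMeasure P] (ha : IsMeasurementModel P a anew) :
    P.map (fun ω => ((fun p : Fin m × Fin q => a p.1 p.2 ω), fun i => anew i ω))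
      = (Measure.pi fun _ : Fin m × Fin q => gaussE n).prod (Measure.pi fun _ : Fin mt => gaussE n)
          := by
  have h1 := ha.indep_a.map_fun_eq_pi_map
    (fun p : Fin m × Fin q => (ha.measurable_a p.1 p.2).aemeasurable)
  have h2 := ha.indep_anew.map_fun_eq_pi_map (fun i => (ha.measurable_anew i).aemeasurable)
  rw [ha.indep_a_anew.map_prod_eq_prod_map_map
    (measurable_pi_lambda _ fun p : Fin m × Fin q => ha.measurable_a p.1 p.2).aemeasurable
    (measurable_pi_lambda _ ha.measurable_anew).aemeasurable, h1, h2]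
  simp only [ha.law_a, ha.law_anew, multivariateGaussian_zero_one]

theorem map_triple [IsProbabilityMeasure P] (hs : IsGaussianSignal P U b Λ c)
    (ha : IsMeasurementModel P a anew)
    (hind : IndepFun (fun ω => ((fun i j => U ω i j), fun k => b k ω))
      (fun ω => ((fun p : Fin m × Fin q => a p.1 p.2 ω), fun i => anew i ω)) P) :
    P.map (fun ω => ((((fun i j => U ω i j), fun k => b k ω),
        fun p : Fin m × Fin q => a p.1 p.2 ω), fun i => anew i ω))
      = ((P.map fun ω => ((fun i j => U ω i j), fun k => b k ω)).prod
        (Measure.pi fun _ : Fin m × Fin q => gaussE n)).prod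
            (Measure.pi fun _ : Fin mt => gaussE n) := by
  have := Measure.isProbabilityMeasure_map (μ := P) hs.measurable_pair.aemeasurable
  have h1 := hind.map_prod_eq_prod_map_map hs.measurable_pair.aemeasurable
    ha.measurable_pair.aemeasurable
  rw [ha.map_pair] at h1
  rw [← ((measurePreserving_prodAssoc (P.map fun ω => ((fun i j => U ω i j), fun k => b k ω))
    (Measure.pi fun _ : Fin m × Fin q => gaussE n) (Measure.pi fun _ : Fin mt => gaussE n)).symm
      MeasurableEquiv.prodAssoc).map_eq, ← h1, Measure.map_map (MeasurableEquiv.measurable _)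
      (hs.measurable_pair.prodMk ha.measurable_pair)]
  rfl

theorem exists_event_output_le [IsProbabilityMeasure P] (hn : 2 ≤ n) (hr : 0 < r) (hq : 0 < q)
    (hm : 0 < m)
    (hs : IsGaussianSignal P U b Λ c) (ha : IsMeasurementModel P a anew)
    (hind : IndepFun (fun ω => ((fun i j => U ω i j), fun k => b k ω))
      (fun ω => ((fun p : Fin m × Fin q => a p.1 p.2 ω), fun i => anew i ω)) P)
    {W δ₀ s γ δ ε β : ℝ} (hW : 0 < W) (hΛW : ∀ k v, v ⬝ᵥ Λ k *ᵥ v ≤ W * (v ⬝ᵥ v))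
    (hγ : 0 < γ) (hγ' : 32 * γ = lamMin (avgCov Λ)) (hδ₀ : 0 ≤ δ₀) (hδ₀1 : δ₀ ≤ 1)
    (hδ₀W : 2 * (δ₀ * W) ≤ γ) (hδ : 0 < δ) (hδε : δ ≤ ε) (hε1 : ε < 1)
    (hR : γ * δ / 128 ≤ r * (W * s))
    (hnew : ∀ V : Matrix (Fin n) (Fin r) ℝ, Vᵀ * V = 1 → ∀ x : EuclideanSpace ℝ (Fin n),
      Measure.pi (fun _ : Fin mt => gaussE n) {η | ¬ NewGood (V * Vᵀ) x ε η} ≤ ENNReal.ofReal β) :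
    ∃ E : Set Ω, MeasurableSet E ∧
      P Eᶜ ≤ ENNReal.ofReal (q * r * Real.exp (1 - s / 8)
          + 2 * 5 ^ r * Real.exp (-(q * δ₀ ^ 2 / 16)))
        + ENNReal.ofReal (3 * q * Real.exp (-(m / 500000)) + 2 * 5 ^ n *
          Real.exp (-((γ * δ / 128) ^ 2 * (m * q) / (28512 * (r * (W * s)) ^ 2))))
        + q * ENNReal.ofReal β ∧
      ∀ ω ∈ E, ∀ (Uhat : Matrix (Fin n) (Fin r) ℝ) (xhat : Fin q → EuclideanSpace ℝ (Fin n)),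
        IsOutput (fun i k => a i k ω) (fun i => anew i ω) (fun k => mulE (U ω) (b k ω)) Uhat xhat →
        SE Uhat (U ω) ≤ δ ∧
        (∀ k, phaseDist (mulE (U ω) (b k ω)) (xhat k) ^ 2 ≤ 9 * ε * ‖mulE (U ω) (b k ω)‖ ^ 2) ∧
        normErr (fun k => mulE (U ω) (b k ω)) xhat ≤ 9 * ε := by
  obtain ⟨Nn, hNc, hN1, hN2⟩ := exists_sphere_net n
  obtain ⟨Nr, hMc, hM1, hM2⟩ := exists_sphere_net r
  set R := r * (W * s) with hRdef
  set τ := γ * δ / 128 with hτdef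
  have hτ : 0 < τ := by positivity
  have hε : 0 < ε := hδ.trans_le hδε
  have hSsymm : (avgCov Λ).IsSymm := by
    rw [avgCov]
    exact (isSymm_sum _ fun k _ => (hs.isDiag k).isSymm).smul _
  set sig : (Fin n → Fin r → ℝ) × (Fin q → EuclideanSpace ℝ (Fin r)) →
    Fin q → EuclideanSpace ℝ (Fin n) := fun p k => mulE (Matrix.of p.1) (p.2 k) with hsig
  have hsigm : ∀ k, Measurable fun p => sig p k := fun k =>
    measurable_mulE (fun i j => (measurable_pi_apply j).comp
      ((measurable_pi_apply i).comp measurable_fst)) ((measurable_pi_apply k).comp measurable_snd)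
  set G1 : Set ((Fin n → Fin r → ℝ) × (Fin q → EuclideanSpace ℝ (Fin r))) :=
    {p | (Matrix.of p.1)ᵀ * Matrix.of p.1 = 1 ∧ CoeffGood p.2 (avgCov Λ) Nr R (δ₀ * W)} with hG1
  set S2 : Set (((Fin n → Fin r → ℝ) × (Fin q → EuclideanSpace ℝ (Fin r))) ×
      (Fin m × Fin q → EuclideanSpace ℝ (Fin n))) :=
    {p | SubspaceGood (fun i k => p.2 (i, k)) (sig p.1) Nn τ} with hS2
  set S3 : Set ((((Fin n → Fin r → ℝ) × (Fin q → EuclideanSpace ℝ (Fin r))) ×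
      (Fin m × Fin q → EuclideanSpace ℝ (Fin n))) × (Fin mt → EuclideanSpace ℝ (Fin n))) :=
    {p | ∀ k, NewGood (specProj ((2 / γ) • (matYU (fun i k => p.1.2 (i, k)) (sig p.1.1)
      - bulk (fun i k => p.1.2 (i, k)) (sig p.1.1) • (1 : Matrix (Fin n) (Fin n) ℝ))))
        (sig p.1.1 k) ε p.2} with hS3
  have hG1m : MeasurableSet G1 := by
    refine MeasurableSet.inter ?_ ((measurableSet_coeffGood _ _ _ _).preimage measurable_snd)
    have hU : MeasurableEntries fun p : (Fin n → Fin r → ℝ) × (Fin q → EuclideanSpace ℝ (Fin r)) =>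
        (Matrix.of p.1)ᵀ * Matrix.of p.1 := by
      have h : MeasurableEntries fun p : (Fin n → Fin r → ℝ) × (Fin q → EuclideanSpace ℝ (Fin r)) =>
        Matrix.of p.1 := fun i j => (measurable_pi_apply j).comp
          ((measurable_pi_apply i).comp measurable_fst)
      exact h.transpose.mul h
    have h : {p : (Fin n → Fin r → ℝ) × (Fin q → EuclideanSpace ℝ (Fin r)) |
        (Matrix.of p.1)ᵀ * Matrix.of p.1 = 1} = ⋂ i, ⋂ j, {p |
            ((Matrix.of p.1)ᵀ * Matrix.of p.1) i j
          = (1 : Matrix (Fin r) (Fin r) ℝ) i j} := by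
      ext p
      simp only [Set.mem_iInter, Set.mem_ofPred_eq]
      exact Matrix.ext_iff.symm
    have h2 : MeasurableSet {p : (Fin n → Fin r → ℝ) × (Fin q → EuclideanSpace ℝ (Fin r)) |
        (Matrix.of p.1)ᵀ * Matrix.of p.1 = 1} := by
      rw [h]
      exact MeasurableSet.iInter fun i => MeasurableSet.iInter fun j =>
        measurableSet_eq_fun (hU i j) measurable_const
    exact h2
  have hS2m : MeasurableSet S2 := measurableSet_subspaceGood
    (fun i k => (measurable_pi_apply (i, k)).comp measurable_snd)
    (fun k => (hsigm k).comp measurable_fst) _ _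
  have ham : ∀ (i : Fin m) (k : Fin q), Measurable fun p :
      (((Fin n → Fin r → ℝ) × (Fin q → EuclideanSpace ℝ (Fin r))) ×
      (Fin m × Fin q → EuclideanSpace ℝ (Fin n))) × (Fin mt → EuclideanSpace ℝ (Fin n)) =>
      p.1.2 (i, k) := fun i k =>
    (measurable_pi_apply (i, k)).comp (measurable_snd.comp measurable_fst)
  have hxm : ∀ k : Fin q, Measurable fun p :
      (((Fin n → Fin r → ℝ) × (Fin q → EuclideanSpace ℝ (Fin r))) ×
      (Fin m × Fin q → EuclideanSpace ℝ (Fin n))) × (Fin mt → EuclideanSpace ℝ (Fin n)) =>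
      sig p.1.1 k := fun k => (hsigm k).comp (measurable_fst.comp measurable_fst)
  have hS3m : MeasurableSet S3 := by
    have h : S3 = ⋂ k, {p | NewGood (specProj ((2 / γ) • (matYU (fun i k => p.1.2 (i, k))
        (sig p.1.1)
      - bulk (fun i k => p.1.2 (i, k)) (sig p.1.1) • (1 : Matrix (Fin n) (Fin n) ℝ))))
        (sig p.1.1 k) ε p.2} := by
      ext p
      simp only [hS3, Set.mem_iInter, Set.mem_ofPred_eq]
    rw [h]
    refine MeasurableSet.iInter fun k => measurableSet_newGood (MeasurableEntries.specProj
      (.smul measurable_const ((measurableEntries_matYU ham hxm).sub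
        (.smul (measurable_bulk ham hxm) (.const 1))))) (hxm k) (fun i => ?_) ε
    exact (measurable_pi_apply i).comp measurable_snd
  have hspike : ∀ p ∈ {p : ((Fin n → Fin r → ℝ) × (Fin q → EuclideanSpace ℝ (Fin r))) ×
      (Fin m × Fin q → EuclideanSpace ℝ (Fin n)) | p.1 ∈ G1 ∧ p ∈ S2}, ∃ M F, IsPerturbedSpike
      (matYU (fun i k => p.2 (i, k)) (sig p.1)) (Matrix.of p.1.1) M F
      (bulk (fun i k => p.2 (i, k)) (sig p.1)) γ (γ * δ / 4) := by
    rintro p ⟨⟨hp1, hp2⟩, hp3⟩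
    rw [show γ * δ / 4 = 32 * τ by rw [hτdef]; ring]
    refine exists_isPerturbedSpike (by omega) hp1 hN1 hN2 hγ (fun v => ?_) hp3 hτ.le ?_
    · refine le_trans ?_ (hp2.le_sum_inner_sq hr hSsymm hM1 hM2 v)
      -- λ_min - 32 δ₀W ≥ 32γ - 16γ = 16γ, using 2δ₀W ≤ γ.
      exact mul_le_mul_of_nonneg_right (by linarith) (sq_nonneg _)
    · rw [hτdef]
      nlinarith
  set ρ := P.map (fun ω => ((fun i j => U ω i j), fun k => b k ω)) with hρ
  have hρ1 : IsProbabilityMeasure ρ := Measure.isProbabilityMeasure_map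
      hs.measurable_pair.aemeasurable
  have hcard : ∀ {k : ℕ} {N : Finset (EuclideanSpace ℝ (Fin k))}, N.card ≤ 5 ^ k →
      ((N.card : ℕ) : ℝ) ≤ 5 ^ k := fun h => by exact_mod_cast h
  have hb1 : ρ G1ᶜ ≤ ENNReal.ofReal (q * r * Real.exp (1 - s / 8)
      + 2 * 5 ^ r * Real.exp (-(q * δ₀ ^ 2 / 16))) := by
    rw [hρ, Measure.map_apply hs.measurable_pair hG1m.compl]
    have h1 := measure_not_coeffGood_le hq hr hs.posSemidef hs.measurable_b hs.law_b hs.indep_b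
      (s := s) hW hΛW hδ₀ hδ₀1 hM1
    have h2 : P {ω | ¬ (U ω)ᵀ * U ω = 1} = 0 := hs.orthonormal_U
    calc P _ ≤ P ({ω | ¬ (U ω)ᵀ * U ω = 1} ∪
          {ω | ¬ CoeffGood (fun k => b k ω) (avgCov Λ) Nr R (δ₀ * W)}) := by
          refine measure_mono fun ω hω => ?_
          by_contra hcon
          exact hω ⟨not_not.1 fun h => hcon (Or.inl h), not_not.1 fun h => hcon (Or.inr h)⟩
      _ ≤ _ := (measure_union_le _ _).trans (by rw [h2, zero_add])
      _ ≤ _ := by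
        refine h1.trans ?_
        refine ENNReal.ofReal_le_ofReal (add_le_add le_rfl ?_)
        have := hcard hMc
        gcongr
  have hb2 := prod_measure_le_of_section_le (ν := Measure.pi fun _ : Fin m × Fin q => gaussE n)
    hG1m hS2m hb1 (d := ENNReal.ofReal (3 * q * Real.exp (-(m / 500000)) + 2 * 5 ^ n *
          Real.exp (-(τ ^ 2 * (m * q) / (28512 * R ^ 2))))) fun p hp => by
    have h1 := measure_not_subspaceGood_le (N := Nn) (R := R) (τ := τ) hn hm hq (x := sig p)
      (fun k => by rw [hsig, norm_mulE hp.1]; exact hp.2.1 k) hτ hR hN1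
    refine le_trans h1 (ENNReal.ofReal_le_ofReal (add_le_add le_rfl ?_))
    have := hcard hNc
    gcongr
  have hb3 := prod_measure_le_of_section_le (ν := Measure.pi fun _ : Fin mt => gaussE n)
    ((hG1m.preimage measurable_fst).inter hS2m) hS3m hb2 (d := q * ENNReal.ofReal β) fun p hp => by
    obtain ⟨M, F, hMF⟩ := hspike p hp
    -- In this section U, b and a are fixed, so any choice of V turns the spectral projector into
    -- VV' with V deterministic, and `hnew` applies.
    obtain ⟨V, hV⟩ := exists_isTopEigenvectors (le_of_transpose_mul_self_eq_one hMF.orthonormal)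
      (isSymm_matYU (fun i k => p.2 (i, k)) (sig p.1))
    have hsub : Prod.mk p ⁻¹' S3ᶜ ⊆ ⋃ k, {η | ¬ NewGood (V * Vᵀ) (sig p.1 k) ε η} := by
      intro η hη
      by_contra hcon
      refine hη fun k => ?_
      change NewGood (specProj ((2 / γ) • (matYU (fun i k => p.2 (i, k)) (sig p.1)
        - bulk (fun i k => p.2 (i, k)) (sig p.1) • (1 : Matrix (Fin n) (Fin n) ℝ)))) _ _ _
      rw [hMF.specProj_eq hV]
      exact not_not.1 fun h => hcon (Set.mem_iUnion.2 ⟨k, h⟩)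
    refine (measure_mono hsub).trans ((measure_iUnion_fintype_le _ _).trans
      ((Finset.sum_le_sum fun k _ => hnew V hV.transpose_mul_self (sig p.1 k)).trans ?_))
    simp
  have hΦm : Measurable (fun ω => ((((fun i j => U ω i j), fun k => b k ω),
        fun p : Fin m × Fin q => a p.1 p.2 ω), fun i => anew i ω)) :=
    (hs.measurable_pair.prodMk (measurable_fst.comp ha.measurable_pair)).prodMk
      (measurable_snd.comp ha.measurable_pair)
  rw [← map_triple hs ha hind] at hb3
  have hEm := ((((hG1m.preimage measurable_fst).inter hS2m).preimage measurable_fst).inter hS3m)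
  refine ⟨_, hEm.preimage hΦm, ?_, ?_⟩
  · rw [← Set.preimage_compl]
    exact (Measure.le_map_apply hΦm.aemeasurable _).trans hb3
  · rintro ω ⟨h12, h3⟩ Uhat xhat hout
    obtain ⟨M, F, hMF⟩ := hspike _ h12
    exact IsPerturbedSpike.output_le (U := U ω) (b := fun k => b k ω) hr hMF hδ.le hδε hε hε1 h3
        hout

end

/-! ### Failure probabilities and sample sizes -/

section

open Matrix

theorem exp_neg_mul_log {n : ℕ} (hn : 0 < n) (k : ℕ) :
    Real.exp (-(k * Real.log n)) = 1 / (n : ℝ) ^ k := by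
  have h : (0 : ℝ) < n := by exact_mod_cast hn
  rw [Real.exp_neg, Real.exp_nat_mul, Real.exp_log h, one_div]

theorem one_le_log_natCast {n : ℕ} (hn : 5 ≤ n) : 1 ≤ Real.log n := by
  have h : (5 : ℝ) ≤ n := by exact_mod_cast hn
  rw [Real.le_log_iff_exp_le (by linarith)]
  linarith [Real.exp_one_lt_d9]

theorem five_pow_le_exp (k : ℕ) : (5 : ℝ) ^ k ≤ Real.exp (2 * k) := by
  rw [mul_comm, Real.exp_nat_mul]
  refine pow_le_pow_left₀ (by norm_num) ?_ k
  have h := Real.exp_one_gt_d9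
  rw [show (2 : ℝ) = 1 + 1 by norm_num, Real.exp_add]
  nlinarith

/-- The level 48 log n for the squared coordinates gives a tail of at most 3n^-6, which pays for the
qr ≤ qn coordinates; 4r log n in the other exponent pays for the net, as 5^r ≤ e^(2r). -/
theorem coeff_failure_le {n r q : ℕ} (hn : 5 ≤ n) (hr : 0 < r) (hrn : r ≤ n) {X : ℝ}
    (hX : 4 * r * Real.log n ≤ X) :
    (q : ℝ) * r * Real.exp (1 - 48 * Real.log n / 8) + 2 * 5 ^ r * Real.exp (-X)
      ≤ q / (n : ℝ) ^ 4 + 2 / (n : ℝ) ^ 2 := by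
  have hn' : (5 : ℝ) ≤ n := by exact_mod_cast hn
  have hr' : (1 : ℝ) ≤ r := by exact_mod_cast hr
  have hrn' : (r : ℝ) ≤ n := by exact_mod_cast hrn
  have hlog := one_le_log_natCast hn
  refine add_le_add ?_ ?_
  · have h1 : Real.exp (1 - 48 * Real.log n / 8) ≤ 3 * (1 / (n : ℝ) ^ 6) := by
      rw [← exp_neg_mul_log (by omega) 6, show 1 - 48 * Real.log n / 8
        = 1 + -((6 : ℕ) * Real.log n) by push_cast; ring, Real.exp_add]
      exact mul_le_mul_of_nonneg_right (by linarith [Real.exp_one_lt_d9]) (Real.exp_pos _).le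
    calc (q : ℝ) * r * Real.exp (1 - 48 * Real.log n / 8)
        ≤ (q : ℝ) * n * (3 * (1 / (n : ℝ) ^ 6)) := by gcongr
      _ = q / (n : ℝ) ^ 4 * (3 / n) := by field_simp
      _ ≤ q / (n : ℝ) ^ 4 * 1 := by
        refine mul_le_mul_of_nonneg_left ?_ (by positivity)
        rw [div_le_one (by linarith)]; linarith
      _ = _ := mul_one _
  · have h2 : (5 : ℝ) ^ r * Real.exp (-X) ≤ 1 / (n : ℝ) ^ 2 := by
      rw [← exp_neg_mul_log (by omega) 2]
      refine (mul_le_mul_of_nonneg_right (five_pow_le_exp r) (Real.exp_pos _).le).trans ?_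
      rw [← Real.exp_add]
      refine Real.exp_le_exp.2 ?_
      push_cast
      nlinarith
    calc 2 * (5 : ℝ) ^ r * Real.exp (-X) = 2 * ((5 : ℝ) ^ r * Real.exp (-X)) := by ring
      _ ≤ 2 * (1 / (n : ℝ) ^ 2) := by gcongr
      _ = _ := by ring

theorem subspace_failure_le {n q : ℕ} (hn : 5 ≤ n) {X Y : ℝ} (hX : 4 * Real.log n ≤ X)
    (hY : 4 * n ≤ Y) :
    3 * (q : ℝ) * Real.exp (-X) + 2 * 5 ^ n * Real.exp (-Y)
      ≤ 3 * q / (n : ℝ) ^ 4 + 2 * Real.exp (-(2 * n)) := by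
  refine add_le_add ?_ ?_
  · have h1 : Real.exp (-X) ≤ 1 / (n : ℝ) ^ 4 := by
      rw [← exp_neg_mul_log (by omega) 4]
      exact Real.exp_le_exp.2 (by push_cast; linarith)
    calc 3 * (q : ℝ) * Real.exp (-X) ≤ 3 * q * (1 / (n : ℝ) ^ 4) := by gcongr
      _ = _ := by ring
  · have h2 : (5 : ℝ) ^ n * Real.exp (-Y) ≤ Real.exp (-(2 * n)) := by
      refine (mul_le_mul_of_nonneg_right (five_pow_le_exp n) (Real.exp_pos _).le).trans ?_
      rw [← Real.exp_add]
      exact Real.exp_le_exp.2 (by linarith)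
    calc 2 * (5 : ℝ) ^ n * Real.exp (-Y) = 2 * ((5 : ℝ) ^ n * Real.exp (-Y)) := by ring
      _ ≤ _ := by gcongr

theorem new_failure_le {n r : ℕ} (hn : 5 ≤ n) {X Z K c : ℝ} (hX : 4 * Real.log n ≤ X) (hK : 0 < K)
    (hc : 0 < c) (hr : (r : ℝ) ^ 2 ≤ c * n) (hZ : K * c * (n : ℝ) ^ 5 ≤ Z ^ 50) :
    2 * Real.exp (-X) + 2 * (r : ℝ) ^ 2 * (K / Z ^ 50) ≤ 4 / (n : ℝ) ^ 4 := by
  have hn' : (5 : ℝ) ≤ n := by exact_mod_cast hn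
  have h1 : Real.exp (-X) ≤ 1 / (n : ℝ) ^ 4 := by
    rw [← exp_neg_mul_log (by omega) 4]
    exact Real.exp_le_exp.2 (by push_cast; linarith)
  have h2 : (r : ℝ) ^ 2 * (K / Z ^ 50) ≤ 1 / (n : ℝ) ^ 4 := by
    calc (r : ℝ) ^ 2 * (K / Z ^ 50) ≤ c * n * (K / (K * c * (n : ℝ) ^ 5)) := by gcongr
      _ = _ := by field_simp
  calc _ = 2 * Real.exp (-X) + 2 * ((r : ℝ) ^ 2 * (K / Z ^ 50)) := by ring
    _ ≤ 2 * (1 / (n : ℝ) ^ 4) + 2 * (1 / (n : ℝ) ^ 4) := by gcongr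
    _ = _ := by ring

/-- Put t = n^(1/10), so that √n = t⁵ and r² ≤ c_r² t⁴. Then m̃ε²/r² is at least a constant times t,
and t^50 = n^5. This is where r = O(n^(1/5)) is used. -/
theorem new_sample_pow_ge {n r mt : ℕ} (hn : 0 < n) (hr : 0 < r) {cr C K ε : ℝ} (hcr : 0 < cr)
    (hK : 0 < K) (hε : 0 < ε) (hrn : (r : ℝ) ≤ cr * (n : ℝ) ^ ((1 : ℝ) / 5))
    (hC : cr ^ 2 * ((1 + K) * (1 + cr ^ 2)) ≤ C) (hmt : C * √n / ε ^ 2 ≤ mt) :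
    (r : ℝ) ^ 2 ≤ cr ^ 2 * n ∧ K * cr ^ 2 * (n : ℝ) ^ 5 ≤ (mt * (ε / r) ^ 2) ^ 50 := by
  have hn' : (1 : ℝ) ≤ n := by exact_mod_cast hn
  have hr' : (0 : ℝ) < r := by exact_mod_cast hr
  set t : ℝ := (n : ℝ) ^ ((1 : ℝ) / 10) with ht
  have ht1 : 1 ≤ t := Real.one_le_rpow hn' (by norm_num)
  have h10 : t ^ 10 = n := by
    rw [ht, ← Real.rpow_natCast, ← Real.rpow_mul (by linarith)]; norm_num
  have h5 : √(n : ℝ) = t ^ 5 := by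
    rw [← h10, show t ^ 10 = (t ^ 5) ^ 2 by ring, Real.sqrt_sq (by positivity)]
  have h2 : (n : ℝ) ^ ((1 : ℝ) / 5) = t ^ 2 := by
    rw [ht, ← Real.rpow_natCast, ← Real.rpow_mul (by linarith)]; norm_num
  rw [h2] at hrn
  rw [h5] at hmt
  have hsq : (r : ℝ) ^ 2 ≤ cr ^ 2 * t ^ 4 := by
    calc (r : ℝ) ^ 2 ≤ (cr * t ^ 2) ^ 2 := pow_le_pow_left₀ hr'.le hrn 2
      _ = _ := by ring
  refine ⟨hsq.trans ?_, ?_⟩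
  · rw [← h10]
    exact mul_le_mul_of_nonneg_left (pow_le_pow_right₀ ht1 (by norm_num)) (by positivity)
  have hZ : (1 + K) * (1 + cr ^ 2) * t ≤ mt * (ε / r) ^ 2 := by
    rw [div_le_iff₀ (by positivity)] at hmt
    rw [div_pow, mul_div_assoc', le_div_iff₀ (by positivity)]
    calc (1 + K) * (1 + cr ^ 2) * t * (r : ℝ) ^ 2
        ≤ (1 + K) * (1 + cr ^ 2) * t * (cr ^ 2 * t ^ 4) := by gcongr
      _ = cr ^ 2 * ((1 + K) * (1 + cr ^ 2)) * t ^ 5 := by ring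
      _ ≤ C * t ^ 5 := by gcongr
      _ ≤ _ := hmt
  calc K * cr ^ 2 * (n : ℝ) ^ 5 = K * cr ^ 2 * t ^ 50 := by rw [← h10, ← pow_mul]
    _ ≤ ((1 + K) * (1 + cr ^ 2)) ^ 50 * t ^ 50 := by
      refine mul_le_mul_of_nonneg_right ?_ (by positivity)
      refine le_trans ?_ (le_self_pow₀ (by nlinarith [mul_pos hK (pow_pos hcr 2), pow_pos hcr 2])
        (by norm_num))
      nlinarith [mul_pos hK (pow_pos hcr 2), pow_pos hcr 2]
    _ = ((1 + K) * (1 + cr ^ 2) * t) ^ 50 := (mul_pow _ _ _).symm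
    _ ≤ _ := pow_le_pow_left₀ (by positivity) hZ 50

/-- The exponent is (τ/R)² M/28512 with τ = λ_min ε/(4096 rL), 4096 = 32 · 128, and R = 48 r c λ_max
l. The squared ratio produces κ², r⁴, L² and l², and the factor n beats the 5^n points of the net.
-/
theorem four_mul_le_subspace_exponent {n r L l lmax lmin c C ε M : ℝ} (hn : 0 < n) (hr : 0 < r)
    (hL : 0 < L) (hl : 0 < l) (hmax : 0 < lmax) (hmin : 0 < lmin) (hc : 0 < c) (hε : 0 < ε)
    (hC : 4 * (28512 * 4096 ^ 2 * 48 ^ 2) * c ^ 2 ≤ C)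
    (hM : C * (lmax / lmin) ^ 2 * n * r ^ 4 * L ^ 2 * l ^ 2 / ε ^ 2 ≤ M) :
    4 * n ≤ (lmin / 32 * (ε / (r * L)) / 128) ^ 2 * M
      / (28512 * (r * (c * lmax * (48 * l))) ^ 2) := by
  rw [le_div_iff₀ (by positivity)]
  calc 4 * n * (28512 * (r * (c * lmax * (48 * l))) ^ 2)
      = (lmin / 32 * (ε / (r * L)) / 128) ^ 2 *
        (4 * (28512 * 4096 ^ 2 * 48 ^ 2) * c ^ 2 * (lmax / lmin) ^ 2 * n * r ^ 4 * L ^ 2 * l ^ 2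
          / ε ^ 2) := by
        field_simp
        ring
    _ ≤ (lmin / 32 * (ε / (r * L)) / 128) ^ 2 *
        (C * (lmax / lmin) ^ 2 * n * r ^ 4 * L ^ 2 * l ^ 2 / ε ^ 2) := by gcongr
    _ ≤ _ := by gcongr

theorem four_mul_le_coeff_exponent {r L l lmax lmin c C ε q : ℝ} (hr : 1 ≤ r)
    (hL : 1 ≤ L) (hl : 0 < l) (hmax : 0 < lmax) (hmin : 0 < lmin) (hc : 0 < c) (hε : 0 < ε)
    (hε1 : ε < 1) (hC : 4 * 65536 * c ^ 2 ≤ C)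
    (hq : C * (lmax / lmin) ^ 2 * r ^ 3 * l * L ^ 2 / ε ^ 2 ≤ q) :
    4 * r * l ≤ q * (lmin / (64 * (c * lmax))) ^ 2 / 16 := by
  have h1 : r ≤ r ^ 3 := le_self_pow₀ hr (by norm_num)
  have h2 : 1 ≤ L ^ 2 := one_le_pow₀ hL
  have h3 : ε ^ 2 ≤ 1 := pow_le_one₀ hε.le hε1.le
  have hC0 : 0 < C := lt_of_lt_of_le (by positivity) hC
  rw [le_div_iff₀ (by norm_num)]
  calc 4 * r * l * 16 = 4 * 65536 * c ^ 2 * (lmax / lmin) ^ 2 * r * l * 1 / 1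
        * (lmin / (64 * (c * lmax))) ^ 2 := by
        field_simp
        ring
    _ ≤ C * (lmax / lmin) ^ 2 * r ^ 3 * l * L ^ 2 / ε ^ 2
        * (lmin / (64 * (c * lmax))) ^ 2 := by gcongr
    _ ≤ _ := by gcongr

end

/-! ### Choice of parameters -/

section

open Matrix

theorem exists_event_of_sample_sizes {Ω : Type*} [MeasurableSpace Ω] {P : Measure Ω}
    [IsProbabilityMeasure P] {n r q m mt : ℕ} {ε C c cr cΛ K : ℝ}
    {U : Ω → Matrix (Fin n) (Fin r) ℝ} {b : Fin q → Ω → EuclideanSpace ℝ (Fin r)}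
    {Λ : Fin q → Matrix (Fin r) (Fin r) ℝ} {a : Fin m → Fin q → Ω → EuclideanSpace ℝ (Fin n)}
    {anew : Fin mt → Ω → EuclideanSpace ℝ (Fin n)} (hcr : 0 < cr) (hc : 1 ≤ c) (hcΛ : cΛ ≤ c)
    (hK : 0 < K) (hC1 : 4 * (28512 * 4096 ^ 2 * 48 ^ 2) * c ^ 2 ≤ C)
    (hC2 : cr ^ 2 * ((1 + K) * (1 + cr ^ 2)) ≤ C)
    (hnew : ∀ V : Matrix (Fin n) (Fin r) ℝ, Vᵀ * V = 1 → ∀ x : EuclideanSpace ℝ (Fin n),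
      Measure.pi (fun _ : Fin mt => gaussE n) {η | ¬ NewGood (V * Vᵀ) x ε η}
        ≤ ENNReal.ofReal (2 * Real.exp (-(mt * ε ^ 2 / 16))
          + 2 * (r : ℝ) ^ 2 * (K / (mt * (ε / r) ^ 2) ^ 50)))
    (hn5 : 5 ≤ n) (hr : 0 < r) (hrn : (r : ℝ) ≤ cr * (n : ℝ) ^ ((1 : ℝ) / 5)) (hε : 0 < ε)
    (hε1 : ε < 1) (hs : IsGaussianSignal P U b Λ cΛ) (hlam : 0 < lamMin (avgCov Λ))
    (ha : IsMeasurementModel P a anew)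
    (hind : IndepFun (fun ω => ((fun i j => U ω i j), fun k => b k ω))
      (fun ω => ((fun p : Fin m × Fin q => a p.1 p.2 ω), fun i => anew i ω)) P)
    (hmt : C * √n / ε ^ 2 ≤ mt)
    (hm : C * condNumber (avgCov Λ) ^ 2 * (r : ℝ) ^ 4 * Real.log mt ^ 2 / ε ^ 2 ≤ m)
    (hmq : C * condNumber (avgCov Λ) ^ 2 * n * (r : ℝ) ^ 4 * Real.log mt ^ 2 * Real.log n ^ 2
      / ε ^ 2 ≤ (m : ℝ) * q)
    (hq : C * condNumber (avgCov Λ) ^ 2 * (r : ℝ) ^ 3 * Real.log n * Real.log mt ^ 2 / ε ^ 2 ≤ q) :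
    ∃ E : Set Ω, MeasurableSet E ∧
      1 - (8 * q / (n : ℝ) ^ 4 + 2 / (n : ℝ) ^ 2 + 2 * Real.exp (-(2 * n))) ≤ P.real E ∧
      ∀ ω ∈ E, ∀ (Uhat : Matrix (Fin n) (Fin r) ℝ) (xhat : Fin q → EuclideanSpace ℝ (Fin n)),
        IsOutput (fun i k => a i k ω) (fun i => anew i ω) (fun k => mulE (U ω) (b k ω)) Uhat xhat →
        SE Uhat (U ω) ≤ ε / (r * Real.log mt) ∧
        (∀ k, phaseDist (mulE (U ω) (b k ω)) (xhat k) ^ 2 ≤ 9 * ε * ‖mulE (U ω) (b k ω)‖ ^ 2) ∧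
        normErr (fun k => mulE (U ω) (b k ω)) xhat ≤ 9 * ε := by
  have hn0 : 0 < n := by omega
  have hn0' : (0 : ℝ) < n := by exact_mod_cast hn0
  have hn' : (5 : ℝ) ≤ n := by exact_mod_cast hn5
  have hr' : (1 : ℝ) ≤ r := by exact_mod_cast hr
  have hl := one_le_log_natCast hn5
  have hcsq : 1 ≤ c ^ 2 := one_le_pow₀ hc
  have hcrK : 0 < cr ^ 2 * ((1 + K) * (1 + cr ^ 2)) := by positivity
  have hC0 : 4000000 ≤ C := by linarith
  set l := Real.log n with hldef
  have hε2 : ε ^ 2 ≤ 1 := pow_le_one₀ hε.le hε1.le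
  have hsqrt : 1 ≤ √(n : ℝ) := Real.one_le_sqrt.2 (by linarith)
  have hlsqrt : l ≤ 2 * √(n : ℝ) := by
    have h := Real.log_le_self (Real.sqrt_nonneg (n : ℝ))
    rw [Real.log_sqrt hn0'.le] at h
    linarith
  have hmt1 : 4000000 * √(n : ℝ) ≤ mt * ε ^ 2 := by
    rw [div_le_iff₀ (by positivity)] at hmt
    exact (mul_le_mul_of_nonneg_right hC0 (Real.sqrt_nonneg _)).trans hmt
  have hmt2 : 4000000 * √(n : ℝ) ≤ mt :=
    hmt1.trans (mul_le_of_le_one_right (Nat.cast_nonneg _) hε2)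
  have hmt0 : 0 < mt := by
    have : (0 : ℝ) < mt := by linarith
    exact_mod_cast this
  set L := Real.log mt with hLdef
  -- As m̃ ≥ e√n, log n is controlled by log m̃. Hence m ≥ 4000000 L² yields m/500000 ≥ 4 log n
  -- without a condition on m in terms of n.
  have hL : 1 + l / 2 ≤ L := by
    have h1 : Real.exp 1 * √(n : ℝ) ≤ mt := by
      refine le_trans ?_ hmt2
      gcongr
      linarith [Real.exp_one_lt_d9]
    have h2 := Real.log_le_log (by positivity) h1
    rwa [Real.log_mul (Real.exp_pos 1).ne' (by positivity), Real.log_exp,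
      Real.log_sqrt hn0'.le] at h2
  have hL1 : 1 ≤ L := by linarith
  have hLL : L ≤ L ^ 2 := le_self_pow₀ hL1 two_ne_zero
  have hsymm : (avgCov Λ).IsSymm := by
    rw [avgCov]
    exact (isSymm_sum _ fun k _ => (hs.isDiag k).isSymm).smul _
  set lmin := lamMin (avgCov Λ) with hlmin
  set lmax := lamMax (avgCov Λ) with hlmax
  have hle : lmin ≤ lmax := by
    obtain ⟨v, hv, -, hv2⟩ := exists_lamMax_eigenvector hr hsymm
    have h1 := lamMin_mul_le hsymm v
    have h2 := hv2 v
    rw [hv, mul_one] at h1 h2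
    exact h1.trans h2
  have hmax : 0 < lmax := hlam.trans_le hle
  have hκ : 1 ≤ (lmax / lmin) ^ 2 := one_le_pow₀ ((one_le_div hlam).2 hle)
  have hΛW : ∀ k v, v ⬝ᵥ (Λ k).mulVec v ≤ c * lmax * (v ⬝ᵥ v) := by
    intro k v
    obtain ⟨-, -, -, h1⟩ := exists_lamMax_eigenvector hr (hs.isDiag k).isSymm
    refine (h1 v).trans (mul_le_mul_of_nonneg_right ?_ (dotProduct_self_nonneg' v))
    exact (hs.lamMax_le k).trans (mul_le_mul_of_nonneg_right hcΛ hmax.le)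
  simp only [condNumber, ← hlmin, ← hlmax] at hm hmq hq
  have hmL : 4000000 * L ^ 2 ≤ m := by
    have hr4 : 1 ≤ (r : ℝ) ^ 4 := one_le_pow₀ hr'
    refine le_trans ?_ hm
    calc 4000000 * L ^ 2 = 4000000 * 1 * 1 * L ^ 2 / 1 := by ring
      _ ≤ C * (lmax / lmin) ^ 2 * (r : ℝ) ^ 4 * L ^ 2 / ε ^ 2 := by gcongr
  have hm0 : 0 < m := by
    have : (0 : ℝ) < m := by linarith
    exact_mod_cast this
  have hq0 : 0 < q := by
    have h : 0 < C * (lmax / lmin) ^ 2 * (r : ℝ) ^ 3 * l * L ^ 2 / ε ^ 2 := by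
      have : 0 < C := by linarith
      positivity
    have : (0 : ℝ) < q := h.trans_le hq
    exact_mod_cast this
  have hrn' : r ≤ n := by
    obtain ⟨ω, hω⟩ := hs.orthonormal_U.exists
    exact le_of_transpose_mul_self_eq_one hω
  obtain ⟨hr2, hZ⟩ := new_sample_pow_ge hn0 hr hcr hK hε hrn hC2 hmt
  have hδ : 0 < ε / (r * L) := by positivity
  have hδε : ε / (r * L) ≤ ε := div_le_self hε.le (one_le_mul_of_one_le_of_one_le hr' hL1)
  have hδ₀1 : lmin / (64 * (c * lmax)) ≤ 1 := by
    rw [div_le_one (by positivity)]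
    calc lmin ≤ 1 * (1 * lmax) := by linarith
      _ ≤ 64 * (c * lmax) := by gcongr; norm_num
  -- γ = λ_min/32, and δ₀ is chosen so that 2δ₀W = γ exactly. The accuracy δ = ε/(rL) is that of the
  -- first claim.
  obtain ⟨E, hE, hPE, hout⟩ := exists_event_output_le (W := c * lmax)
    (δ₀ := lmin / (64 * (c * lmax))) (s := 48 * l) (γ := lmin / 32) (δ := ε / (r * L)) (ε := ε)
    (by omega) hr hq0 hm0 hs ha hind (by positivity) hΛW (by positivity) (by ring) (by positivity)
    hδ₀1 (le_of_eq (by field_simp; norm_num)) hδ hδε hε1 (by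
      have h1 : lmin / 32 * (ε / (r * L)) ≤ lmin / 32 * 1 :=
        mul_le_mul_of_nonneg_left (hδε.trans hε1.le) (by positivity)
      have h2 : 1 * (1 * lmax * (48 * 1)) ≤ r * (c * lmax * (48 * l)) := by gcongr
      linarith)
    hnew
  have hX := four_mul_le_coeff_exponent hr' hL1 (by linarith) hmax hlam (by linarith) hε hε1
    ((mul_le_mul_of_nonneg_right (by norm_num) (sq_nonneg c)).trans hC1) hq
  have hb1 := coeff_failure_le (q := q) hn5 hr hrn' hX
  have hb2 := subspace_failure_le (q := q) hn5 (X := m / 500000) (by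
      rw [le_div_iff₀ (by norm_num)]
      linarith)
    (four_mul_le_subspace_exponent hn0' (by linarith) (by linarith) (by linarith) hmax hlam
      (by linarith) hε hC1 hmq)
  have hb3 := new_failure_le hn5 (X := mt * ε ^ 2 / 16) (by
      rw [le_div_iff₀ (by norm_num)]
      linarith) hK (by positivity) hr2 hZ
  have hbad : P Eᶜ ≤ ENNReal.ofReal (8 * q / (n : ℝ) ^ 4 + 2 / (n : ℝ) ^ 2
      + 2 * Real.exp (-(2 * n))) := by
    refine hPE.trans ?_
    rw [← ENNReal.ofReal_natCast q, ← ENNReal.ofReal_mul (Nat.cast_nonneg _),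
      ← ENNReal.ofReal_add (by positivity) (by positivity),
      ← ENNReal.ofReal_add (by positivity) (by positivity)]
    refine ENNReal.ofReal_le_ofReal ?_
    calc _ ≤ (q / (n : ℝ) ^ 4 + 2 / (n : ℝ) ^ 2) + (3 * q / (n : ℝ) ^ 4 + 2 * Real.exp (-(2 * n)))
          + q * (4 / (n : ℝ) ^ 4) :=
          add_le_add (add_le_add hb1 hb2) (mul_le_mul_of_nonneg_left hb3 (Nat.cast_nonneg _))
      _ = _ := by ring
  have hreal : 1 - (8 * q / (n : ℝ) ^ 4 + 2 / (n : ℝ) ^ 2 + 2 * Real.exp (-(2 * n))) ≤ P.real E :=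
      by
    have h1 := ENNReal.toReal_le_of_le_ofReal (by positivity) hbad
    have h2 := probReal_compl_eq_one_sub (μ := P) hE
    rw [measureReal_def] at h2
    linarith
  exact ⟨E, hE, hreal, hout⟩

end

end LRPR

end

theorem theorem2 (cr cΛ : ℝ) (hcr : 0 < cr) (hcΛ : 0 < cΛ) :
    ∃ C c C₁ C₂ : ℝ, 0 < C ∧ 0 < c ∧ 0 < C₁ ∧ 0 < C₂ ∧ ∀ cq : ℝ, 0 < cq → ∃ C₃ : ℝ, 0 < C₃ ∧
      ∀ (Ω : Type*) [MeasurableSpace Ω] (P : Measure Ω) [IsProbabilityMeasure P]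
        (n r q m mt : ℕ) (ε : ℝ)
        (U : Ω → Matrix (Fin n) (Fin r) ℝ) (b : Fin q → Ω → EuclideanSpace ℝ (Fin r))
        (Λ : Fin q → Matrix (Fin r) (Fin r) ℝ)
        (a : Fin m → Fin q → Ω → EuclideanSpace ℝ (Fin n))
        (anew : Fin mt → Ω → EuclideanSpace ℝ (Fin n)),
        0 < r → (r : ℝ) ≤ cr * (n : ℝ) ^ ((1 : ℝ) / 5) →
        0 < ε → ε < 1 →
        LRPR.IsGaussianSignal P U b Λ cΛ →
        0 < LRPR.lamMin (LRPR.avgCov Λ) →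
        LRPR.IsMeasurementModel P a anew →
        IndepFun (fun ω => ((fun i j => U ω i j), fun k => b k ω))
          (fun ω => ((fun p : Fin m × Fin q => a p.1 p.2 ω), fun i => anew i ω)) P →
        C * Real.sqrt n / ε ^ 2 ≤ (mt : ℝ) →
        C * LRPR.condNumber (LRPR.avgCov Λ) ^ 2 * (r : ℝ) ^ 4 * Real.log mt ^ 2 / ε ^ 2
          ≤ (m : ℝ) →
        C * LRPR.condNumber (LRPR.avgCov Λ) ^ 2 * (n : ℝ) * (r : ℝ) ^ 4 * Real.log mt ^ 2
          * Real.log n ^ 2 / ε ^ 2 ≤ (m : ℝ) * (q : ℝ) →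
        C * LRPR.condNumber (LRPR.avgCov Λ) ^ 2 * (r : ℝ) ^ 3 * Real.log n * Real.log mt ^ 2
          / ε ^ 2 ≤ (q : ℝ) →
        ∃ E : Set Ω, MeasurableSet E ∧
          1 - 2 * Real.exp (-(c * n)) - 36 * (q : ℝ) / (n : ℝ) ^ 4 - 20 / (n : ℝ) ^ 2
            ≤ P.real E ∧
          ((q : ℝ) ≤ cq * (n : ℝ) ^ 2 → 1 - C₃ / (n : ℝ) ^ 2 ≤ P.real E) ∧
          ∀ ω ∈ E, ∀ (Uhat : Matrix (Fin n) (Fin r) ℝ)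
            (xhat : Fin q → EuclideanSpace ℝ (Fin n)),
            LRPR.IsOutput (fun i k => a i k ω) (fun i => anew i ω)
              (fun k => LRPR.mulE (U ω) (b k ω)) Uhat xhat →
            LRPR.SE Uhat (U ω) ≤ C₁ * ε / ((r : ℝ) * Real.log mt) ∧
            (∀ k, LRPR.phaseDist (LRPR.mulE (U ω) (b k ω)) (xhat k) ^ 2
              ≤ C₂ * ε * ‖LRPR.mulE (U ω) (b k ω)‖ ^ 2) ∧
            LRPR.normErr (fun k => LRPR.mulE (U ω) (b k ω)) xhat ≤ C₂ * ε := by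
  obtain ⟨K, hK, hnew⟩ := LRPR.exists_measure_not_newGood_le
  obtain ⟨C, hC1, hC2, hC⟩ : ∃ C : ℝ, 4 * (28512 * 4096 ^ 2 * 48 ^ 2) * max cΛ 1 ^ 2 ≤ C ∧
      cr ^ 2 * ((1 + K) * (1 + cr ^ 2)) ≤ C ∧ 0 < C :=
    ⟨_, le_max_left _ _, le_max_right _ _, lt_max_of_lt_right (by positivity)⟩
  -- For C₃ = 36c_q + 22: the term in q costs at most 36c_q when q ≤ c_q n², and 22 covers both the
  -- remaining 2 + 2 and the value 20 needed for n < 5.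
  refine ⟨C, 2, 1, 9, hC, by norm_num, by norm_num, by norm_num, fun cq hcq =>
    ⟨36 * cq + 22, by positivity, ?_⟩⟩
  intro Ω _ P _ n r q m mt ε U b Λ a anew hr hrn hε hε1 hs hlam ha hind hmt hm hmq hq
  have hn0 : 0 < n := by
    rcases Nat.eq_zero_or_pos n with h | h
    · rw [h, Nat.cast_zero, Real.zero_rpow (by norm_num), mul_zero] at hrn
      have : (0 : ℝ) < r := by exact_mod_cast hr
      linarith
    · exact h
  have hn0' : (0 : ℝ) < n := by exact_mod_cast hn0
  -- For n ≤ 4 one has 20/n² ≥ 1, so the probability bounds are vacuous and the empty event serves.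
  rcases Nat.lt_or_ge n 5 with hn5 | hn5
  · have h1 : (n : ℝ) ^ 2 ≤ 16 := by
      have : (n : ℝ) ≤ 4 := by exact_mod_cast Nat.lt_succ_iff.1 hn5
      nlinarith
    have h2 : 1 ≤ 20 / (n : ℝ) ^ 2 := by rw [le_div_iff₀ (by positivity)]; linarith
    refine ⟨∅, MeasurableSet.empty, ?_, fun _ => ?_, fun ω hω => absurd hω (Set.notMem_empty ω)⟩
    · have h3 : 0 ≤ 36 * (q : ℝ) / (n : ℝ) ^ 4 := by positivity
      have h4 := Real.exp_pos (-(2 * (n : ℝ)))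
      rw [measureReal_empty]
      linarith
    · have h3 : 20 / (n : ℝ) ^ 2 ≤ (36 * cq + 22) / (n : ℝ) ^ 2 := by gcongr; linarith
      rw [measureReal_empty]
      linarith
  have hmt0 : 0 < mt := by
    have h : 0 < C * √(n : ℝ) / ε ^ 2 := by positivity
    have : (0 : ℝ) < mt := h.trans_le hmt
    exact_mod_cast this
  obtain ⟨E, hE, hreal, hout⟩ := LRPR.exists_event_of_sample_sizes hcr (le_max_right cΛ 1)
    (le_max_left cΛ 1) hK hC1 hC2 (fun V hV x => hnew n r mt (by omega) hr hmt0 V hV x ε hε hε1)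
    hn5 hr hrn hε hε1 hs hlam ha hind hmt hm hmq hq
  refine ⟨E, hE, ?_, fun hqn => ?_, ?_⟩
  · have h1 : 8 * (q : ℝ) / (n : ℝ) ^ 4 ≤ 36 * q / (n : ℝ) ^ 4 := by gcongr; norm_num
    have h2 : 2 / (n : ℝ) ^ 2 ≤ 20 / (n : ℝ) ^ 2 := by gcongr; norm_num
    linarith
  · have h1 : 8 * (q : ℝ) / (n : ℝ) ^ 4 ≤ 36 * cq / (n : ℝ) ^ 2 := by
      rw [div_le_div_iff₀ (by positivity) (by positivity)]
      calc 8 * (q : ℝ) * (n : ℝ) ^ 2 ≤ 36 * (cq * (n : ℝ) ^ 2) * (n : ℝ) ^ 2 := by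
            gcongr
            norm_num
        _ = _ := by ring
    have h2 : Real.exp (-(2 * n)) ≤ 1 / (n : ℝ) ^ 2 := by
      rw [← LRPR.exp_neg_mul_log hn0 2]
      refine Real.exp_le_exp.2 ?_
      have := Real.log_le_self hn0'.le
      push_cast
      linarith
    have h3 : (36 * cq + 22) / (n : ℝ) ^ 2
        = 36 * cq / (n : ℝ) ^ 2 + 2 / (n : ℝ) ^ 2 + 20 * (1 / (n : ℝ) ^ 2) := by ring
    have h4 : 0 ≤ 1 / (n : ℝ) ^ 2 := by positivity
    linarith
  · intro ω hω Uhat xhat h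
    have := hout ω hω Uhat xhat h
    rwa [one_mul]
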